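/- **Theorem (Correctness of the translation of the Fusion Calculus into Hoare SHR).** *Fusion Calculus.* Fix an infinite set $\mathcal N$ of names. Prefixes are $\alpha ::= u\vec x \mid \overline u\vec x\mid \phi$, where a fusion $\phi$ is an equivalence relation on names presented by a finite list of equalities (two presentations of the same equivalence relation are the same fusion). Agents are $P ::= 0 \mid \sum_i\alpha_i.P_i \mid P|P \mid (x)P\mid \mathrm{rec}\,X.P\mid X$, with finite sums (sequential agents), up to $\alpha$-conversion. They have guarded recursion: in $\mathrm{rec}\,X.P$ each occurrence of $X$ in $P$ is within a sequential agent. Closed agents have no free names (a name occurring in an equality of a fusion counts as occurring) and no free agent variables. Structural congruence $\equiv$ is the least congruence with: sums unordered, identity of presentations of a fusion, the abelian monoid laws for $|,0$, $(x)0\equiv0$, $(x)(y)P\equiv(y)(x)P$, $P|(z)Q\equiv(z)(P|Q)$ for $z\notin \mathrm{fn}(P)$, and $\mathrm{rec}\,X.P\equiv P\{\mathrm{rec}\,X.P/X\}$. A substitutive effect of a fusion $\phi$ is an idempotent substitution with kernel $\phi$. Reduction $\to$ is the least relation closed under $\equiv$ on both sides with $(\vec z)(R|(\dots+u\vec x.P)|(\overline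 u\vec y.Q+\dots))\to(\vec z)(R|P|Q)\sigma$ if $|\vec x|=|\vec y|$ and $\sigma$ is a substitutive effect of $\{\vec x=\vec y\}$ with $\mathrm{dom}(\sigma)\subseteq\vec z$, and $(\vec z)(R|(\dots+\phi.P))\to(\vec z)(R|P)\sigma$ if $\sigma$ is a substitutive effect of $\phi$ with $\mathrm{dom}(\sigma)\subseteq\vec z$. *HSHR.* A judgement $\Gamma\vdash G$ is a finite set $\Gamma$ of names (nodes) and a finite multiset $G$ of edges $L(x_1,\dots,x_{\mathrm{rank} L})$ with names $\mathrm n(G)\subseteq\Gamma$; $|$ is multiset union. A transition $\Gamma\vdash G\xrightarrow{\Lambda,\pi}\Phi\vdash G'$ has $\Lambda$ assigning to each $x\in\Gamma$ an action $\mathrm{act}_\Lambda(x)$ and a vector $\mathrm n_\Lambda(x)$ of names whose length is the arity of the action, and an idempotent $\pi:\Gamma\to\Gamma$ with $z\pi=z$ for every exposed name $z\in \mathrm n(\Lambda)=\bigcup_x \mathrm n_\Lambda(x)$; moreover $\Phi\supseteq\Gamma\pi\cup\Gamma_\Lambda$ with $\Gamma_\Lambda=\mathrm n(\Lambda)\setminus\Gamma$,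 and $\Phi\setminus(\Gamma\pi\cup\Gamma_\Lambda)\subseteq \mathrm n(G')$. Transitions are derived from a set of productions by the Hoare rules: (par) union of transitions with disjoint sets of nodes; (merge) if $\sigma:\Gamma\to\Gamma$ is an idempotent substitution with $\mathrm{act}_\Lambda(x)=\mathrm{act}_\Lambda(y)$ whenever $x\sigma=y\sigma$, $x\neq y$, then from $\Gamma\vdash G_1\xrightarrow{\Lambda,\pi}\Phi\vdash G_2$ infer $\Gamma\sigma\vdash G_1\sigma\xrightarrow{\Lambda',\pi'}\Phi'\vdash G_2\sigma\rho$, where $\rho$ is an idempotent most general unifier of $\{\mathrm n_\Lambda(x)\sigma=\mathrm n_\Lambda(y)\sigma\mid x\sigma=y\sigma\}\cup\{x\sigma=y\sigma\mid x\pi=y\pi\}$ choosing representatives in $\Gamma\sigma$ whenever possible, $\Lambda'(z\sigma)=\Lambda(z)\sigma\rho$, and $\pi'=\rho|_{\Gamma\sigma}$; (idle) $\Gamma\vdash G\xrightarrow{\Lambda_\epsilon,id}\Gamma\vdash G$, where $\Lambda_\epsilon$ assigns the idle action $\epsilon$ (of arity 0) everywhere; (new) adding to $\Gamma$ an isolated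 node $x\notin\Gamma$ exposing an arbitrary action with a vector $\vec y$ of names not in $\Gamma\cup\Phi\cup\{x\}$. *Translation.* Edge labels are $L_{\hat S}$ for standard linear sequential agents $\hat S$ (each free name occurs exactly once, and the free names are standard names $x_1,\dots,x_n$ in order of occurrence; rank $n$), $m_k$ of rank $k\ge2$, and $n$ of rank $1$. For a substitution $\sigma$ with finite domain let $[\![\sigma]\!]$ be the parallel composition of the edges $m_{k+1}(x,\sigma^{-1}(x))$, $k=|\sigma^{-1}(x)|$, over $x\in\mathrm{im}(\sigma)$. A normal form of an agent $P$ without free agent variables is an expression $(\vec x)P'\sigma\equiv P$ where $P'$ is a parallel composition of sequential agents, linear (each free name occurs exactly once), $\mathrm{fn}(P')$ (the domain of $\sigma$) is disjoint from $\mathrm{fn}(P'\sigma)$, the names $\vec x$ are distinct and occur in $P'\sigma$, and $\mathrm{fn}((\vec x)P'\sigma)\subseteq \mathrm{fn}(P)$. Let $\mathrm{fnarray}(P')$ be the vector of the free names of $P'$ in order of occurrence. For vectors $\vec v,\vec w$ of distinct names, disjoint from each other and from $\mathrm{fn}((\vec x)P'\sigma)$, with $|\vec v|=|\vec x|$ and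 $|\vec w|=|\mathrm{fnarray}(P')|$, the judgement $$\mathrm{fn}((\vec x)P'\sigma),\vec v,\vec w\ \vdash\ [\![P']\!]\{\vec w/\mathrm{fnarray}(P')\}\ \big|\ [\![\sigma]\!]\{\vec v/\vec x\}\{\vec w/\mathrm{fnarray}(P')\}\ \big|\ \textstyle\prod_{x\in\vec v}n(x)$$ is a translation $[\![P]\!]_{\vec v,\vec w}$ of $P$, where $[\![P']\!]$ has one edge $L_{\hat S}(x_1,\dots,x_n)\rho_S$ for each component $S=\hat S\rho_S$ of $P'$. *Productions.* Actions are $\epsilon$, $in_k$, $out_k$ (of arity $0,k,k$). Let $[\![u\vec x]\!]=(\Lambda,id)$ where $\Lambda$ has $(in_{|\vec x|},\vec x)$ on $u$ and $\epsilon$ elsewhere, $[\![\overline u\vec x]\!]$ likewise with $out_{|\vec x|}$, and $[\![\phi]\!]=(\Lambda_\epsilon,\pi)$ with $\pi$ any substitutive effect of $\phi$. The process productions are, for each standard linear $S=\sum_i\alpha_i.P_i$ and each $j$, instantiated at arbitrary distinct nodes $x_1,\dots,x_n$, $$x_1,\dots,x_n\vdash L_S(x_1,\dots,x_n)\xrightarrow{\Lambda,id}\Gamma\cup\{x_1,\dots,x_n\}\vdash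 G\,|\,[\![\xi]\!]\,|\,[\![\pi]\!]\,|\textstyle\prod_{x\in\Gamma''}n(x)$$ where $[\![\alpha_j]\!]=(\Lambda,\pi)$, $\xi$ is an injective renaming of $\mathrm{fn}(P_j)$ to fresh names, $\Gamma\vdash G$ is a translation $[\![P_j\xi]\!]_{\vec v,\vec w}$, the sets $\vec v\cup\vec w$, $\{x_1,\dots,x_n\}$, $\mathrm{fn}(P_j)\xi$ are pairwise disjoint, and $\Gamma''$ is the set of those $x_i$ that are not exposed by $\Lambda$, not identified with another name by $\pi$, and not in $\mathrm{fn}(P_j)$. The auxiliary productions are, for $k\ge 2$, distinct nodes $\vec s$ with $|\vec s|=k$, two distinct $x_1,x_2\in\vec s$ and vectors $\vec y_1,\vec y_2$ of $l$ pairwise distinct fresh names each, $$\vec s\vdash m_k(\vec s)\xrightarrow{\Lambda,id}\vec s,\vec y_1,\vec y_2\vdash m_k(\vec s)\,|\textstyle\prod_{i\le l}m_2(\vec y_1[i],\vec y_2[i])$$ where $\Lambda(x_1)=(in_l,\vec y_1)$, $\Lambda(x_2)=(out_l,\vec y_2)$ and $\Lambda$ is $\epsilon$ elsewhere. There are no productions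 for $n$ edges. *Amoeboids.* A structured amoeboid for a finite set $S$ of (external) nodes is a connected graph of $m$ and $n$ edges in which each node of $S$ is attached to exactly one edge, every other (internal) node is attached to exactly two edges, and every path (without repeated nodes or edges) between two distinct nodes of $S$ has an odd number of edges. A pseudoamoeboid is a structured amoeboid for $S=\emptyset$. **Statement.** Let $P$ be a closed agent with guarded recursion, let $P\to P'$, and let $[\![P]\!]_{\vec v,\vec w}$ be any translation of $P$. Then there are $\Lambda,\Gamma,G$ and an HSHR transition, derivable from the productions above, $$[\![P]\!]_{\vec v,\vec w}\xrightarrow{\Lambda,id}\Gamma\vdash G,$$ and a translation $[\![P']\!]_{\vec v',\vec w'}$ of $P'$, such that $\Gamma\vdash G$ equals $[\![P']\!]_{\vec v',\vec w'}$ up to isolated nodes, injective renaming, equivalence of amoeboids and pseudoamoeboids. That is: after an injective renaming of $\Gamma$, the graph $G$ is obtained from the graph of $[\![P']\!]_{\vec v',\vec w'}$ by replacing some edges $m_k(\vec s)$ by structured amoeboids for the set of the nodes $\vec s$ and adding pseudoamoeboids in parallel, where the internal nodes of the amoeboids and the nodes of the pseudoamoeboids do not occur in $[\![P']\!]_{\vec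 v',\vec w'}$ and are pairwise disjoint; isolated nodes of the two judgements are disregarded. -/

import Mathlib

namespace FusionSHR

universe u

/-! ## The Fusion Calculus

Bound names and agent variables are represented by the nested `Option` encoding:
`scope P` binds the name `none : Option ν`, `recX P` binds the agent variable
`none : Option χ`.  Hence alpha-conversion is syntactic identity. -/

/-- Prefixes over a set `ν` of names: input `u x⃗`, output `ū x⃗`, and fusions, given by a finite
set of equalities. -/
inductive Prefix (ν : Type) : Type
  | input (chan : ν) (xs : List ν)
  | output (chan : ν) (xs : List ν)
  | fusion (eqs : List (ν × ν))

/-- The equalities of a list of pairs, as a relation on names. -/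
def eqRel {ν : Type} (E : List (ν × ν)) : ν → ν → Prop := fun x y => (x, y) ∈ E

/-- Renaming of a prefix. -/
def Prefix.map {ν ν' : Type} (f : ν → ν') : Prefix ν → Prefix ν'
  | .input c xs => .input (f c) (xs.map f)
  | .output c xs => .output (f c) (xs.map f)
  | .fusion E => .fusion (E.map (Prod.map f f))

/-- The name occurrences of a prefix, from left to right. -/
def Prefix.occ {ν : Type} : Prefix ν → List ν
  | .input c xs => c :: xs
  | .output c xs => c :: xs
  | .fusion E => E.flatMap (fun p => [p.1, p.2])

/-- Two prefixes are the same if they are syntactically equal, or if they are two presentations of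
the same fusion (a fusion is an equivalence relation, presented by finitely many equalities). -/
inductive Prefix.Same {ν : Type} : Prefix ν → Prefix ν → Prop
  | refl (α : Prefix ν) : Prefix.Same α α
  | fusion (E F : List (ν × ν))
      (h : ∀ x y, Relation.EqvGen (eqRel E) x y ↔ Relation.EqvGen (eqRel F) x y) :
      Prefix.Same (.fusion E) (.fusion F)

/-- Agents with free names in `ν` and free agent variables in `χ`. The constructor `sum` is the
guarded sum `∑ i, αᵢ.Pᵢ`. -/
inductive Agent : Type → Type → Type 1
  | zero {ν χ : Type} : Agent ν χ
  | sum {ν χ : Type} (n : ℕ) (α : Fin n → Prefix ν) (P : Fin n → Agent ν χ) : Agent ν χ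
  | par {ν χ : Type} (P Q : Agent ν χ) : Agent ν χ
  | scope {ν χ : Type} (P : Agent (Option ν) χ) : Agent ν χ
  | recX {ν χ : Type} (P : Agent ν (Option χ)) : Agent ν χ
  | var {ν χ : Type} (X : χ) : Agent ν χ

namespace Agent

/-- Application of a substitution of names for the free names (capture-avoiding by
construction). -/
def map : {ν χ : Type} → Agent ν χ → {ν' : Type} → (ν → ν') → Agent ν' χ
  | _, _, zero, _, _ => zero
  | _, _, sum n α P, _, f => sum n (fun i => (α i).map f) (fun i => (P i).map f)
  | _, _, par P Q, _, f => par (P.map f) (Q.map f)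
  | _, _, scope P, _, f => scope (P.map (Option.map f))
  | _, _, recX P, _, f => recX (P.map f)
  | _, _, var X, _, _ => var X

/-- Renaming of free agent variables. -/
def mapVar : {ν χ : Type} → Agent ν χ → {χ' : Type} → (χ → χ') → Agent ν χ'
  | _, _, zero, _, _ => zero
  | _, _, sum n α P, _, f => sum n α (fun i => (P i).mapVar f)
  | _, _, par P Q, _, f => par (P.mapVar f) (Q.mapVar f)
  | _, _, scope P, _, f => scope (P.mapVar f)
  | _, _, recX P, _, f => recX (P.mapVar (Option.map f))
  | _, _, var X, _, f => var (f X)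

/-- Simultaneous capture-avoiding substitution of agents for agent variables. -/
def bind : {ν χ : Type} → Agent ν χ → {χ' : Type} → (χ → Agent ν χ') → Agent ν χ'
  | _, _, zero, _, _ => zero
  | _, _, sum n α P, _, f => sum n α (fun i => (P i).bind f)
  | _, _, par P Q, _, f => par (P.bind f) (Q.bind f)
  | _, _, scope P, _, f => scope (P.bind (fun X => (f X).map some))
  | _, _, recX P, _, f =>
      recX (P.bind (fun o => o.elim (var none) (fun X => (f X).mapVar some)))
  | _, _, var X, _, f => f X

/-- `P{Q/X}` for the most recently bound agent variable `X`. -/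
def subst {ν χ : Type} (P : Agent ν (Option χ)) (Q : Agent ν χ) : Agent ν χ :=
  P.bind (fun o => o.elim Q var)

/-- The occurrences of free names, from left to right. -/
def occ : {ν χ : Type} → Agent ν χ → List ν
  | _, _, zero => []
  | _, _, sum n α P => (List.finRange n).flatMap (fun i => (α i).occ ++ (P i).occ)
  | _, _, par P Q => P.occ ++ Q.occ
  | _, _, scope P => P.occ.reduceOption
  | _, _, recX P => P.occ
  | _, _, var _ => []

/-- The agent variable `X` has a free occurrence which is not within a sequential agent. -/
def Unguarded : {ν χ : Type} → Agent ν χ → χ → Prop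
  | _, _, zero, _ => False
  | _, _, sum _ _ _, _ => False
  | _, _, par P Q, X => P.Unguarded X ∨ Q.Unguarded X
  | _, _, scope P, X => P.Unguarded X
  | _, _, recX P, X => P.Unguarded (some X)
  | _, _, var Y, X => X = Y

/-- All recursions of the agent are guarded. -/
def Guarded : {ν χ : Type} → Agent ν χ → Prop
  | _, _, zero => True
  | _, _, sum _ _ P => ∀ i, (P i).Guarded
  | _, _, par P Q => P.Guarded ∧ Q.Guarded
  | _, _, scope P => P.Guarded
  | _, _, recX P => P.Guarded ∧ ¬ P.Unguarded none
  | _, _, var _ => True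

/-- The agent has no free names. (That it has no free agent variables is expressed by
`χ = Empty`.) -/
def Closed {ν χ : Type} (P : Agent ν χ) : Prop := P.occ = []

/-- Structural congruence. -/
inductive Cong : {ν χ : Type} → Agent ν χ → Agent ν χ → Prop
  | refl {ν χ : Type} (P : Agent ν χ) : Cong P P
  | symm {ν χ : Type} {P Q : Agent ν χ} : Cong P Q → Cong Q P
  | trans {ν χ : Type} {P Q R : Agent ν χ} : Cong P Q → Cong Q R → Cong P R
  | sum {ν χ : Type} {n : ℕ} {α β : Fin n → Prefix ν} {P Q : Fin n → Agent ν χ} :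
      (∀ i, (α i).Same (β i)) → (∀ i, Cong (P i) (Q i)) → Cong (sum n α P) (sum n β Q)
  | par {ν χ : Type} {P P' Q Q' : Agent ν χ} :
      Cong P P' → Cong Q Q' → Cong (par P Q) (par P' Q')
  | scope {ν χ : Type} {P Q : Agent (Option ν) χ} : Cong P Q → Cong (scope P) (scope Q)
  | recX {ν χ : Type} {P Q : Agent ν (Option χ)} : Cong P Q → Cong (recX P) (recX Q)
  /- sums are unordered -/
  | sum_perm {ν χ : Type} {n : ℕ} (e : Equiv.Perm (Fin n)) (α : Fin n → Prefix ν)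
      (P : Fin n → Agent ν χ) : Cong (Agent.sum n α P) (Agent.sum n (α ∘ e) (P ∘ e))
  | par_assoc {ν χ : Type} (P Q R : Agent ν χ) :
      Cong (Agent.par (Agent.par P Q) R) (Agent.par P (Agent.par Q R))
  | par_comm {ν χ : Type} (P Q : Agent ν χ) : Cong (Agent.par P Q) (Agent.par Q P)
  | par_zero {ν χ : Type} (P : Agent ν χ) : Cong (Agent.par P zero) P
  | scope_zero {ν χ : Type} : Cong (Agent.scope (zero : Agent (Option ν) χ)) zero
  | scope_swap {ν χ : Type} (P : Agent (Option (Option ν)) χ) :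
      Cong (Agent.scope (Agent.scope P))
        (Agent.scope (Agent.scope (P.map
          (fun o => o.elim (some none) (fun o' => o'.elim none (fun x => some (some x)))))))
  /- `P | (z)Q ≡ (z)(P | Q)` for `z` not free in `P`: here `P.map some` is `P` seen under the
  binder, where the bound name does not occur. -/
  | extrusion {ν χ : Type} (P : Agent ν χ) (Q : Agent (Option ν) χ) :
      Cong (Agent.par P (Agent.scope Q)) (Agent.scope (Agent.par (P.map some) Q))
  | unfold {ν χ : Type} (P : Agent ν (Option χ)) :
      Cong (Agent.recX P) (P.subst (Agent.recX P))

/-- The agent `(x)P` for a name `x`. -/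
def res {ν χ : Type} [DecidableEq ν] (x : ν) (P : Agent ν χ) : Agent ν χ :=
  scope (P.map (fun y => if y = x then none else some y))

/-- The agent `(x⃗)P`. -/
def scopes {ν χ : Type} [DecidableEq ν] (xs : List ν) (P : Agent ν χ) : Agent ν χ :=
  xs.foldr res P

/-- The parallel composition of a list of agents. -/
def parAll {ν χ : Type} (Ps : List (Agent ν χ)) : Agent ν χ := Ps.foldr par zero

end Agent

/-- `σ` is an idempotent substitution whose kernel is the equivalence relation generated by the
equations `r`. So `σ` is a substitutive effect of the fusion presented by `r`, or, equivalently, an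
idempotent most general unifier of the equations `r`. -/
def IsSubstEffect {ν : Type} (σ : ν → ν) (r : ν → ν → Prop) : Prop :=
  (∀ x, σ (σ x) = σ x) ∧ ∀ x y, σ x = σ y ↔ Relation.EqvGen r x y

/-- Reduction of the Fusion Calculus. -/
inductive Red {ν : Type} [DecidableEq ν] : Agent ν Empty → Agent ν Empty → Prop
  | comm (zs : List ν) (R : Agent ν Empty)
      (n : ℕ) (α : Fin n → Prefix ν) (P : Fin n → Agent ν Empty) (i : Fin n)
      (m : ℕ) (β : Fin m → Prefix ν) (Q : Fin m → Agent ν Empty) (j : Fin m)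
      (c : ν) (xs ys : List ν) (σ : ν → ν)
      (hα : α i = .input c xs) (hβ : β j = .output c ys) (hlen : xs.length = ys.length)
      (hσ : IsSubstEffect σ (eqRel (xs.zip ys))) (hdom : ∀ x, σ x ≠ x → x ∈ zs) :
      Red (.scopes zs (.par R (.par (.sum n α P) (.sum m β Q))))
        (.scopes zs ((Agent.par R (.par (P i) (Q j))).map σ))
  | fuse (zs : List ν) (R : Agent ν Empty)
      (n : ℕ) (α : Fin n → Prefix ν) (P : Fin n → Agent ν Empty) (i : Fin n)
      (E : List (ν × ν)) (σ : ν → ν) (hα : α i = .fusion E)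
      (hσ : IsSubstEffect σ (eqRel E)) (hdom : ∀ x, σ x ≠ x → x ∈ zs) :
      Red (.scopes zs (.par R (.sum n α P))) (.scopes zs ((Agent.par R (P i)).map σ))
  | struct {P P' Q' Q : Agent ν Empty} (h₁ : P.Cong P') (h₂ : Red P' Q') (h₃ : Q'.Cong Q) :
      Red P Q

/-! ## Synchronized hyperedge replacement with Hoare synchronization -/

/-- A ranked alphabet of edge labels. -/
class RankedAlphabet (L : Type u) where
  rank : L → ℕ

/-- A set of actions with arities and an idle action. -/
class ActionAlphabet (A : Type) where
  ar : A → ℕ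
  eps : A
  ar_eps : ar eps = 0

/-- An edge `L(x₁, …, xₙ)` with `n = rank L`. -/
@[ext] structure Edge (L : Type u) [RankedAlphabet L] (𝒩 : Type) where
  label : L
  att : List 𝒩
  att_length : att.length = RankedAlphabet.rank label

/-- Graph terms up to structural congruence (associativity, commutativity and identity of parallel
composition), that is, finite multisets of edges; parallel composition is `+`. -/
abbrev Graph (L : Type u) [RankedAlphabet L] (𝒩 : Type) := Multiset (Edge L 𝒩)

section HSHR

variable {L : Type u} [RankedAlphabet L] {A : Type} [ActionAlphabet A] {𝒩 : Type} [DecidableEq 𝒩]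

/-- Renaming of an edge. -/
def Edge.rename (f : 𝒩 → 𝒩) (e : Edge L 𝒩) : Edge L 𝒩 :=
  ⟨e.label, e.att.map f, by rw [List.length_map]; exact e.att_length⟩

/-- Renaming of a graph. -/
def Graph.rename (f : 𝒩 → 𝒩) (G : Graph L 𝒩) : Graph L 𝒩 := Multiset.map (Edge.rename f) G

/-- The names occurring in a graph. -/
def Graph.names (G : Graph L 𝒩) : Finset 𝒩 :=
  (Multiset.bind G (fun e => (e.att : Multiset 𝒩))).toFinset

variable (L 𝒩) in
/-- Well-formed syntactic judgements `Γ ⊢ G`. -/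
@[ext] structure Judgement where
  Γ : Finset 𝒩
  G : Graph L 𝒩
  wf : Graph.names G ⊆ Γ

variable (L A 𝒩) in
/-- Transitions `Γ ⊢ G --Λ,π--> Φ ⊢ G'`. The functions `Λ` and `π` on `Γ` are extended to all
names by the idle action and by the identity. -/
structure Transition where
  src : Judgement L 𝒩
  Λ : 𝒩 → A × List 𝒩
  π : 𝒩 → 𝒩
  tgt : Judgement L 𝒩
  arity : ∀ x ∈ src.Γ, (Λ x).2.length = ActionAlphabet.ar (Λ x).1
  Λ_out : ∀ x, x ∉ src.Γ → Λ x = (ActionAlphabet.eps, [])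
  π_mem : ∀ x ∈ src.Γ, π x ∈ src.Γ
  π_out : ∀ x, x ∉ src.Γ → π x = x
  π_idem : ∀ x, π (π x) = π x
  /-- only references to representatives are exposed -/
  exposed_rep : ∀ x ∈ src.Γ, ∀ z ∈ (Λ x).2, π z = z
  /-- nodes are never erased -/
  nodes_kept : ∀ x ∈ src.Γ, π x ∈ tgt.Γ
  fresh_kept : ∀ x ∈ src.Γ, ∀ z ∈ (Λ x).2, z ∉ src.Γ → z ∈ tgt.Γ
  /-- no isolated internal nodes are created -/
  no_isolated : ∀ z ∈ tgt.Γ, z ∉ src.Γ.image π →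
    ¬ (z ∉ src.Γ ∧ ∃ x ∈ src.Γ, z ∈ (Λ x).2) → z ∈ Graph.names tgt.G

/-- The equations
`{n_Λ(x)σ = n_Λ(y)σ | xσ = yσ} ∪ {xσ = yσ | xπ = yπ}` of the merge rule. -/
def mergeEqs (t : Transition L A 𝒩) (σ : 𝒩 → 𝒩) (a b : 𝒩) : Prop :=
  ∃ x ∈ t.src.Γ, ∃ y ∈ t.src.Γ,
    (σ x = σ y ∧ (a, b) ∈ ((t.Λ x).2.map σ).zip ((t.Λ y).2.map σ)) ∨
    (t.π x = t.π y ∧ a = σ x ∧ b = σ y)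

/-- `Derives Prods t`: the transition `t` is derivable from the productions `Prods` by the rules for Hoare
synchronization. The set `Prods` is meant to contain the instances of its production schemas for all
choices of names. In the rules `merge` and `new` the nodes of the final judgement are determined by
the remaining data and the conditions on transitions. -/
inductive Derives (Prods : Set (Transition L A 𝒩)) : Transition L A 𝒩 → Prop
  | prod {t : Transition L A 𝒩} (h : t ∈ Prods) : Derives Prods t
  | par {t₁ t₂ t : Transition L A 𝒩} (h₁ : Derives Prods t₁) (h₂ : Derives Prods t₂)
      (hdisj : Disjoint (t₁.src.Γ ∪ t₁.tgt.Γ) (t₂.src.Γ ∪ t₂.tgt.Γ))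
      (hsrcΓ : t.src.Γ = t₁.src.Γ ∪ t₂.src.Γ) (hsrcG : t.src.G = t₁.src.G + t₂.src.G)
      (hΛ₁ : ∀ x ∈ t₁.src.Γ, t.Λ x = t₁.Λ x) (hΛ₂ : ∀ x ∈ t₂.src.Γ, t.Λ x = t₂.Λ x)
      (hπ₁ : ∀ x ∈ t₁.src.Γ, t.π x = t₁.π x) (hπ₂ : ∀ x ∈ t₂.src.Γ, t.π x = t₂.π x)
      (htgtΓ : t.tgt.Γ = t₁.tgt.Γ ∪ t₂.tgt.Γ) (htgtG : t.tgt.G = t₁.tgt.G + t₂.tgt.G) :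
      Derives Prods t
  | merge {t t' : Transition L A 𝒩} (h : Derives Prods t) (σ ρ : 𝒩 → 𝒩)
      (hσ_mem : ∀ x ∈ t.src.Γ, σ x ∈ t.src.Γ) (hσ_out : ∀ x, x ∉ t.src.Γ → σ x = x)
      (hσ_idem : ∀ x, σ (σ x) = σ x)
      (hact : ∀ x ∈ t.src.Γ, ∀ y ∈ t.src.Γ, σ x = σ y → x ≠ y → (t.Λ x).1 = (t.Λ y).1)
      (hρ : IsSubstEffect ρ (mergeEqs t σ))
      (hρ_rep : ∀ z, ∀ y ∈ t.src.Γ.image σ, ρ y = ρ z → ρ z ∈ t.src.Γ.image σ)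
      (hsrcΓ : t'.src.Γ = t.src.Γ.image σ) (hsrcG : t'.src.G = Graph.rename σ t.src.G)
      (hΛ : ∀ z ∈ t.src.Γ, t'.Λ (σ z) = ((t.Λ z).1, (t.Λ z).2.map (ρ ∘ σ)))
      (hπ : ∀ z ∈ t.src.Γ.image σ, t'.π z = ρ z)
      (htgtG : t'.tgt.G = Graph.rename (ρ ∘ σ) t.tgt.G) : Derives Prods t'
  | idle {t : Transition L A 𝒩} (hΛ : ∀ x, t.Λ x = (ActionAlphabet.eps, []))
      (hπ : t.π = id) (htgt : t.tgt = t.src) : Derives Prods t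
  | new {t t' : Transition L A 𝒩} (h : Derives Prods t) (x : 𝒩) (a : A) (ys : List 𝒩)
      (hx : x ∉ t.src.Γ) (hys : ∀ y ∈ ys, y ∉ t.src.Γ ∧ y ∉ t.tgt.Γ ∧ y ≠ x)
      (hsrcΓ : t'.src.Γ = insert x t.src.Γ) (hsrcG : t'.src.G = t.src.G)
      (hΛ : t'.Λ = Function.update t.Λ x (a, ys)) (hπ : t'.π = t.π)
      (htgtG : t'.tgt.G = t.tgt.G) : Derives Prods t'

end HSHR

/-! ## Sequential agents and the alphabets of the translation -/

/-- Sequential agents `∑ i, αᵢ.Pᵢ` without free agent variables. -/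
structure Seq (ν : Type) where
  n : ℕ
  pre : Fin n → Prefix ν
  cont : Fin n → Agent ν Empty

namespace Seq

def toAgent {ν : Type} (S : Seq ν) : Agent ν Empty := .sum S.n S.pre S.cont

def map {ν ν' : Type} (f : ν → ν') (S : Seq ν) : Seq ν' :=
  ⟨S.n, fun i => (S.pre i).map f, fun i => (S.cont i).map f⟩

/-- The occurrences of free names, from left to right. -/
def occ {ν : Type} (S : Seq ν) : List ν := S.toAgent.occ

/-- The standard form of a (linear) sequential agent: its names are replaced by the standard names
`0, 1, 2, …` in the order of their occurrences. -/
def std {ν : Type} [DecidableEq ν] (S : Seq ν) : Seq ℕ := S.map (fun x => S.occ.idxOf x)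

end Seq

theorem Prefix.occ_map {ν ν' : Type} (f : ν → ν') (α : Prefix ν) :
    (α.map f).occ = α.occ.map f := by
  cases α with
  | input c xs => simp [Prefix.map, Prefix.occ]
  | output c xs => simp [Prefix.map, Prefix.occ]
  | fusion E => simp [Prefix.map, Prefix.occ, List.flatMap_map, List.map_flatMap]

theorem Agent.occ_map {ν χ : Type} (P : Agent ν χ) :
    ∀ {ν' : Type} (f : ν → ν'), (P.map f).occ = P.occ.map f := by
  induction P with
  | zero => intros; simp [Agent.map, Agent.occ]
  | sum n α P ih => intros; simp [Agent.map, Agent.occ, List.map_flatMap, ih, Prefix.occ_map]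
  | par P Q ihP ihQ => intros; simp [Agent.map, Agent.occ, ihP, ihQ]
  | scope P ih => intros; simp [Agent.map, Agent.occ, ih, List.reduceOption_map]
  | recX P ih => intros; simp [Agent.map, Agent.occ, ih]
  | var X => intros; simp [Agent.map, Agent.occ]

theorem Seq.occ_map {ν ν' : Type} (f : ν → ν') (S : Seq ν) : (S.map f).occ = S.occ.map f :=
  Agent.occ_map S.toAgent f

/-- Edge labels: `proc S` for (standard, linear) sequential agents `S`, the routers `m i`
of rank `i + 2`, and `n`, of rank one. -/
inductive Label : Type 1
  | proc (S : Seq ℕ)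
  | m (i : ℕ)
  | n

instance : RankedAlphabet Label where
  rank
    | .proc S => S.occ.length
    | .m i => i + 2
    | .n => 1

/-- The actions `ε`, `in_k` and `out_k`. -/
inductive Act : Type
  | eps
  | inp (k : ℕ)
  | out (k : ℕ)

instance : ActionAlphabet Act where
  ar
    | .eps => 0
    | .inp k => k
    | .out k => k
  eps := .eps
  ar_eps := rfl

section Translation

variable {𝒩 : Type} [DecidableEq 𝒩]

/-- The edge `m_{k+2}(x, y, z₁, …, z_k)`. -/
def mEdge (x y : 𝒩) (zs : List 𝒩) : Edge Label 𝒩 :=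
  ⟨.m zs.length, x :: y :: zs, rfl⟩

/-- The edge `n(x)`. -/
def nEdge (x : 𝒩) : Edge Label 𝒩 := ⟨.n, [x], rfl⟩

/-- The edge `L_Ŝ(x₁, …, xₙ)ρ`, for `Ŝ` with name occurrences `x₁, …, xₙ`. -/
def stdEdge (S : Seq ℕ) (ρ : ℕ → 𝒩) : Edge Label 𝒩 :=
  ⟨.proc S, S.occ.map ρ, by rw [List.length_map]; rfl⟩

/-- The translation `L_Ŝ(x₁, …, xₙ)ρ_S` of a linear sequential agent `S = Ŝρ_S`. -/
def procEdge (S : Seq 𝒩) : Edge Label 𝒩 :=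
  ⟨.proc S.std, S.occ, by
    change S.occ.length = S.std.occ.length
    rw [Seq.std, Seq.occ_map, List.length_map]⟩

/-- The translation of a substitution `σ` with (finite) domain `dom`: the parallel composition of
the edges `m_{k+1}(x, σ⁻¹(x))` with `k = |σ⁻¹(x)|`, over all `x` in the image of `σ`. -/
def substGraph (dom : List 𝒩) (σ : 𝒩 → 𝒩) : Graph Label 𝒩 :=
  Multiset.bind ((dom.map σ).dedup : Multiset 𝒩) (fun x =>
    match dom.filter (fun y => σ y = x) with
    | [] => 0
    | y :: ys => {mEdge x y ys})

/-- The simultaneous substitution `{bs/as}`. -/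
def vecSubst (as bs : List 𝒩) (x : 𝒩) : 𝒩 := (bs[as.idxOf x]?).getD x

/-- The free names of a parallel composition of sequential agents, in the order of their
occurrences. -/
def fnarray (Ss : List (Seq 𝒩)) : List 𝒩 := Ss.flatMap Seq.occ

/-- `(x⃗)P'σ` is a normal form of `P`, where `P'` is the parallel composition of the sequential
agents `Ss`. -/
structure IsNormalForm (P : Agent 𝒩 Empty) (xs : List 𝒩) (Ss : List (Seq 𝒩)) (σ : 𝒩 → 𝒩) :
    Prop where
  cong : (Agent.scopes xs (Agent.parAll (Ss.map (fun S => (S.map σ).toAgent)))).Cong P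
  /-- the restricted names are distinct and occur in `P'σ` -/
  nodup : xs.Nodup
  occurs : ∀ x ∈ xs, x ∈ (fnarray Ss).map σ
  /-- `P'` is linear -/
  linear : (fnarray Ss).Nodup
  /-- the names of `P'` are fresh -/
  fresh : ∀ x ∈ fnarray Ss, x ∉ (fnarray Ss).map σ
  /-- no free names are introduced (the presentation of a fusion might contain trivial equalities
  of further names) -/
  free : ∀ x ∈ (fnarray Ss).map σ, x ∉ xs → x ∈ P.occ

/-- The free names of `(x⃗)P'σ`. -/
def freeNames (xs : List 𝒩) (Ss : List (Seq 𝒩)) (σ : 𝒩 → 𝒩) : List 𝒩 :=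
  ((fnarray Ss).map σ).filter (fun x => x ∉ xs)

/-- The graph of the translation of `(x⃗)P'σ` with respect to `v⃗` and `w⃗`. -/
def translGraph (xs : List 𝒩) (Ss : List (Seq 𝒩)) (σ : 𝒩 → 𝒩) (v w : List 𝒩) :
    Graph Label 𝒩 :=
  Graph.rename (vecSubst (fnarray Ss) w) (Multiset.ofList (Ss.map procEdge)) +
    Graph.rename (vecSubst (xs ++ fnarray Ss) (v ++ w)) (substGraph (fnarray Ss) σ) +
    Multiset.ofList (v.map nEdge)

/-- `J` is a translation of `P` with respect to the vectors of nodes `v⃗` and `w⃗`. -/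
def IsTranslation (P : Agent 𝒩 Empty) (v w : List 𝒩) (J : Judgement Label 𝒩) : Prop :=
  ∃ (xs : List 𝒩) (Ss : List (Seq 𝒩)) (σ : 𝒩 → 𝒩),
    IsNormalForm P xs Ss σ ∧ v.length = xs.length ∧ w.length = (fnarray Ss).length ∧
    (freeNames xs Ss σ).Disjoint (v ++ w) ∧ (v ++ w).Nodup ∧
    J.Γ = (freeNames xs Ss σ ++ v ++ w).toFinset ∧ J.G = translGraph xs Ss σ v w

/-- The function assigning the action `a` with the names `ys` to `x` and the idle action to all
other names. -/
def single (x : 𝒩) (a : Act) (ys : List 𝒩) : 𝒩 → Act × List 𝒩 :=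
  Function.update (fun _ => (Act.eps, [])) x (a, ys)

/-- The translation `(Λ, π)` of a prefix. -/
inductive PrefixTransl : Prefix 𝒩 → (𝒩 → Act × List 𝒩) → (𝒩 → 𝒩) → Prop
  | input (c : 𝒩) (xs : List 𝒩) : PrefixTransl (.input c xs) (single c (.inp xs.length) xs) id
  | output (c : 𝒩) (xs : List 𝒩) : PrefixTransl (.output c xs) (single c (.out xs.length) xs) id
  | fusion (E : List (𝒩 × 𝒩)) (π : 𝒩 → 𝒩) (h : IsSubstEffect π (eqRel E)) :
      PrefixTransl (.fusion E) (fun _ => (Act.eps, [])) π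

open Classical in
/-- The nodes of `nodes` that are not exposed by `Λ`, not fused by `π` and not free in `P`. -/
noncomputable def closedNodes (nodes : List 𝒩) (Λ : 𝒩 → Act × List 𝒩) (π : 𝒩 → 𝒩)
    (P : Agent 𝒩 Empty) : List 𝒩 :=
  nodes.filter (fun x =>
    ¬ (∃ y, x ∈ (Λ y).2) ∧ ¬ (∃ y, y ≠ x ∧ π x = π y) ∧ x ∉ P.occ)

/-- Process productions, for each prefix `αⱼ` of a linear standard sequential agent `S`, at
pairwise distinct nodes given by `ρ`. The substitution `π` belonging to a fusion prefix is
implemented by routers in the final graph, and the fusion component of the production is the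
identity. -/
def IsProcessProduction (t : Transition Label Act 𝒩) : Prop :=
  ∃ (S : Seq ℕ) (ρ : ℕ → 𝒩) (j : Fin S.n) (Λ : 𝒩 → Act × List 𝒩) (π ξ : 𝒩 → 𝒩)
    (v w : List 𝒩) (K : Judgement Label 𝒩),
    let nodes : List 𝒩 := S.occ.map ρ
    let Pj : Agent 𝒩 Empty := (S.cont j).map ρ
    S.occ = List.range S.occ.length ∧ nodes.Nodup ∧
    PrefixTransl ((S.pre j).map ρ) Λ π ∧
    Set.InjOn ξ {x | x ∈ Pj.occ} ∧
    (∀ x ∈ Pj.occ, ξ x ∉ nodes ∧ ξ x ∉ v ++ w) ∧ nodes.Disjoint (v ++ w) ∧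
    IsTranslation (Pj.map ξ) v w K ∧
    t.src.Γ = nodes.toFinset ∧ t.src.G = {stdEdge S ρ} ∧ t.Λ = Λ ∧ t.π = id ∧
    t.tgt.Γ = K.Γ ∪ nodes.toFinset ∧
    t.tgt.G = K.G + substGraph Pj.occ ξ + substGraph (nodes.filter (fun x => π x ≠ x)) π +
      Multiset.ofList ((closedNodes nodes Λ π Pj).map nEdge)

/-- Auxiliary productions, for routers `m_k` with pairwise distinct nodes. -/
def IsAuxProduction (t : Transition Label Act 𝒩) : Prop :=
  ∃ (a b : 𝒩) (cs : List 𝒩) (x₁ x₂ : 𝒩) (y₁ y₂ : List 𝒩),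
    let nodes : List 𝒩 := a :: b :: cs
    (nodes ++ y₁ ++ y₂).Nodup ∧ x₁ ∈ nodes ∧ x₂ ∈ nodes ∧ x₁ ≠ x₂ ∧
    y₁.length = y₂.length ∧
    t.src.Γ = nodes.toFinset ∧ t.src.G = {mEdge a b cs} ∧
    t.Λ = Function.update (single x₁ (.inp y₁.length) y₁) x₂ (.out y₂.length, y₂) ∧ t.π = id ∧
    t.tgt.Γ = (nodes ++ y₁ ++ y₂).toFinset ∧
    t.tgt.G = mEdge a b cs ::ₘ
      Multiset.ofList (List.zipWith (fun y z => mEdge y z []) y₁ y₂)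

variable (𝒩) in
/-- The productions of the translation of the Fusion Calculus. There are none for `n` edges. -/
def productions : Set (Transition Label Act 𝒩) :=
  {t | IsProcessProduction t ∨ IsAuxProduction t}

/-! ## Structured amoeboids -/

/-- `IsWalk x p y`: the list `p` of pairs (edge, next node) describes a walk from `x` to `y`. -/
def IsWalk : 𝒩 → List (Edge Label 𝒩 × 𝒩) → 𝒩 → Prop
  | x, [], y => x = y
  | x, (e, z) :: p, y => x ∈ e.att ∧ z ∈ e.att ∧ IsWalk z p y

/-- A path in `M` is a walk through distinct nodes and distinct edges of `M` (edges of `M` being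
counted with their multiplicity). -/
def IsPath (M : Graph Label 𝒩) (x : 𝒩) (p : List (Edge Label 𝒩 × 𝒩)) (y : 𝒩) : Prop :=
  IsWalk x p y ∧ (x :: p.map Prod.snd).Nodup ∧
    Multiset.ofList (p.map Prod.fst) ≤ M

/-- The number of edges of `M` that are attached to `x`. -/
def edgeCount (M : Graph Label 𝒩) (x : 𝒩) : ℕ := Multiset.countP (fun e => x ∈ e.att) M

/-- `M` is a structured amoeboid with set of external nodes `S`. -/
structure IsAmoeboid (S : Finset 𝒩) (M : Graph Label 𝒩) : Prop where
  edges : ∀ e ∈ M, e.label = .n ∨ ∃ i, e.label = .m i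
  connected : ∀ x ∈ Graph.names M, ∀ y ∈ Graph.names M,
    ∃ p, IsWalk x p y ∧ ∀ q ∈ p, q.1 ∈ M
  external : ∀ x ∈ S, edgeCount M x = 1
  internal : ∀ x ∈ Graph.names M, x ∉ S → edgeCount M x = 2
  odd : ∀ x ∈ S, ∀ y ∈ S, x ≠ y → ∀ p, IsPath M x p y → Odd p.length

/-- `J` is equal to `J'` up to isolated nodes, an injective renaming, the replacement of simple
amoeboids of `J'` by structured amoeboids with the same external nodes, and pseudoamoeboids:
after an injective renaming `f`, the graph of `J` consists of the graph of `J'` where each router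
edge `a` of a list of pairs `(a, M)` is replaced by the structured amoeboid `M`, together with the
pseudoamoeboids in the list `Q` (amoeboids without external nodes), all internal nodes being new.
Since judgements are well-formed, disregarding isolated nodes means comparing only their graphs. -/
def EqualUpTo (J J' : Judgement Label 𝒩) : Prop :=
  ∃ (f : 𝒩 → 𝒩) (rest : Graph Label 𝒩) (As : List (Edge Label 𝒩 × Graph Label 𝒩))
    (Qs : List (Graph Label 𝒩)),
    Set.InjOn f (J.Γ : Set 𝒩) ∧
    J'.G = rest + Multiset.ofList (As.map Prod.fst) ∧
    Graph.rename f J.G = rest + (As.map Prod.snd).sum + Qs.sum ∧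
    (∀ p ∈ As, (∃ i, p.1.label = .m i) ∧ IsAmoeboid p.1.att.toFinset p.2) ∧
    (∀ M ∈ Qs, IsAmoeboid ∅ M) ∧
    (let internals : List (Finset 𝒩) :=
      As.map (fun p => Graph.names p.2 \ p.1.att.toFinset) ++ Qs.map Graph.names
    internals.Pairwise Disjoint ∧ ∀ I ∈ internals, Disjoint I (Graph.names J'.G))

end Translation

end FusionSHR

open FusionSHR

/-!
# Simulation of reductions of the Fusion Calculus by transitions of Hoare SHR

Let `(v)(Ss σ)` be a normal form of the closed agent `P`: the linear sequential agents `Ss` with the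
free names `w`, whose names are identified by `σ`, under the restriction of the names `v`. Its
translation consists of one edge for each member of `Ss`, one router for each name in `v`, which
connects this name with its preimages in `w`, and one `n` edge for each name in `v`. Since `P` is
closed, every translation has this form up to the choice of names
(`IsTranslation.exists_canonical`).

*Reductions are visible in the normal form.* A reduction is closed under structural congruence on
both sides, so its redex need not be a part of the given normal form. However, recursion is guarded,
so the sequential agents at the head of an agent can be computed by unfolding recursions once
(`Agent.Flat`), and they are invariant under structural congruence, up to their order, the choice of
bound names and the evident equivalence of sequential agents (`Agent.Cong.transfers`). Hence the
participants of the redex correspond to members of `Ss`, and the reduction is a communication of two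
members of `Ss` or a fusion of one of them (`Red.normalStep`). All names are restricted, so any
substitutive effect of the equations gives the reduct, up to structural congruence.

*Transitions.* A member of `Ss` that takes part in the step uses the process production of its
prefix (`exists_process_transition`). For a fusion this is all; for a communication, the two
subjects are preimages of the same name, and the router of this name supplies an auxiliary
production that exposes an input and an output complementary to those of the two agents. The three
transitions are put together with (par), on fresh copies of the shared nodes, and (merge), which
unifies the fresh names of the router with the objects of the prefixes (`exists_comm_transition`).
The rest of the graph is an idle context (`Derives.exists_context`). The unifiers that occur in
these merges fix all nodes, so the fusion component remains the identity.

*The result.* The continuations, renamed by `ξ`, are brought into a normal form `(vk)(Sk σk)`.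
Besides the edges of the members of `Ss` that are left and of `Sk`, the resulting graph contains the
routers of `σ` and `σk`, and the following edges: binary routers for the equations of the step,
binary routers for `ξ`, and `n` edges for `v`, for `vk` and for the names of the participants that
occur neither in the equations nor in the continuations. The routers of `σ` and `σk` are a matching:
each node is attached to exactly one of them. So are the other edges, apart from the free names of
the sequential agents, to which none of them is attached. Therefore a path alternates between the
two matchings, and a path that joins two nodes at which only the first matching is present has odd
length (`IsWalk.odd_length`). The connected components are amoeboids, and the external nodes of a
component are the names in the sequential agents that are identified by the normal form of the
reduct, together with a representative (`equalUpTo_of_matchings`, `exists_translation_equalUpTo`);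
components without such names are pseudoamoeboids.
-/

namespace FusionSHR

/-! ### Substitutions of names and of agents -/

theorem Prefix.map_map {ν ν' ν'' : Type} (f : ν → ν') (g : ν' → ν'') (α : Prefix ν) :
    (α.map f).map g = α.map (g ∘ f) := by
  cases α <;> simp [Prefix.map]

theorem Prefix.map_congr {ν ν' : Type} {f g : ν → ν'} (α : Prefix ν)
    (h : ∀ x ∈ α.occ, f x = g x) : α.map f = α.map g := by
  cases α with
  | input c xs => simp_all [Prefix.map, Prefix.occ]
  | output c xs => simp_all [Prefix.map, Prefix.occ]
  | fusion E =>
    simp only [Prefix.map, Prefix.fusion.injEq]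
    refine List.map_congr_left fun p hp => ?_
    have h1 : p.1 ∈ (Prefix.fusion E).occ :=
      List.mem_flatMap.2 ⟨p, hp, by simp⟩
    have h2 : p.2 ∈ (Prefix.fusion E).occ :=
      List.mem_flatMap.2 ⟨p, hp, by simp⟩
    exact Prod.ext (h _ h1) (h _ h2)

theorem Prefix.map_id {ν : Type} (α : Prefix ν) : α.map id = α := by
  cases α <;> simp [Prefix.map]

namespace Agent

theorem map_map {ν χ : Type} (P : Agent ν χ) :
    ∀ {ν' ν'' : Type} (f : ν → ν') (g : ν' → ν''), (P.map f).map g = P.map (g ∘ f) := by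
  induction P with
  | zero => intros; rfl
  | sum n α P ih => intros; simp [map, ih, Prefix.map_map]
  | par P Q ihP ihQ => intros; simp [map, ihP, ihQ]
  | scope P ih => intros; simp [map, ih, Option.map_comp_map]
  | recX P ih => intros; simp [map, ih]
  | var X => intros; rfl

theorem map_congr {ν χ : Type} (P : Agent ν χ) :
    ∀ {ν' : Type} {f g : ν → ν'}, (∀ x ∈ P.occ, f x = g x) → P.map f = P.map g := by
  induction P with
  | zero => intros; rfl
  | sum n α P ih =>
    intro ν' f g h
    simp only [occ, List.mem_flatMap, List.mem_append, List.mem_finRange, true_and] at h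
    simp only [map, sum.injEq, heq_eq_eq, true_and]
    exact ⟨funext fun i => Prefix.map_congr _ fun x hx => h x ⟨i, .inl hx⟩,
      funext fun i => ih i fun x hx => h x ⟨i, .inr hx⟩⟩
  | par P Q ihP ihQ =>
    intro ν' f g h
    simp only [occ, List.mem_append] at h
    simp only [map]
    rw [ihP fun x hx => h x (.inl hx), ihQ fun x hx => h x (.inr hx)]
  | scope P ih =>
    intro ν' f g h
    simp only [occ, List.reduceOption_mem_iff] at h
    simp only [map]
    rw [ih]
    rintro (_ | x) hx
    · rfl
    · simp [h x hx]
  | recX P ih =>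
    intro ν' f g h
    simp only [map]
    rw [ih h]
  | var X => intros; rfl

theorem map_id {ν χ : Type} (P : Agent ν χ) : P.map id = P := by
  induction P with
  | zero => rfl
  | sum n α P ih => simp [map, ih, Prefix.map_id]
  | par P Q ihP ihQ => simp [map, ihP, ihQ]
  | scope P ih => simp [map, ih, Option.map_id]
  | recX P ih => simp [map, ih]
  | var X => rfl

theorem map_eq_self {ν χ : Type} (P : Agent ν χ) {f : ν → ν} (h : ∀ x ∈ P.occ, f x = x) :
    P.map f = P := by
  rw [map_congr P (g := id) h, map_id]

theorem mapVar_map {ν χ : Type} (P : Agent ν χ) :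
    ∀ {χ' ν' : Type} (h : χ → χ') (f : ν → ν'), (P.mapVar h).map f = (P.map f).mapVar h := by
  induction P with
  | zero => intros; rfl
  | sum n α P ih => intros; simp [map, mapVar, ih]
  | par P Q ihP ihQ => intros; simp [map, mapVar, ihP, ihQ]
  | scope P ih => intros; simp [map, mapVar, ih]
  | recX P ih => intros; simp [map, mapVar, ih]
  | var X => intros; rfl

/-- Substitution for agent variables commutes with the application of a substitution of names. -/
theorem bind_map {ν χ : Type} (P : Agent ν χ) :
    ∀ {χ' ν' : Type} (g : χ → Agent ν χ') (f : ν → ν'),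
      (P.bind g).map f = (P.map f).bind (fun X => (g X).map f) := by
  induction P with
  | zero => intros; rfl
  | sum n α P ih => intros; simp [map, bind, ih]
  | par P Q ihP ihQ => intros; simp [map, bind, ihP, ihQ]
  | scope P ih =>
    intros
    simp only [map, bind, ih, map_map]
    congr
  | recX P ih =>
    intro χ' ν' g f
    simp only [map, bind, ih]
    congr 2
    funext o
    cases o <;> simp [map, mapVar_map]
  | var X => intros; rfl

theorem mapVar_bind {ν χ : Type} (P : Agent ν χ) :
    ∀ {χ' χ'' : Type} (h : χ → χ') (g : χ' → Agent ν χ''),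
      (P.mapVar h).bind g = P.bind (fun X => g (h X)) := by
  induction P with
  | zero => intros; rfl
  | sum n α P ih => intros; simp [mapVar, bind, ih]
  | par P Q ihP ihQ => intros; simp [mapVar, bind, ihP, ihQ]
  | scope P ih => intros; simp [mapVar, bind, ih]
  | recX P ih =>
    intro χ' χ'' h g
    simp only [mapVar, bind, ih]
    congr 2
    funext o
    cases o <;> simp
  | var X => intros; rfl

theorem bind_var {ν χ : Type} (P : Agent ν χ) : P.bind var = P := by
  induction P with
  | zero => rfl
  | sum n α P ih => simp [bind, ih]
  | par P Q ihP ihQ => simp [bind, ihP, ihQ]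
  | scope P ih => simp only [bind, map]; rw [ih]
  | recX P ih =>
    simp only [bind]
    conv_rhs => rw [← ih]
    congr 2
    funext o
    cases o <;> simp [mapVar]
  | var X => rfl

theorem mapVar_eq_bind {ν χ χ' : Type} (P : Agent ν χ) (h : χ → χ') :
    P.mapVar h = P.bind (fun X => var (h X)) := by
  conv_lhs => rw [← bind_var (P.mapVar h)]
  exact mapVar_bind P h var

theorem mapVar_mapVar {ν χ χ' χ'' : Type} (P : Agent ν χ) (h : χ → χ') (k : χ' → χ'') :
    (P.mapVar h).mapVar k = P.mapVar (k ∘ h) := by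
  rw [mapVar_eq_bind (P.mapVar h), mapVar_bind, mapVar_eq_bind]
  rfl

theorem bind_mapVar {ν χ : Type} (P : Agent ν χ) :
    ∀ {χ' χ'' : Type} (g : χ → Agent ν χ') (h : χ' → χ''),
      (P.bind g).mapVar h = P.bind (fun X => (g X).mapVar h) := by
  induction P with
  | zero => intros; rfl
  | sum n α P ih => intros; simp [mapVar, bind, ih]
  | par P Q ihP ihQ => intros; simp [mapVar, bind, ihP, ihQ]
  | scope P ih => intros; simp [mapVar, bind, ih, mapVar_map]
  | recX P ih =>
    intro χ' χ'' g h
    simp only [mapVar, bind, ih]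
    congr 2
    funext o
    cases o with
    | none => simp [mapVar]
    | some X => simp [mapVar_mapVar, Function.comp_def]
  | var X => intros; rfl

theorem bind_bind {ν χ : Type} (P : Agent ν χ) :
    ∀ {χ' χ'' : Type} (g : χ → Agent ν χ') (h : χ' → Agent ν χ''),
      (P.bind g).bind h = P.bind (fun X => (g X).bind h) := by
  induction P with
  | zero => intros; rfl
  | sum n α P ih => intros; simp [bind, ih]
  | par P Q ihP ihQ => intros; simp [bind, ihP, ihQ]
  | scope P ih => intros; simp [bind, ih, bind_map]
  | recX P ih =>
    intro χ' χ'' g h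
    simp only [bind, ih]
    congr 2
    funext o
    cases o with
    | none => simp [bind]
    | some X => simp [mapVar_bind, bind_mapVar]
  | var X => intros; rfl

theorem subst_map {ν χ ν' : Type} (P : Agent ν (Option χ)) (Q : Agent ν χ) (f : ν → ν') :
    (P.subst Q).map f = (P.map f).subst (Q.map f) := by
  simp only [subst, bind_map]
  congr 1
  funext o
  cases o <;> simp [map]

/-- The substitution lemma for agent variables. -/
theorem subst_bind {ν χ χ' : Type} (P : Agent ν (Option χ)) (Q : Agent ν χ)
    (g : χ → Agent ν χ') :
    (P.subst Q).bind g =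
      (P.bind (fun o => o.elim (var none) (fun X => (g X).mapVar some))).subst (Q.bind g) := by
  simp only [subst, bind_bind]
  congr 1
  funext o
  cases o with
  | none => simp [bind]
  | some X => simp [bind, mapVar_bind, bind_var]

end Agent

theorem Prefix.Same.symm {ν : Type} {α β : Prefix ν} (h : α.Same β) : β.Same α := by
  cases h with
  | refl => exact .refl _
  | fusion E F h => exact .fusion _ _ fun x y => (h x y).symm

theorem Prefix.Same.trans {ν : Type} {α β γ : Prefix ν} (h : α.Same β) (h' : β.Same γ) :
    α.Same γ := by
  cases h with
  | refl => exact h'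
  | fusion E F h =>
    cases h' with
    | refl => exact .fusion _ _ h
    | fusion _ G h' => exact .fusion _ _ fun x y => (h x y).trans (h' x y)

theorem eqvGen_map {ν ν' : Type} (f : ν → ν') {E F : List (ν × ν)}
    (h : ∀ x y, Relation.EqvGen (eqRel E) x y → Relation.EqvGen (eqRel F) x y) {x y : ν'}
    (hxy : Relation.EqvGen (eqRel (E.map (Prod.map f f))) x y) :
    Relation.EqvGen (eqRel (F.map (Prod.map f f))) x y := by
  have key : ∀ a b, Relation.EqvGen (eqRel F) a b →
      Relation.EqvGen (eqRel (F.map (Prod.map f f))) (f a) (f b) := by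
    intro a b hab
    induction hab with
    | rel a b hab => exact .rel _ _ (List.mem_map.2 ⟨(a, b), hab, rfl⟩)
    | refl a => exact .refl _
    | symm a b _ ih => exact ih.symm
    | trans a b c _ _ ih ih' => exact ih.trans _ _ _ ih'
  induction hxy with
  | rel a b hab =>
    obtain ⟨⟨a', b'⟩, hab', he⟩ := List.mem_map.1 hab
    cases he
    exact key _ _ (h _ _ (.rel _ _ hab'))
  | refl a => exact .refl _
  | symm a b _ ih => exact ih.symm
  | trans a b c _ _ ih ih' => exact ih.trans _ _ _ ih'

theorem Prefix.Same.map {ν ν' : Type} (f : ν → ν') {α β : Prefix ν} (h : α.Same β) :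
    (α.map f).Same (β.map f) := by
  cases h with
  | refl => exact .refl _
  | fusion E F h =>
    exact .fusion _ _ fun x y => ⟨eqvGen_map f fun x y => (h x y).1, eqvGen_map f fun x y => (h x y).2⟩

namespace Agent

theorem Cong.map {ν χ : Type} {P Q : Agent ν χ} (h : P.Cong Q) :
    ∀ {ν' : Type} (f : ν → ν'), (P.map f).Cong (Q.map f) := by
  induction h with
  | refl P => intros; exact .refl _
  | symm _ ih => intro ν' f; exact (ih f).symm
  | trans _ _ ih ih' => intro ν' f; exact (ih f).trans (ih' f)
  | sum hα _ ih => intro ν' f; exact .sum (fun i => (hα i).map f) fun i => ih i f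
  | par _ _ ih ih' => intro ν' f; exact .par (ih f) (ih' f)
  | scope _ ih => intro ν' f; exact .scope (ih _)
  | recX _ ih => intro ν' f; exact .recX (ih _)
  | sum_perm e α P => intro ν' f; exact .sum_perm e _ _
  | par_assoc P Q R => intro ν' f; exact .par_assoc _ _ _
  | par_comm P Q => intro ν' f; exact .par_comm _ _
  | par_zero P => intro ν' f; exact .par_zero _
  | scope_zero => intro ν' f; exact .scope_zero
  | scope_swap P =>
    intro ν' f
    have := Cong.scope_swap (P.map (Option.map (Option.map f)))
    simp only [Agent.map, map_map] at this ⊢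
    convert this using 4
    funext o
    rcases o with _ | _ | x <;> rfl
  | extrusion P Q =>
    intro ν' f
    have := Cong.extrusion (P.map f) (Q.map (Option.map f))
    simp only [Agent.map, map_map] at this ⊢
    exact this
  | unfold P =>
    intro ν' f
    have := Cong.unfold (P.map f)
    rw [subst_map]
    exact this

theorem Cong.bind_left {ν χ : Type} {P Q : Agent ν χ} (h : P.Cong Q) :
    ∀ {χ' : Type} (g : χ → Agent ν χ'), (P.bind g).Cong (Q.bind g) := by
  induction h with
  | refl P => intros; exact .refl _
  | symm _ ih => intro χ' f; exact (ih f).symm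
  | trans _ _ ih ih' => intro χ' f; exact (ih f).trans (ih' f)
  | sum hα _ ih => intro χ' f; exact .sum hα fun i => ih i f
  | par _ _ ih ih' => intro χ' f; exact .par (ih f) (ih' f)
  | scope _ ih => intro χ' f; exact .scope (ih _)
  | recX _ ih => intro χ' f; exact .recX (ih _)
  | sum_perm e α P => intro χ' f; exact .sum_perm e _ _
  | par_assoc P Q R => intro χ' f; exact .par_assoc _ _ _
  | par_comm P Q => intro χ' f; exact .par_comm _ _
  | par_zero P => intro χ' f; exact .par_zero _
  | scope_zero => intro χ' f; exact .scope_zero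
  | scope_swap P =>
    intro χ' f
    simp only [Agent.bind]
    refine (Cong.scope_swap _).trans ?_
    rw [bind_map]
    simp only [map_map]
    exact .refl _
  | extrusion P Q =>
    intro χ' f
    simp only [Agent.bind]
    refine (Cong.extrusion _ _).trans ?_
    rw [bind_map]
    exact .refl _
  | unfold P =>
    intro χ' f
    rw [subst_bind]
    exact Cong.unfold _

theorem Cong.mapVar {ν χ χ' : Type} {P Q : Agent ν χ} (h : P.Cong Q) (f : χ → χ') :
    (P.mapVar f).Cong (Q.mapVar f) := by
  rw [mapVar_eq_bind, mapVar_eq_bind]; exact h.bind_left _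

theorem bind_cong_right {ν χ : Type} (P : Agent ν χ) :
    ∀ {χ' : Type} {g h : χ → Agent ν χ'}, (∀ X, (g X).Cong (h X)) → (P.bind g).Cong (P.bind h) := by
  induction P with
  | zero => intros; exact .refl _
  | sum n α P ih => intro χ' g h hgh; exact .sum (fun i => .refl _) fun i => ih i hgh
  | par P Q ihP ihQ => intro χ' g h hgh; exact .par (ihP hgh) (ihQ hgh)
  | scope P ih => intro χ' g h hgh; exact .scope (ih fun X => (hgh X).map _)
  | recX P ih =>
    intro χ' g h hgh
    refine .recX (ih fun o => ?_)
    cases o with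
    | none => exact .refl _
    | some X => exact (hgh X).mapVar _
  | var X => intro χ' g h hgh; exact hgh X

theorem Cong.subst {ν χ : Type} {P P' : Agent ν (Option χ)} {Q Q' : Agent ν χ} (h : P.Cong P')
    (h' : Q.Cong Q') : (P.subst Q).Cong (P'.subst Q') := by
  refine (h.bind_left _).trans (bind_cong_right _ fun o => ?_)
  cases o with
  | none => exact h'
  | some X => exact .refl _

end Agent
namespace Agent

/-! ### Restrictions and parallel compositions up to structural congruence -/

theorem mem_occ_res {ν χ : Type} [DecidableEq ν] {a x : ν} {P : Agent ν χ} :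
    x ∈ (res a P).occ ↔ x ∈ P.occ ∧ x ≠ a := by
  simp only [res, occ, List.reduceOption_mem_iff, occ_map, List.mem_map]
  constructor
  · rintro ⟨y, hy, h⟩
    split_ifs at h with hya
    cases h
    exact ⟨hy, hya⟩
  · rintro ⟨hx, hxa⟩
    exact ⟨x, hx, by simp [hxa]⟩

theorem mem_occ_scopes {ν χ : Type} [DecidableEq ν] {xs : List ν} {x : ν} {P : Agent ν χ} :
    x ∈ (scopes xs P).occ ↔ x ∈ P.occ ∧ x ∉ xs := by
  induction xs with
  | nil => simp [scopes]
  | cons a xs ih =>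
    change x ∈ (res a (scopes xs P)).occ ↔ _
    rw [mem_occ_res, ih]
    simp only [List.mem_cons]
    tauto

theorem scopes_append {ν χ : Type} [DecidableEq ν] (xs ys : List ν) (P : Agent ν χ) :
    scopes (xs ++ ys) P = scopes xs (scopes ys P) := by
  simp [scopes]

theorem res_map {ν ν' χ : Type} [DecidableEq ν] [DecidableEq ν'] (x : ν) (P : Agent ν χ)
    {e : ν → ν'} (he : ∀ y ∈ P.occ, e y = e x → y = x) :
    (res x P).map e = res (e x) (P.map e) := by
  simp only [res, map, map_map]
  congr 1
  refine map_congr _ fun y hy => ?_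
  by_cases h : y = x
  · simp [h]
  · have : e y ≠ e x := fun h' => h (he y hy h')
    simp [h, this]

theorem scopes_map {ν ν' χ : Type} [DecidableEq ν] [DecidableEq ν'] (xs : List ν)
    (P : Agent ν χ) {e : ν → ν'} (he : ∀ x ∈ xs, ∀ y ∈ P.occ, e y = e x → y = x) :
    (scopes xs P).map e = scopes (xs.map e) (P.map e) := by
  induction xs with
  | nil => rfl
  | cons x xs ih =>
    change (res x (scopes xs P)).map e = res (e x) (scopes (xs.map e) (P.map e))
    rw [res_map, ih]
    · exact fun z hz => he z (List.mem_cons_of_mem _ hz)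
    · exact fun y hy => he x List.mem_cons_self y (mem_occ_scopes.1 hy).1

theorem Cong.res {ν χ : Type} [DecidableEq ν] {P Q : Agent ν χ} (h : P.Cong Q) (x : ν) :
    (Agent.res x P).Cong (Agent.res x Q) := .scope (h.map _)

theorem Cong.scopes {ν χ : Type} [DecidableEq ν] {P Q : Agent ν χ} (h : P.Cong Q) (xs : List ν) :
    (Agent.scopes xs P).Cong (Agent.scopes xs Q) := by
  induction xs with
  | nil => exact h
  | cons x xs ih => exact ih.res x

theorem Cong.of_eq {ν χ : Type} {P Q : Agent ν χ} (h : P = Q) : P.Cong Q := h ▸ .refl _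

theorem zero_par_cong {ν χ : Type} (P : Agent ν χ) : (par zero P).Cong P :=
  (Cong.par_comm _ _).trans (.par_zero _)

/-- A binder that binds nothing can be removed. -/
theorem scope_map_some_cong {ν χ : Type} (P : Agent ν χ) : (scope (P.map some)).Cong P := by
  have h1 : (par P (scope zero)).Cong (scope (par (P.map some) zero)) := .extrusion P zero
  exact (Cong.scope (.symm (.par_zero _))).trans
    (h1.symm.trans ((Cong.par (.refl _) .scope_zero).trans (.par_zero _)))

theorem res_cong_of_notMem {ν χ : Type} [DecidableEq ν] {x : ν} {P : Agent ν χ}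
    (hx : x ∉ P.occ) : (res x P).Cong P := by
  refine (Cong.of_eq ?_).trans (scope_map_some_cong P)
  simp only [res]
  congr 1
  refine map_congr _ fun y hy => ?_
  have : y ≠ x := fun h => hx (h ▸ hy)
  simp [this]

theorem res_swap {ν χ : Type} [DecidableEq ν] (x y : ν) (P : Agent ν χ) :
    (res x (res y P)).Cong (res y (res x P)) := by
  by_cases hxy : x = y
  · rw [hxy]; exact .refl _
  simp only [res, map, map_map]
  refine (Cong.scope_swap _).trans (.of_eq ?_)
  congr 2
  rw [map_map]
  refine map_congr _ fun z _ => ?_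
  by_cases h1 : z = y
  · have : y ≠ x := fun h => hxy h.symm
    simp [h1, this]
  · by_cases h2 : z = x
    · simp [h2, hxy]
    · simp [h1, h2]

theorem scopes_perm {ν χ : Type} [DecidableEq ν] {xs ys : List ν} (h : xs.Perm ys)
    (P : Agent ν χ) : (scopes xs P).Cong (scopes ys P) := by
  induction h with
  | nil => exact .refl _
  | cons x _ ih => exact ih.res x
  | swap x y l => exact res_swap _ _ _
  | trans _ _ ih ih' => exact ih.trans ih'

theorem scopes_cong_dedup_filter {ν χ : Type} [DecidableEq ν] (xs : List ν) (P : Agent ν χ) :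
    (scopes xs P).Cong (scopes (xs.dedup.filter (· ∈ P.occ)) P) := by
  induction xs with
  | nil => exact .refl _
  | cons x xs ih =>
    by_cases hx : x ∈ xs
    · rw [List.dedup_cons_of_mem hx]
      refine (res_cong_of_notMem fun h => ?_).trans ih
      exact (mem_occ_scopes.1 h).2 hx
    · rw [List.dedup_cons_of_notMem hx]
      by_cases hxP : x ∈ P.occ
      · rw [List.filter_cons_of_pos (by simpa using hxP)]
        exact ih.res x
      · rw [List.filter_cons_of_neg (by simpa using hxP)]
        exact (res_cong_of_notMem fun h => hxP (mem_occ_scopes.1 h).1).trans ih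

/-- Only the set of those restricted names that occur matters. -/
theorem scopes_cong_of_mem_iff {ν χ : Type} [DecidableEq ν] {xs ys : List ν} {P : Agent ν χ}
    (h : ∀ x ∈ P.occ, x ∈ xs ↔ x ∈ ys) : (scopes xs P).Cong (scopes ys P) := by
  refine (scopes_cong_dedup_filter xs P).trans
    (.trans (scopes_perm ?_ P) (scopes_cong_dedup_filter ys P).symm)
  refine (List.perm_ext_iff_of_nodup ((List.nodup_dedup _).filter _)
    ((List.nodup_dedup _).filter _)).2 fun a => ?_
  simp only [List.mem_filter, List.mem_dedup, decide_eq_true_eq]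
  exact ⟨fun ⟨h1, h2⟩ => ⟨(h a h2).1 h1, h2⟩, fun ⟨h1, h2⟩ => ⟨(h a h2).2 h1, h2⟩⟩

end Agent

/-- A function that is injective on a finite set agrees there with a permutation. -/
theorem exists_perm_eqOn {ν : Type} [DecidableEq ν] (A : Finset ν) (f : ν → ν)
    (hf : Set.InjOn f A) : ∃ e : Equiv.Perm ν, ∀ a ∈ A, e a = f a := by
  induction A using Finset.induction_on with
  | empty => exact ⟨1, by simp⟩
  | insert a A ha ih =>
    obtain ⟨e, he⟩ := ih (hf.mono (by simp))
    refine ⟨Equiv.swap (e a) (f a) * e, fun b hb => ?_⟩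
    rcases Finset.mem_insert.1 hb with rfl | hb
    · simp
    · have hba : b ≠ a := fun h => ha (h ▸ hb)
      have h1 : e b ≠ e a := fun h => hba (e.injective h)
      have h2 : e b ≠ f a := fun h => hba (hf (by simp [hb]) (by simp) (by rw [← he b hb, h]))
      rw [Equiv.Perm.mul_apply, Equiv.swap_apply_of_ne_of_ne h1 h2, he b hb]

theorem exists_fresh_list {ν : Type} [Infinite ν] (n : ℕ) (A : Finset ν) :
    ∃ l : List ν, l.length = n ∧ l.Nodup ∧ ∀ x ∈ l, x ∉ A := by
  obtain ⟨s, hs, hc⟩ := (A.finite_toSet.infinite_compl).exists_subset_card_eq n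
  exact ⟨s.toList, by simp [hc], s.nodup_toList, fun x hx h => hs (by simpa using hx) h⟩

namespace Agent

/-- Change of bound names, together with the removal or the insertion of vacuous restrictions. -/
theorem scopes_cong_map {ν χ : Type} [DecidableEq ν] {xs ys : List ν} {P : Agent ν χ} {g : ν → ν}
    (hg : Set.InjOn g {x | x ∈ P.occ}) (h : ∀ x ∈ P.occ, x ∈ xs ↔ g x ∈ ys)
    (hid : ∀ x ∈ P.occ, x ∉ xs → g x = x) : (scopes xs P).Cong (scopes ys (P.map g)) := by
  obtain ⟨e, he⟩ := exists_perm_eqOn P.occ.toFinset g (by simpa using hg)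
  simp only [List.mem_toFinset] at he
  have h1 : scopes xs P = scopes (xs.map e) (P.map g) := by
    rw [← map_congr P he, ← scopes_map _ _ (fun _ _ _ _ h => e.injective h), map_eq_self]
    intro x hx
    rw [mem_occ_scopes] at hx
    rw [he x hx.1, hid x hx.1 hx.2]
  rw [h1]
  refine scopes_cong_of_mem_iff fun y hy => ?_
  rw [occ_map, List.mem_map] at hy
  obtain ⟨x, hx, rfl⟩ := hy
  rw [← h x hx, ← he x hx, List.mem_map]
  exact ⟨fun ⟨z, hz, hzx⟩ => e.injective hzx ▸ hz, fun hx => ⟨x, hx, rfl⟩⟩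

theorem par_res_cong {ν χ : Type} [DecidableEq ν] {x : ν} {P Q : Agent ν χ} (hx : x ∉ P.occ) :
    (par P (res x Q)).Cong (res x (par P Q)) := by
  refine (Cong.extrusion _ _).trans (.of_eq ?_)
  simp only [res, map]
  congr 2
  refine map_congr _ fun y hy => ?_
  have : y ≠ x := fun h => hx (h ▸ hy)
  simp [this]

theorem par_scopes_cong {ν χ : Type} [DecidableEq ν] {xs : List ν} {P Q : Agent ν χ}
    (hx : ∀ x ∈ xs, x ∉ P.occ) : (par P (scopes xs Q)).Cong (scopes xs (par P Q)) := by
  induction xs with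
  | nil => exact .refl _
  | cons x xs ih =>
    exact (par_res_cong (hx x List.mem_cons_self)).trans
      ((ih fun y hy => hx y (List.mem_cons_of_mem _ hy)).res x)

theorem scopes_par_cong {ν χ : Type} [DecidableEq ν] {xs : List ν} {P Q : Agent ν χ}
    (hx : ∀ x ∈ xs, x ∉ Q.occ) : (par (scopes xs P) Q).Cong (scopes xs (par P Q)) :=
  (Cong.par_comm _ _).trans ((par_scopes_cong hx).trans ((Cong.par_comm _ _).scopes xs))

theorem scopes_par_scopes_cong {ν χ : Type} [DecidableEq ν] {xs ys : List ν} {P Q : Agent ν χ}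
    (hx : ∀ x ∈ xs, x ∉ Q.occ) (hy : ∀ y ∈ ys, y ∉ P.occ) :
    (par (scopes xs P) (scopes ys Q)).Cong (scopes (xs ++ ys) (par P Q)) := by
  rw [scopes_append]
  refine (scopes_par_cong fun x hxs h => hx x hxs (mem_occ_scopes.1 h).1).trans
    ((par_scopes_cong hy).scopes xs)

theorem parAll_append_cong {ν χ : Type} (l m : List (Agent ν χ)) :
    (parAll (l ++ m)).Cong (par (parAll l) (parAll m)) := by
  induction l with
  | nil => exact (zero_par_cong _).symm
  | cons P l ih => exact (Cong.par (.refl P) ih).trans (Cong.par_assoc _ _ _).symm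

theorem parAll_forall₂_cong {ν χ : Type} {l m : List (Agent ν χ)} (h : List.Forall₂ Cong l m) :
    (parAll l).Cong (parAll m) := by
  induction h with
  | nil => exact .refl _
  | cons h _ ih => exact .par h ih

theorem parAll_map {ν ν' χ : Type} (l : List (Agent ν χ)) (f : ν → ν') :
    (parAll l).map f = parAll (l.map (fun P => P.map f)) := by
  induction l with
  | nil => rfl
  | cons P l ih => simp only [parAll, List.foldr_cons, List.map_cons, map] at ih ⊢; rw [ih]

theorem parAll_bind {ν χ χ' : Type} (l : List (Agent ν χ)) (g : χ → Agent ν χ') :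
    (parAll l).bind g = parAll (l.map (fun P => P.bind g)) := by
  induction l with
  | nil => rfl
  | cons P l ih => simp only [parAll, List.foldr_cons, List.map_cons, bind] at ih ⊢; rw [ih]

theorem occ_parAll {ν χ : Type} (l : List (Agent ν χ)) : (parAll l).occ = l.flatMap occ := by
  induction l with
  | nil => rfl
  | cons P l ih => simp only [parAll, List.foldr_cons, List.flatMap_cons, occ] at ih ⊢; rw [ih]

/-- Substitution for agent variables commutes with restrictions, up to capture. -/
theorem scopes_bind {ν χ χ' : Type} [DecidableEq ν] {xs : List ν} (P : Agent ν χ)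
    {g : χ → Agent ν χ'} (h : ∀ x ∈ xs, ∀ X, x ∉ (g X).occ) :
    (scopes xs P).bind g = scopes xs (P.bind g) := by
  induction xs with
  | nil => rfl
  | cons x xs ih =>
    change (res x (scopes xs P)).bind g = res x (scopes xs (P.bind g))
    rw [← ih fun y hy => h y (List.mem_cons_of_mem _ hy)]
    simp only [res, bind]
    rw [bind_map]
    congr 2
    funext X
    refine map_congr _ fun y hy => ?_
    have : y ≠ x := fun h' => h x List.mem_cons_self X (h' ▸ hy)
    simp [this]

theorem occ_mapVar {ν χ : Type} (P : Agent ν χ) :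
    ∀ {χ' : Type} (h : χ → χ'), (P.mapVar h).occ = P.occ := by
  induction P with
  | zero => intros; rfl
  | sum n α P ih => intros; simp [mapVar, occ, ih]
  | par P Q ihP ihQ => intros; simp [mapVar, occ, ihP, ihQ]
  | scope P ih => intros; simp [mapVar, occ, ih]
  | recX P ih => intros; simp [mapVar, occ, ih]
  | var X => intros; rfl

theorem mem_occ_bind_of_mem {ν χ : Type} (P : Agent ν χ) :
    ∀ {χ' : Type} (g : χ → Agent ν χ') {x : ν}, x ∈ P.occ → x ∈ (P.bind g).occ := by
  induction P with
  | zero => intro χ' g x hx; exact hx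
  | sum n α P ih =>
    intro χ' g x hx
    simp only [bind, occ, List.mem_flatMap, List.mem_append] at hx ⊢
    obtain ⟨i, hi, h | h⟩ := hx
    · exact ⟨i, hi, .inl h⟩
    · exact ⟨i, hi, .inr (ih i g h)⟩
  | par P Q ihP ihQ =>
    intro χ' g x hx
    simp only [bind, occ, List.mem_append] at hx ⊢
    exact hx.imp (ihP g) (ihQ g)
  | scope P ih =>
    intro χ' g x hx
    simp only [bind, occ, List.reduceOption_mem_iff] at hx ⊢
    exact ih _ hx
  | recX P ih => intro χ' g x hx; exact ih _ hx
  | var X => intro χ' g x hx; simp [occ] at hx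

theorem mem_occ_of_mem_bind {ν χ : Type} (P : Agent ν χ) :
    ∀ {χ' : Type} (g : χ → Agent ν χ') {x : ν}, x ∈ (P.bind g).occ →
      x ∈ P.occ ∨ ∃ X, x ∈ (g X).occ := by
  induction P with
  | zero => intro χ' g x hx; exact .inl hx
  | sum n α P ih =>
    intro χ' g x hx
    simp only [bind, occ, List.mem_flatMap, List.mem_append] at hx ⊢
    obtain ⟨i, hi, h | h⟩ := hx
    · exact .inl ⟨i, hi, .inl h⟩
    · exact (ih i g h).imp_left fun h => ⟨i, hi, .inr h⟩
  | par P Q ihP ihQ =>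
    intro χ' g x hx
    simp only [bind, occ, List.mem_append] at hx ⊢
    rcases hx with hx | hx
    · exact (ihP g hx).imp_left .inl
    · exact (ihQ g hx).imp_left .inr
  | scope P ih =>
    intro χ' g x hx
    simp only [bind, occ, List.reduceOption_mem_iff] at hx ⊢
    exact (ih _ hx).imp_right fun ⟨X, hX⟩ => ⟨X, by simpa [occ_map] using hX⟩
  | recX P ih =>
    intro χ' g x hx
    refine (ih _ hx).imp_right fun ⟨o, ho⟩ => ?_
    cases o with
    | none => simp [occ] at ho
    | some X => exact ⟨X, by simpa [occ_mapVar] using ho⟩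
  | var X => intro χ' g x hx; exact .inr ⟨X, hx⟩

/-! ### Guardedness -/

theorem unguarded_map {ν χ : Type} (P : Agent ν χ) :
    ∀ {ν' : Type} (f : ν → ν') (X : χ), (P.map f).Unguarded X ↔ P.Unguarded X := by
  induction P with
  | zero => intros; rfl
  | sum n α P ih => intros; rfl
  | par P Q ihP ihQ => intros; simp [map, Unguarded, ihP, ihQ]
  | scope P ih => intros; simp [map, Unguarded, ih]
  | recX P ih => intros; simp [map, Unguarded, ih]
  | var X => intros; rfl

theorem guarded_map {ν χ : Type} (P : Agent ν χ) :
    ∀ {ν' : Type} (f : ν → ν'), (P.map f).Guarded ↔ P.Guarded := by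
  induction P with
  | zero => intros; rfl
  | sum n α P ih => intros; simp [map, Guarded, ih]
  | par P Q ihP ihQ => intros; simp [map, Guarded, ihP, ihQ]
  | scope P ih => intros; simp [map, Guarded, ih]
  | recX P ih => intros; simp [map, Guarded, ih, unguarded_map]
  | var X => intros; rfl

theorem unguarded_mapVar {ν χ : Type} (P : Agent ν χ) :
    ∀ {χ' : Type} (h : χ → χ') (Y : χ'),
      (P.mapVar h).Unguarded Y ↔ ∃ X, P.Unguarded X ∧ Y = h X := by
  induction P with
  | zero => intros; simp [mapVar, Unguarded]
  | sum n α P ih => intros; simp [mapVar, Unguarded]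
  | par P Q ihP ihQ => intros; simp [mapVar, Unguarded, ihP, ihQ, or_and_right, exists_or]
  | scope P ih => intros; simp [mapVar, Unguarded, ih]
  | recX P ih =>
    intro χ' h Y
    simp only [mapVar, Unguarded, ih]
    constructor
    · rintro ⟨_ | X, hX, hY⟩
      · simp at hY
      · exact ⟨X, hX, by simpa using hY⟩
    · rintro ⟨X, hX, rfl⟩
      exact ⟨some X, hX, rfl⟩
  | var X => intros; simp [mapVar, Unguarded]

theorem guarded_mapVar {ν χ : Type} (P : Agent ν χ) :
    ∀ {χ' : Type} (h : χ → χ'), (P.mapVar h).Guarded ↔ P.Guarded := by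
  induction P with
  | zero => intros; rfl
  | sum n α P ih => intros; simp [mapVar, Guarded, ih]
  | par P Q ihP ihQ => intros; simp [mapVar, Guarded, ihP, ihQ]
  | scope P ih => intros; simp [mapVar, Guarded, ih]
  | recX P ih =>
    intro χ' h
    simp only [mapVar, Guarded, ih, unguarded_mapVar]
    refine and_congr_right fun _ => not_congr ⟨?_, fun h => ⟨none, h, rfl⟩⟩
    rintro ⟨_ | X, hX, hY⟩
    · exact hX
    · simp at hY
  | var X => intros; rfl

theorem unguarded_bind {ν χ : Type} (P : Agent ν χ) :
    ∀ {χ' : Type} (g : χ → Agent ν χ') (Y : χ'),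
      (P.bind g).Unguarded Y ↔ ∃ X, P.Unguarded X ∧ (g X).Unguarded Y := by
  induction P with
  | zero => intros; simp [bind, Unguarded]
  | sum n α P ih => intros; simp [bind, Unguarded]
  | par P Q ihP ihQ => intros; simp [bind, Unguarded, ihP, ihQ, or_and_right, exists_or]
  | scope P ih => intros; simp [bind, Unguarded, ih, unguarded_map]
  | recX P ih =>
    intro χ' g Y
    simp only [bind, Unguarded, ih]
    constructor
    · rintro ⟨_ | X, hX, hY⟩
      · simp [Unguarded] at hY
      · exact ⟨X, hX, by simpa [unguarded_mapVar] using hY⟩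
    · rintro ⟨X, hX, hY⟩
      exact ⟨some X, hX, by simpa [unguarded_mapVar] using hY⟩
  | var X => intros; simp [bind, Unguarded]

theorem unguarded_bind_lift_none {ν χ χ' : Type} (P : Agent ν (Option χ))
    (g : χ → Agent ν χ') :
    (P.bind (fun o => o.elim (var none) (fun X => (g X).mapVar some))).Unguarded none ↔
      P.Unguarded none := by
  rw [unguarded_bind]
  constructor
  · rintro ⟨_ | X, hX, hY⟩
    · exact hX
    · simp [unguarded_mapVar] at hY
  · exact fun h => ⟨none, h, by simp [Unguarded]⟩

theorem Guarded.bind {ν χ : Type} {P : Agent ν χ} :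
    ∀ {χ' : Type} {g : χ → Agent ν χ'}, P.Guarded → (∀ X, (g X).Guarded) →
      (P.bind g).Guarded := by
  induction P with
  | zero => intros; trivial
  | sum n α P ih => intro χ' g hP hg i; exact ih i (hP i) hg
  | par P Q ihP ihQ => intro χ' g hP hg; exact ⟨ihP hP.1 hg, ihQ hP.2 hg⟩
  | scope P ih => intro χ' g hP hg; exact ih hP fun X => (guarded_map _ _).2 (hg X)
  | recX P ih =>
    intro χ' g hP hg
    refine ⟨ih hP.1 fun o => ?_, ?_⟩
    · cases o with
      | none => trivial
      | some X => exact (guarded_mapVar _ _).2 (hg X)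
    · rw [unguarded_bind_lift_none]; exact hP.2
  | var X => intro χ' g _ hg; exact hg X

theorem Guarded.of_bind {ν χ : Type} {P : Agent ν χ} :
    ∀ {χ' : Type} {g : χ → Agent ν χ'}, (P.bind g).Guarded → P.Guarded := by
  induction P with
  | zero => intros; trivial
  | sum n α P ih => intro χ' g h i; exact ih i (h i)
  | par P Q ihP ihQ => intro χ' g h; exact ⟨ihP h.1, ihQ h.2⟩
  | scope P ih => intro χ' g h; exact ih h
  | recX P ih => intro χ' g h; exact ⟨ih h.1, (unguarded_bind_lift_none _ _).not.1 h.2⟩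
  | var X => intros; trivial

theorem Guarded.of_bind_unguarded {ν χ : Type} {P : Agent ν χ} :
    ∀ {χ' : Type} {g : χ → Agent ν χ'} {X : χ}, (P.bind g).Guarded → P.Unguarded X →
      (g X).Guarded := by
  induction P with
  | zero => intro χ' g X _ h; exact h.elim
  | sum n α P ih => intro χ' g X _ h; exact h.elim
  | par P Q ihP ihQ => intro χ' g X hG h; exact h.elim (ihP hG.1) (ihQ hG.2)
  | scope P ih => intro χ' g X hG h; exact (guarded_map _ _).1 (ih hG h)
  | recX P ih => intro χ' g X hG h; exact (guarded_mapVar _ _).1 (ih hG.1 (X := some X) h)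
  | var Y => intro χ' g X hG h; cases h; exact hG

theorem Cong.unguarded_iff {ν χ : Type} {P Q : Agent ν χ} (h : P.Cong Q) :
    ∀ X, P.Unguarded X ↔ Q.Unguarded X := by
  induction h with
  | refl P => intro X; rfl
  | symm _ ih => intro X; exact (ih X).symm
  | trans _ _ ih ih' => intro X; exact (ih X).trans (ih' X)
  | sum hα _ ih => intro X; rfl
  | par _ _ ih ih' => intro X; exact or_congr (ih X) (ih' X)
  | scope _ ih => exact ih
  | recX _ ih => intro X; exact ih _
  | sum_perm e α P => intro X; rfl
  | par_assoc P Q R => intro X; simp [Unguarded, or_assoc]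
  | par_comm P Q => intro X; simp [Unguarded, or_comm]
  | par_zero P => intro X; simp [Unguarded]
  | scope_zero => intro X; simp [Unguarded]
  | scope_swap P => intro X; simp [Unguarded, unguarded_map]
  | extrusion P Q => intro X; simp [Unguarded, unguarded_map]
  | unfold P =>
    intro X
    simp only [Agent.subst, unguarded_bind]
    constructor
    · exact fun h => ⟨some X, h, by simp [Unguarded]⟩
    · rintro ⟨_ | Y, hY, h⟩
      · exact h
      · simp only [Option.elim_some, Unguarded] at h
        exact h ▸ hY

theorem Cong.guarded_iff {ν χ : Type} {P Q : Agent ν χ} (h : P.Cong Q) :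
    P.Guarded ↔ Q.Guarded := by
  induction h with
  | refl P => rfl
  | symm _ ih => exact ih.symm
  | trans _ _ ih ih' => exact ih.trans ih'
  | sum hα _ ih => exact forall_congr' ih
  | par _ _ ih ih' => exact and_congr ih ih'
  | scope _ ih => exact ih
  | recX h ih => exact and_congr ih (not_congr (h.unguarded_iff _))
  | sum_perm e α P => exact (e.forall_congr_right (q := fun i => (P i).Guarded)).symm
  | par_assoc P Q R => simp [Guarded, and_assoc]
  | par_comm P Q => simp [Guarded, and_comm]
  | par_zero P => simp [Guarded]
  | scope_zero => simp [Guarded]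
  | scope_swap P => simp [Guarded, guarded_map]
  | extrusion P Q => simp [Guarded, guarded_map]
  | unfold P =>
    constructor
    · intro h
      refine Guarded.bind h.1 fun o => ?_
      cases o with
      | none => exact h
      | some X => trivial
    · intro h
      refine ⟨h.of_bind, fun hu => ?_⟩
      exact (h.of_bind_unguarded hu).2 hu

theorem guarded_scopes {ν χ : Type} [DecidableEq ν] (xs : List ν) (P : Agent ν χ) :
    (scopes xs P).Guarded ↔ P.Guarded := by
  induction xs with
  | nil => rfl
  | cons x xs ih => exact (guarded_map _ _).trans ih

theorem guarded_parAll {ν χ : Type} (l : List (Agent ν χ)) :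
    (parAll l).Guarded ↔ ∀ P ∈ l, P.Guarded := by
  induction l with
  | nil => simp [parAll, Guarded]
  | cons P l ih => simpa [parAll, Guarded] using fun _ => ih

end Agent
namespace Agent

/-! ### Head components of an agent -/

/-- `P.Flat f B l`: after the free names of `P` are replaced along `f`, the names bound at the head
of `P` by `B`, and the recursions at the head are unfolded, the components of `P` are the agents in
`l`. It is not required here that the names `B` are distinct or fresh. An agent with an unguarded
agent variable has no such decomposition. -/
def Flat {D : Type} : {ν χ : Type} → Agent ν χ → (ν → D) → List D → List (Agent D χ) → Prop
  | _, _, zero, _, B, l => B = [] ∧ l = []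
  | _, _, sum n α P, f, B, l => B = [] ∧ l = [(sum n α P).map f]
  | _, _, par P Q, f, B, l => ∃ B₁ B₂ l₁ l₂, B = B₁ ++ B₂ ∧ l = l₁ ++ l₂ ∧
      P.Flat f B₁ l₁ ∧ Q.Flat f B₂ l₂
  | _, _, scope P, f, B, l => ∃ d B', B = d :: B' ∧ P.Flat (fun o => o.elim d f) B' l
  | _, _, recX P, f, B, l => ∃ l', l = l'.map (fun C => C.subst ((recX P).map f)) ∧
      P.Flat f B l'
  | _, _, var _, _, _, _ => False

/-- All recursions are guarded, and no free agent variable occurs unguarded. -/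
def HeadGuarded {ν χ : Type} (P : Agent ν χ) : Prop := P.Guarded ∧ ∀ X, ¬ P.Unguarded X

theorem Cong.headGuarded_iff {ν χ : Type} {P Q : Agent ν χ} (h : P.Cong Q) :
    P.HeadGuarded ↔ Q.HeadGuarded := by
  simp only [HeadGuarded, h.guarded_iff, h.unguarded_iff]

theorem HeadGuarded.of_par {ν χ : Type} {P Q : Agent ν χ} (h : (par P Q).HeadGuarded) :
    P.HeadGuarded ∧ Q.HeadGuarded :=
  ⟨⟨h.1.1, fun X hX => h.2 X (.inl hX)⟩, ⟨h.1.2, fun X hX => h.2 X (.inr hX)⟩⟩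

theorem HeadGuarded.of_recX {ν χ : Type} {P : Agent ν (Option χ)} (h : (recX P).HeadGuarded) :
    P.HeadGuarded :=
  ⟨h.1.1, fun o => match o with
    | none => h.1.2
    | some X => h.2 X⟩

theorem HeadGuarded.of_scope {ν χ : Type} {P : Agent (Option ν) χ} (h : (scope P).HeadGuarded) :
    P.HeadGuarded := h

theorem flat_map {D ν χ : Type} (P : Agent ν χ) :
    ∀ {ν' : Type} (h : ν → ν') (f : ν' → D) (B : List D) (l : List (Agent D χ)),
      (P.map h).Flat f B l ↔ P.Flat (f ∘ h) B l := by
  induction P with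
  | zero => intros; rfl
  | sum n α P ih =>
    intros
    simp only [map, Flat, Prefix.map_map, map_map]
  | par P Q ihP ihQ => intros; simp [map, Flat, ihP, ihQ]
  | scope P ih =>
    intro ν' h f B l
    simp only [map, Flat, ih]
    have : ∀ d, (fun o : Option ν' => o.elim d f) ∘ Option.map h =
        fun o => o.elim d (f ∘ h) := fun d => by
      funext o; cases o <;> rfl
    simp only [this]
  | recX P ih => intros; simp only [map, Flat, ih, map_map]
  | var X => intros; rfl

/-- Substitution for guarded agent variables does not change the head of an agent: the components
are those of `P`, with the substitution applied to them. -/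
theorem flat_bind {D ν χ : Type} (P : Agent ν χ) :
    ∀ {χ' : Type} (g : χ → Agent ν χ') (f : ν → D) (B : List D) (m : List (Agent D χ')),
      P.HeadGuarded → ((P.bind g).Flat f B m ↔
        ∃ l, P.Flat f B l ∧ m = l.map (fun C => C.bind (fun X => (g X).map f))) := by
  induction P with
  | zero => intros; simp [bind, Flat]
  | sum n α P ih =>
    intro χ' g f B m _
    simp only [Flat, bind, map]
    constructor
    · rintro ⟨rfl, rfl⟩
      exact ⟨_, ⟨rfl, rfl⟩, by simp [bind, bind_map]⟩
    · rintro ⟨l, ⟨rfl, rfl⟩, rfl⟩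
      simp [bind, bind_map]
  | par P Q ihP ihQ =>
    intro χ' g f B m hu
    have hu := hu.of_par
    simp only [Flat, bind, ihP _ _ _ _ hu.1, ihQ _ _ _ _ hu.2]
    constructor
    · rintro ⟨B₁, B₂, _, _, rfl, rfl, ⟨l₁, h₁, rfl⟩, ⟨l₂, h₂, rfl⟩⟩
      exact ⟨_, ⟨B₁, B₂, _, _, rfl, rfl, h₁, h₂⟩, by simp⟩
    · rintro ⟨_, ⟨B₁, B₂, l₁, l₂, rfl, rfl, h₁, h₂⟩, rfl⟩
      exact ⟨B₁, B₂, _, _, rfl, by simp, ⟨l₁, h₁, rfl⟩, ⟨l₂, h₂, rfl⟩⟩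
  | scope P ih =>
    intro χ' g f B m hu
    simp only [Flat, bind, ih _ _ _ _ hu.of_scope, map_map]
    constructor
    · rintro ⟨d, B', rfl, l, h, rfl⟩
      exact ⟨l, ⟨d, B', rfl, h⟩, rfl⟩
    · rintro ⟨l, ⟨d, B', rfl, h⟩, rfl⟩
      exact ⟨d, B', rfl, l, h, rfl⟩
  | recX P ih =>
    intro χ' g f B m hu
    simp only [Flat, bind, ih _ _ _ _ hu.of_recX]
    have key : ∀ C : Agent D (Option _),
        ((C.bind fun o => Agent.map (o.elim (var none) fun X => (g X).mapVar some) f).subst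
          ((P.bind fun o => o.elim (var none) fun X => (g X).mapVar some).recX.map f)) =
        (C.subst (P.recX.map f)).bind fun X => (g X).map f := by
      intro C
      rw [subst_bind, ← bind_map]
      congr 2
      funext o
      cases o <;> simp [map, mapVar_map]
    constructor
    · rintro ⟨_, rfl, l, h, rfl⟩
      exact ⟨_, ⟨l, rfl, h⟩, by simp [key]⟩
    · rintro ⟨_, ⟨l, rfl, h⟩, rfl⟩
      exact ⟨_, by simp [key], l, h, rfl⟩
  | var X => intro χ' g f B m hu; exact (hu.2 X rfl).elim

/-- Existence of the decomposition, for an arbitrary choice of bound names. -/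
theorem exists_flat {ν χ : Type} (P : Agent ν χ) : P.HeadGuarded → ∃ n : ℕ,
    ∀ {D : Type} (f : ν → D) (B : List D), B.length = n → ∃ l, P.Flat f B l := by
  induction P with
  | zero => exact fun _ => ⟨0, fun f B hB => ⟨[], List.eq_nil_of_length_eq_zero hB, rfl⟩⟩
  | sum n α P ih => exact fun _ => ⟨0, fun f B hB => ⟨_, List.eq_nil_of_length_eq_zero hB, rfl⟩⟩
  | par P Q ihP ihQ =>
    intro h
    obtain ⟨n, hn⟩ := ihP h.of_par.1
    obtain ⟨m, hm⟩ := ihQ h.of_par.2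
    refine ⟨n + m, fun f B hB => ?_⟩
    obtain ⟨l, hl⟩ := hn f (B.take n) (by simp [hB])
    obtain ⟨l', hl'⟩ := hm f (B.drop n) (by simp [hB])
    exact ⟨l ++ l', _, _, _, _, (List.take_append_drop n B).symm, rfl, hl, hl'⟩
  | scope P ih =>
    intro h
    obtain ⟨n, hn⟩ := ih h.of_scope
    refine ⟨n + 1, fun f B hB => ?_⟩
    cases B with
    | nil => simp at hB
    | cons d B =>
      obtain ⟨l, hl⟩ := hn (fun o => o.elim d f) B (by simpa using hB)
      exact ⟨l, d, B, rfl, hl⟩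
  | recX P ih =>
    intro h
    obtain ⟨n, hn⟩ := ih h.of_recX
    refine ⟨n, fun f B hB => ?_⟩
    obtain ⟨l, hl⟩ := hn f B hB
    exact ⟨_, l, rfl, hl⟩
  | var X => exact fun h => (h.2 X rfl).elim

/-- The components are sequential agents. -/
theorem Flat.eq_sum {D ν χ : Type} {P : Agent ν χ} :
    ∀ {f : ν → D} {B : List D} {l : List (Agent D χ)}, P.Flat f B l →
      ∀ C ∈ l, ∃ n α Q, C = sum n α Q := by
  induction P with
  | zero => rintro f B l ⟨-, rfl⟩ C hC; simp at hC
  | sum n α P ih =>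
    rintro f B l ⟨-, rfl⟩ C hC
    exact ⟨_, _, _, List.mem_singleton.1 hC⟩
  | par P Q ihP ihQ =>
    rintro f B l ⟨B₁, B₂, l₁, l₂, rfl, rfl, h₁, h₂⟩ C hC
    exact (List.mem_append.1 hC).elim (ihP h₁ C) (ihQ h₂ C)
  | scope P ih => rintro f B l ⟨d, B', rfl, h⟩; exact ih h
  | recX P ih =>
    rintro f B l ⟨l', rfl, h⟩ C hC
    obtain ⟨C', hC', rfl⟩ := List.mem_map.1 hC
    obtain ⟨n, α, Q, rfl⟩ := ih h C' hC'
    exact ⟨_, _, _, rfl⟩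
  | var X => rintro f B l h; exact h.elim

theorem Flat.mem_occ {D ν χ : Type} {P : Agent ν χ} :
    ∀ {f : ν → D} {B : List D} {l : List (Agent D χ)}, P.Flat f B l →
      ∀ C ∈ l, ∀ x ∈ C.occ, x ∈ B ∨ x ∈ P.occ.map f := by
  induction P with
  | zero => rintro f B l ⟨-, rfl⟩ C hC; simp at hC
  | sum n α P ih =>
    rintro f B l ⟨-, rfl⟩ C hC x hx
    rw [List.mem_singleton.1 hC, occ_map] at hx
    exact .inr hx
  | par P Q ihP ihQ =>
    rintro f B l ⟨B₁, B₂, l₁, l₂, rfl, rfl, h₁, h₂⟩ C hC x hx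
    simp only [List.mem_append, occ, List.map_append]
    rcases List.mem_append.1 hC with hC | hC
    · exact (ihP h₁ C hC x hx).imp .inl .inl
    · exact (ihQ h₂ C hC x hx).imp .inr .inr
  | scope P ih =>
    rintro f B l ⟨d, B', rfl, h⟩ C hC x hx
    rcases ih h C hC x hx with h | h
    · exact .inl (List.mem_cons_of_mem _ h)
    · obtain ⟨_ | y, hy, rfl⟩ := List.mem_map.1 h
      · exact .inl List.mem_cons_self
      · exact .inr (List.mem_map.2 ⟨y, List.reduceOption_mem_iff.2 hy, rfl⟩)
  | recX P ih =>
    rintro f B l ⟨l', rfl, h⟩ C hC x hx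
    obtain ⟨C', hC', rfl⟩ := List.mem_map.1 hC
    rcases mem_occ_of_mem_bind _ _ hx with hx | ⟨_ | X, hX⟩
    · exact ih h C' hC' x hx
    · simp only [Option.elim_none, occ_map] at hX
      exact .inr hX
    · simp [occ] at hX
  | var X => rintro f B l h; exact h.elim

theorem Flat.exists_mem_occ {D ν χ : Type} {P : Agent ν χ} :
    ∀ {f : ν → D} {B : List D} {l : List (Agent D χ)}, P.Flat f B l →
      ∀ x ∈ P.occ, ∃ C ∈ l, f x ∈ C.occ := by
  induction P with
  | zero => rintro f B l - x hx; simp [occ] at hx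
  | sum n α P ih =>
    rintro f B l ⟨-, rfl⟩ x hx
    exact ⟨_, List.mem_singleton.2 rfl, by rw [occ_map]; exact List.mem_map_of_mem hx⟩
  | par P Q ihP ihQ =>
    rintro f B l ⟨B₁, B₂, l₁, l₂, rfl, rfl, h₁, h₂⟩ x hx
    rcases List.mem_append.1 hx with hx | hx
    · obtain ⟨C, hC, h⟩ := ihP h₁ x hx
      exact ⟨C, List.mem_append_left _ hC, h⟩
    · obtain ⟨C, hC, h⟩ := ihQ h₂ x hx
      exact ⟨C, List.mem_append_right _ hC, h⟩
  | scope P ih =>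
    rintro f B l ⟨d, B', rfl, h⟩ x hx
    exact ih h (some x) (List.reduceOption_mem_iff.1 hx)
  | recX P ih =>
    rintro f B l ⟨l', rfl, h⟩ x hx
    obtain ⟨C, hC, h⟩ := ih h x hx
    exact ⟨_, List.mem_map_of_mem hC, mem_occ_bind_of_mem _ _ h⟩
  | var X => rintro f B l h; exact h.elim

/-- If the bound names are distinct and fresh, the agent is structurally congruent to the
restriction of the parallel composition of its components. -/
theorem Flat.cong {D ν χ : Type} [DecidableEq D] {P : Agent ν χ} :
    ∀ {f : ν → D} {B : List D} {l : List (Agent D χ)}, P.Flat f B l → B.Nodup →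
      (∀ b ∈ B, b ∉ P.occ.map f) → (P.map f).Cong (scopes B (parAll l)) := by
  induction P with
  | zero => rintro f B l ⟨rfl, rfl⟩ - -; exact .refl _
  | sum n α P ih => rintro f B l ⟨rfl, rfl⟩ - -; exact (Cong.par_zero _).symm
  | par P Q ihP ihQ =>
    rintro f B l ⟨B₁, B₂, l₁, l₂, rfl, rfl, h₁, h₂⟩ hB hf
    rw [List.nodup_append] at hB
    simp only [occ, List.map_append, List.mem_append, not_or] at hf
    refine (Cong.par (ihP h₁ hB.1 fun b hb => (hf b (.inl hb)).1)
      (ihQ h₂ hB.2.1 fun b hb => (hf b (.inr hb)).2)).trans ?_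
    refine (scopes_par_scopes_cong ?_ ?_).trans ((parAll_append_cong _ _).symm.scopes _)
    · intro b hb h
      rw [occ_parAll] at h
      obtain ⟨C, hC, h⟩ := List.mem_flatMap.1 h
      exact (h₂.mem_occ C hC b h).elim (fun h => hB.2.2 b hb b h rfl) (hf b (.inl hb)).2
    · intro b hb h
      rw [occ_parAll] at h
      obtain ⟨C, hC, h⟩ := List.mem_flatMap.1 h
      exact (h₁.mem_occ C hC b h).elim (fun h => hB.2.2 b h b hb rfl) (hf b (.inr hb)).1
  | scope P ih =>
    rintro f B l ⟨d, B', rfl, h⟩ hB hf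
    rw [List.nodup_cons] at hB
    have hf' : ∀ b ∈ d :: B', ∀ x, some x ∈ P.occ → f x ≠ b := fun b hb x hx hxb =>
      hf b hb (List.mem_map.2 ⟨x, List.reduceOption_mem_iff.2 hx, hxb⟩)
    have := ih h hB.2 (by
      intro b hb hbP
      obtain ⟨_ | x, hx, hxb⟩ := List.mem_map.1 hbP
      · exact hB.1 ((show d = b from hxb) ▸ hb)
      · exact hf' b (List.mem_cons_of_mem _ hb) x hx hxb)
    refine (Cong.of_eq ?_).trans (this.res d)
    simp only [map, res, map_map]
    congr 1
    refine map_congr _ ?_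
    rintro (_ | x) hx
    · simp
    · simp [hf' d List.mem_cons_self x hx]
  | recX P ih =>
    rintro f B l ⟨l', rfl, h⟩ hB hf
    refine (Cong.unfold (P.map f)).trans (.trans ((ih h hB hf).subst (.refl _)) (.of_eq ?_))
    rw [Agent.subst, scopes_bind, parAll_bind]
    · rfl
    · rintro b hb (_ | X)
      · have := hf b hb
        rwa [occ, ← occ_map] at this
      · simp [occ]
  | var X => rintro f B l h; exact h.elim

/-! ### Components of structurally congruent agents -/

/-- Two sequential agents agree up to the order of the summands, the presentations of fusions and
structural congruence of the continuations. -/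
inductive SumEqv {ν χ : Type} : Agent ν χ → Agent ν χ → Prop
  | mk {n m : ℕ} {α : Fin n → Prefix ν} {P : Fin n → Agent ν χ} {β : Fin m → Prefix ν}
      {Q : Fin m → Agent ν χ} (e : Fin n ≃ Fin m) (hα : ∀ i, (α i).Same (β (e i)))
      (hP : ∀ i, (P i).Cong (Q (e i))) : SumEqv (sum n α P) (sum m β Q)

theorem SumEqv.symm {ν χ : Type} {P Q : Agent ν χ} (h : SumEqv P Q) : SumEqv Q P := by
  obtain ⟨e, hα, hP⟩ := h
  refine ⟨e.symm, fun i => ?_, fun i => ?_⟩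
  · simpa using (hα (e.symm i)).symm
  · simpa using (hP (e.symm i)).symm

theorem SumEqv.trans {ν χ : Type} {P Q R : Agent ν χ} (h : SumEqv P Q) (h' : SumEqv Q R) :
    SumEqv P R := by
  obtain ⟨e, hα, hP⟩ := h
  obtain ⟨e', hα', hP'⟩ := h'
  exact ⟨e.trans e', fun i => (hα i).trans (hα' _), fun i => (hP i).trans (hP' _)⟩

theorem SumEqv.cong {ν χ : Type} {P Q : Agent ν χ} (h : SumEqv P Q) : P.Cong Q := by
  obtain @⟨n, m, α, P, β, Q, e, hα, hP⟩ := h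
  obtain rfl : n = m := by simpa using Fintype.card_congr e
  exact (Cong.sum hα hP).trans (Cong.sum_perm e β Q).symm

theorem SumEqv.subst {ν χ : Type} {P P' : Agent ν (Option χ)} {Q Q' : Agent ν χ}
    (h : SumEqv P P') (h' : Q.Cong Q') : SumEqv (P.subst Q) (P'.subst Q') := by
  obtain ⟨e, hα, hP⟩ := h
  exact ⟨e, hα, fun i => (hP i).subst h'⟩

theorem sumEqv_refl_of_eq_sum {ν χ : Type} {P : Agent ν χ} (h : ∃ n α Q, P = sum n α Q) :
    SumEqv P P := by
  obtain ⟨n, α, Q, rfl⟩ := h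
  exact ⟨Equiv.refl _, fun i => .refl _, fun i => .refl _⟩

/-- Equivalence of lists of components, up to their order. -/
def SumsEqv {ν χ : Type} : List (Agent ν χ) → List (Agent ν χ) → Prop :=
  Relation.Comp (List.Forall₂ SumEqv) List.Perm

theorem SumsEqv.trans {ν χ : Type} {l m k : List (Agent ν χ)} (h : SumsEqv l m)
    (h' : SumsEqv m k) : SumsEqv l k := by
  obtain ⟨a, hla, ham⟩ := h
  obtain ⟨b, hmb, hbk⟩ := h'
  obtain ⟨c, hac, hcb⟩ : Relation.Comp (List.Forall₂ SumEqv) List.Perm a b := by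
    rw [List.forall₂_comp_perm_eq_perm_comp_forall₂]
    exact ⟨m, ham, hmb⟩
  refine ⟨c, ?_, hcb.trans hbk⟩
  clear ham hmb hbk hcb
  induction hla generalizing c with
  | nil => exact hac
  | cons h _ ih =>
    cases hac with
    | cons h' hac => exact .cons (h.trans h') (ih _ hac)

theorem SumsEqv.append {ν χ : Type} {l m l' m' : List (Agent ν χ)} (h : SumsEqv l m)
    (h' : SumsEqv l' m') : SumsEqv (l ++ l') (m ++ m') := by
  obtain ⟨a, hla, ham⟩ := h
  obtain ⟨b, hmb, hbk⟩ := h'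
  exact ⟨a ++ b, List.rel_append hla hmb, ham.append hbk⟩

theorem SumsEqv.of_perm {ν χ : Type} {l m : List (Agent ν χ)} (h : l.Perm m)
    (hl : ∀ C ∈ l, ∃ n α Q, C = sum n α Q) : SumsEqv l m :=
  ⟨l, List.forall₂_same.2 fun C hC => sumEqv_refl_of_eq_sum (hl C hC), h⟩

theorem SumsEqv.map_subst {ν χ : Type} {l m : List (Agent ν (Option χ))} {Q Q' : Agent ν χ}
    (h : SumsEqv l m) (h' : Q.Cong Q') :
    SumsEqv (l.map (fun C => C.subst Q)) (m.map (fun C => C.subst Q')) := by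
  obtain ⟨a, hla, ham⟩ := h
  refine ⟨a.map (fun C => C.subst Q'), ?_, ham.map _⟩
  rw [List.forall₂_map_left_iff, List.forall₂_map_right_iff]
  exact hla.imp fun _ _ h => h.subst h'

/-- Each decomposition of `P` is matched by one of `Q`; the finite set `A` of names to be avoided by
the bound names is arbitrary. -/
def Transfers {ν χ : Type} (P Q : Agent ν χ) : Prop :=
  ∀ (D : Type) [Infinite D] (f : ν → D) (A : Set D) (B : List D) (l : List (Agent D χ)),
    A.Finite → P.Flat f B l → B.Nodup → (∀ b ∈ B, b ∉ A) →
    ∃ C m, Q.Flat f C m ∧ C.Nodup ∧ (∀ c ∈ C, c ∉ A) ∧ SumsEqv l m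

/-- The case in which no bound names have to be chosen: the decomposition of `Q` is a reordering of
the one of `P`. -/
theorem Transfers.of_imp {ν χ : Type} {P Q : Agent ν χ}
    (h : ∀ (D : Type) (f : ν → D) (B : List D) (l : List (Agent D χ)), P.Flat f B l →
      ∃ C m, Q.Flat f C m ∧ C.Perm B ∧ m.Perm l) : Transfers P Q := by
  intro D _ f A B l _ hl hB hA
  obtain ⟨C, m, hm, hC, hml⟩ := h D f B l hl
  exact ⟨C, m, hm, hC.nodup_iff.2 hB, fun c hc => hA c (hC.mem_iff.1 hc),
    .of_perm hml.symm hl.eq_sum⟩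

theorem Transfers.trans {ν χ : Type} {P Q R : Agent ν χ} (h : Transfers P Q)
    (h' : Transfers Q R) : Transfers P R := by
  intro D _ f A B l hAf hl hB hA
  obtain ⟨C, m, hm, hC, hA', he⟩ := h D f A B l hAf hl hB hA
  obtain ⟨E, k, hk, hE, hA'', he'⟩ := h' D f A C m hAf hm hC hA'
  exact ⟨E, k, hk, hE, hA'', he.trans he'⟩

theorem Transfers.par_comm {ν χ : Type} (P Q : Agent ν χ) :
    Transfers (Agent.par P Q) (Agent.par Q P) := by
  refine .of_imp ?_
  rintro D f _ _ ⟨B₁, B₂, l₁, l₂, rfl, rfl, h₁, h₂⟩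
  exact ⟨_, _, ⟨_, _, _, _, rfl, rfl, h₂, h₁⟩, List.perm_append_comm, List.perm_append_comm⟩

theorem Transfers.par {ν χ : Type} {P P' Q Q' : Agent ν χ} (h : Transfers P P')
    (h' : Transfers Q Q') : Transfers (par P Q) (par P' Q') := by
  rintro D _ f A _ _ hAf ⟨B₁, B₂, l₁, l₂, rfl, rfl, h₁, h₂⟩ hB hA
  rw [List.nodup_append] at hB
  obtain ⟨C₁, m₁, hm₁, hC₁, hA₁, he₁⟩ := h D f (A ∪ {x | x ∈ B₂}) B₁ l₁
    (hAf.union B₂.finite_toSet) h₁ hB.1 (by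
      rintro b hb (h | h)
      · exact hA b (List.mem_append_left _ hb) h
      · exact hB.2.2 b hb b h rfl)
  obtain ⟨C₂, m₂, hm₂, hC₂, hA₂, he₂⟩ := h' D f (A ∪ {x | x ∈ C₁}) B₂ l₂
    (hAf.union C₁.finite_toSet) h₂ hB.2.1 (by
      rintro b hb (h | h)
      · exact hA b (List.mem_append_right _ hb) h
      · exact hA₁ b h (.inr hb))
  refine ⟨C₁ ++ C₂, m₁ ++ m₂, ⟨_, _, _, _, rfl, rfl, hm₁, hm₂⟩, ?_, ?_, he₁.append he₂⟩
  · refine List.nodup_append.2 ⟨hC₁, hC₂, ?_⟩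
    rintro a ha _ hb rfl
    exact hA₂ a hb (.inr ha)
  · intro c hc
    exact (List.mem_append.1 hc).elim (fun hc h => hA₁ c hc (.inl h))
      (fun hc h => hA₂ c hc (.inl h))

theorem Transfers.scope {ν χ : Type} {P P' : Agent (Option ν) χ} (h : Transfers P P') :
    Transfers (scope P) (scope P') := by
  rintro D _ f A _ l hAf ⟨d, B, rfl, hl⟩ hB hA
  rw [List.nodup_cons] at hB
  obtain ⟨C, m, hm, hC, hA', he⟩ := h D _ (insert d A) B l (hAf.insert d) hl hB.2 (by
    rintro b hb (h | h)
    · exact hB.1 (h ▸ hb)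
    · exact hA b (List.mem_cons_of_mem _ hb) h)
  refine ⟨d :: C, m, ⟨d, C, rfl, hm⟩, List.nodup_cons.2 ⟨fun h => hA' d h (.inl rfl), hC⟩, ?_, he⟩
  intro c hc
  rcases List.mem_cons.1 hc with rfl | hc
  · exact hA c List.mem_cons_self
  · exact fun h => hA' c hc (.inr h)

theorem Transfers.recX {ν χ : Type} {P P' : Agent ν (Option χ)} (h : Transfers P P')
    (hc : P.Cong P') : Transfers (recX P) (recX P') := by
  rintro D _ f A B _ hAf ⟨l, rfl, hl⟩ hB hA
  obtain ⟨C, m, hm, hC, hA', he⟩ := h D f A B l hAf hl hB hA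
  exact ⟨C, _, ⟨m, rfl, hm⟩, hC, hA', he.map_subst ((Cong.recX hc).map f)⟩

/-- Structurally congruent agents have the same components, up to the equivalence of sequential
agents. -/
theorem Cong.transfers {ν χ : Type} {P Q : Agent ν χ} (h : P.Cong Q) :
    P.HeadGuarded → Transfers P Q ∧ Transfers Q P := by
  induction h with
  | refl P =>
    intro _
    have : Transfers P P := .of_imp fun D f B l hl => ⟨B, l, hl, .refl _, .refl _⟩
    exact ⟨this, this⟩
  | symm h ih => intro hP; exact (ih (h.headGuarded_iff.2 hP)).symm
  | trans h h' ih ih' =>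
    intro hP
    obtain ⟨h1, h2⟩ := ih hP
    obtain ⟨h3, h4⟩ := ih' (h.headGuarded_iff.1 hP)
    exact ⟨h1.trans h3, h4.trans h2⟩
  | @sum _ _ n α β P Q hα hP ih =>
    intro _
    constructor
    · rintro D _ f A _ _ _ ⟨rfl, rfl⟩ _ _
      refine ⟨[], _, ⟨rfl, rfl⟩, .nil, by simp, _, .cons ?_ .nil, .refl _⟩
      exact ⟨Equiv.refl _, fun i => (hα i).map f, fun i => (hP i).map f⟩
    · rintro D _ f A _ _ _ ⟨rfl, rfl⟩ _ _
      refine ⟨[], _, ⟨rfl, rfl⟩, .nil, by simp, _, .cons ?_ .nil, .refl _⟩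
      exact ⟨Equiv.refl _, fun i => (hα i).symm.map f, fun i => (hP i).symm.map f⟩
  | par h h' ih ih' =>
    intro hP
    obtain ⟨h1, h2⟩ := ih hP.of_par.1
    obtain ⟨h3, h4⟩ := ih' hP.of_par.2
    exact ⟨h1.par h3, h2.par h4⟩
  | scope h ih => intro hP; exact ⟨(ih hP.of_scope).1.scope, (ih hP.of_scope).2.scope⟩
  | recX h ih => intro hP; exact ⟨(ih hP.of_recX).1.recX h, (ih hP.of_recX).2.recX h.symm⟩
  | sum_perm e α P =>
    intro _
    have key : ∀ D (f : _ → D), SumEqv ((Agent.sum _ α P).map f)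
        ((Agent.sum _ (α ∘ e) (P ∘ e)).map f) := fun D f =>
      ⟨e.symm, fun i => by simpa using Prefix.Same.refl _, fun i => by simpa using Cong.refl _⟩
    constructor
    · rintro D _ f A _ _ _ ⟨rfl, rfl⟩ _ _
      exact ⟨[], _, ⟨rfl, rfl⟩, .nil, by simp, _, .cons (key D f) .nil, .refl _⟩
    · rintro D _ f A _ _ _ ⟨rfl, rfl⟩ _ _
      exact ⟨[], _, ⟨rfl, rfl⟩, .nil, by simp, _, .cons (key D f).symm .nil, .refl _⟩
  | par_assoc P Q R =>
    intro _
    constructor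
    · refine .of_imp ?_
      rintro D f _ _ ⟨_, B₃, _, l₃, rfl, rfl, ⟨B₁, B₂, l₁, l₂, rfl, rfl, h₁, h₂⟩, h₃⟩
      exact ⟨_, _, ⟨_, _, _, _, rfl, rfl, h₁, _, _, _, _, rfl, rfl, h₂, h₃⟩, by simp, by simp⟩
    · refine .of_imp ?_
      rintro D f _ _ ⟨B₁, _, l₁, _, rfl, rfl, h₁, ⟨B₂, B₃, l₂, l₃, rfl, rfl, h₂, h₃⟩⟩
      exact ⟨_, _, ⟨_, _, _, _, rfl, rfl, ⟨_, _, _, _, rfl, rfl, h₁, h₂⟩, h₃⟩, by simp, by simp⟩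
  | par_comm P Q => exact fun _ => ⟨.par_comm P Q, .par_comm Q P⟩
  | par_zero P =>
    intro _
    constructor
    · refine .of_imp ?_
      rintro D f _ _ ⟨B₁, _, l₁, _, rfl, rfl, h₁, rfl, rfl⟩
      exact ⟨_, _, h₁, by simp, by simp⟩
    · refine .of_imp fun D f B l h => ⟨B ++ [], l ++ [], ⟨_, _, _, _, rfl, rfl, h, rfl, rfl⟩, ?_⟩
      simp
  | scope_zero =>
    intro _
    constructor
    · rintro D _ f A _ _ _ ⟨d, _, rfl, rfl, rfl⟩ _ _
      exact ⟨[], [], ⟨rfl, rfl⟩, .nil, by simp, [], .nil, .refl _⟩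
    · rintro D _ f A _ _ hA ⟨rfl, rfl⟩ _ _
      -- the additional restriction binds a fresh name that occurs nowhere
      obtain ⟨d, hd⟩ := hA.infinite_compl.nonempty
      exact ⟨[d], [], ⟨d, [], rfl, rfl, rfl⟩, by simp, by simpa using hd, [], .nil, .refl _⟩
  | scope_swap P =>
    intro _
    constructor
    · refine .of_imp ?_
      rintro D f _ l ⟨d, _, rfl, d', B, rfl, h⟩
      refine ⟨d' :: d :: B, l, ⟨d', _, rfl, d, B, rfl, ?_⟩, .swap _ _ _, .refl _⟩
      rw [flat_map]
      convert h using 1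
      funext o
      rcases o with _ | _ | x <;> rfl
    · refine .of_imp ?_
      rintro D f _ l ⟨d, _, rfl, d', B, rfl, h⟩
      refine ⟨d' :: d :: B, l, ⟨d', _, rfl, d, B, rfl, ?_⟩, .swap _ _ _, .refl _⟩
      rw [flat_map] at h
      convert h using 1
      funext o
      rcases o with _ | _ | x <;> rfl
  | extrusion P Q =>
    intro _
    constructor
    · refine .of_imp ?_
      rintro D f _ _ ⟨B₁, _, l₁, l₂, rfl, rfl, h₁, d, B₂, rfl, h₂⟩
      exact ⟨d :: (B₁ ++ B₂), _, ⟨d, _, rfl, _, _, _, _, rfl, rfl, (flat_map _ _ _ _ _).2 h₁, h₂⟩,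
        List.perm_middle.symm, .refl _⟩
    · refine .of_imp ?_
      rintro D f _ _ ⟨d, _, rfl, B₁, B₂, l₁, l₂, rfl, rfl, h₁, h₂⟩
      exact ⟨B₁ ++ d :: B₂, _, ⟨_, _, _, _, rfl, rfl, (flat_map _ some _ _ _).1 h₁, d, B₂, rfl, h₂⟩,
        List.perm_middle, .refl _⟩
  | unfold P =>
    intro hP
    have key : ∀ (D : Type) (f : _ → D) (B : List D) (l : List (Agent D _)),
        (Agent.recX P).Flat f B l ↔ (P.subst (Agent.recX P)).Flat f B l := by
      intro D f B l
      rw [Agent.subst, flat_bind _ _ _ _ _ hP.of_recX]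
      have : ∀ C : Agent D (Option _),
          (C.bind fun o => Agent.map (o.elim (Agent.recX P) var) f) =
            C.subst ((Agent.recX P).map f) := fun C => by
        rw [Agent.subst]
        congr 1
        funext o
        cases o <;> rfl
      simp only [this]
      exact ⟨fun ⟨l', h, h'⟩ => ⟨l', h', h⟩, fun ⟨l', h, h'⟩ => ⟨l', h', h⟩⟩
    exact ⟨.of_imp fun D f B l h => ⟨B, l, (key D f B l).1 h, .refl _, .refl _⟩,
      .of_imp fun D f B l h => ⟨B, l, (key D f B l).2 h, .refl _, .refl _⟩⟩

end Agent

/-! ### Linear sequential agents and normal forms -/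

theorem exists_flatMap_finRange {ν ν' : Type} (g : ν' → ν) {n : ℕ} (F : Fin n → List ν)
    (L : List ν') (h : L.map g = (List.finRange n).flatMap F) :
    ∃ G : Fin n → List ν', L = (List.finRange n).flatMap G ∧ ∀ i, (G i).map g = F i := by
  induction n generalizing L with
  | zero => exact ⟨fun i => i.elim0, by simpa using h, fun i => i.elim0⟩
  | succ n ih =>
    rw [List.finRange_succ, List.flatMap_cons, List.flatMap_map, List.map_eq_append_iff] at h
    obtain ⟨L₁, L₂, rfl, h₁, h₂⟩ := h
    obtain ⟨G, rfl, hG⟩ := ih (fun i => F i.succ) L₂ h₂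
    refine ⟨Fin.cons L₁ G, ?_, fun i => ?_⟩
    · rw [List.finRange_succ, List.flatMap_cons, List.flatMap_map]
      simp
    · refine Fin.cases ?_ (fun i => ?_) i
      · simpa using h₁
      · simpa using hG i

theorem exists_reduceOption {ν ν' : Type} (g : ν' → ν) (M : List (Option ν)) (L : List ν')
    (h : L.map g = M.reduceOption) :
    ∃ M' : List (Option ν'), M'.map (Option.map g) = M ∧ M'.reduceOption = L := by
  induction M generalizing L with
  | nil =>
    refine ⟨[], rfl, ?_⟩
    simpa using h
  | cons o M ih =>
    cases o with
    | none =>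
      rw [List.reduceOption_cons_of_none] at h
      obtain ⟨M', rfl, rfl⟩ := ih L h
      exact ⟨none :: M', rfl, by rw [List.reduceOption_cons_of_none]⟩
    | some x =>
      rw [List.reduceOption_cons_of_some, List.map_eq_cons_iff] at h
      obtain ⟨y, L, rfl, rfl, h⟩ := h
      obtain ⟨M', rfl, rfl⟩ := ih L h
      exact ⟨some y :: M', rfl, by rw [List.reduceOption_cons_of_some]⟩

theorem Prefix.exists_map_eq {ν ν' : Type} (g : ν' → ν) (α : Prefix ν) (L : List ν')
    (h : L.map g = α.occ) : ∃ α' : Prefix ν', α'.map g = α ∧ α'.occ = L := by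
  cases α with
  | input c xs =>
    obtain ⟨c', xs', rfl, rfl, rfl⟩ := List.map_eq_cons_iff.1 h
    exact ⟨.input c' xs', rfl, rfl⟩
  | output c xs =>
    obtain ⟨c', xs', rfl, rfl, rfl⟩ := List.map_eq_cons_iff.1 h
    exact ⟨.output c' xs', rfl, rfl⟩
  | fusion E =>
    suffices ∃ E' : List (ν' × ν'), E'.map (Prod.map g g) = E ∧
        E'.flatMap (fun p => [p.1, p.2]) = L by
      obtain ⟨E', hE, hL⟩ := this
      exact ⟨.fusion E', by rw [← hE]; rfl, hL⟩
    simp only [Prefix.occ] at h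
    induction E generalizing L with
    | nil => exact ⟨[], rfl, by simpa [eq_comm] using h⟩
    | cons p E ih =>
      obtain ⟨a, b⟩ := p
      simp only [List.flatMap_cons, List.cons_append, List.nil_append, List.map_eq_cons_iff] at h
      obtain ⟨a', _, rfl, rfl, b', L, rfl, rfl, h⟩ := h
      obtain ⟨E', rfl, rfl⟩ := ih L h
      exact ⟨(a', b') :: E', rfl, rfl⟩

/-- The occurrences of free names of an agent can be replaced by arbitrary names independently. -/
theorem Agent.exists_map_eq {ν χ : Type} (P : Agent ν χ) :
    ∀ {ν' : Type} (g : ν' → ν) (L : List ν'), L.map g = P.occ →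
      ∃ P' : Agent ν' χ, P'.map g = P ∧ P'.occ = L := by
  induction P with
  | zero => intro ν' g L h; exact ⟨zero, rfl, by simpa [occ, eq_comm] using h⟩
  | sum n α P ih =>
    intro ν' g L h
    obtain ⟨G, rfl, hG⟩ := exists_flatMap_finRange g _ L h
    have : ∀ i, ∃ (α' : Prefix ν') (P' : Agent ν' _), α'.map g = α i ∧ P'.map g = P i ∧
        α'.occ ++ P'.occ = G i := by
      intro i
      obtain ⟨L₁, L₂, h, h₁, h₂⟩ := List.map_eq_append_iff.1 (hG i)
      obtain ⟨α', hα, rfl⟩ := Prefix.exists_map_eq g _ _ h₁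
      obtain ⟨P', hP, rfl⟩ := ih i g _ h₂
      exact ⟨α', P', hα, hP, h.symm⟩
    choose α' P' hα hP hG using this
    exact ⟨sum n α' P', by simp [map, hα, hP], by simp [occ, hG]⟩
  | par P Q ihP ihQ =>
    intro ν' g L h
    obtain ⟨L₁, L₂, rfl, h₁, h₂⟩ := List.map_eq_append_iff.1 h
    obtain ⟨P', rfl, rfl⟩ := ihP g _ h₁
    obtain ⟨Q', rfl, rfl⟩ := ihQ g _ h₂
    exact ⟨par P' Q', rfl, rfl⟩
  | scope P ih =>
    intro ν' g L h
    obtain ⟨M, hM, rfl⟩ := exists_reduceOption g _ L h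
    obtain ⟨P', rfl, rfl⟩ := ih _ M hM
    exact ⟨scope P', rfl, rfl⟩
  | recX P ih =>
    intro ν' g L h
    obtain ⟨P', rfl, rfl⟩ := ih g L h
    exact ⟨recX P', rfl, rfl⟩
  | var X => intro ν' g L h; exact ⟨var X, rfl, by simpa [occ, eq_comm] using h⟩

theorem Seq.exists_of_forall_sum {ν : Type} (l : List (Agent ν Empty))
    (h : ∀ C ∈ l, ∃ n α Q, C = Agent.sum n α Q) : ∃ Ss : List (Seq ν), Ss.map Seq.toAgent = l := by
  induction l with
  | nil => exact ⟨[], rfl⟩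
  | cons C l ih =>
    obtain ⟨Ss, rfl⟩ := ih fun C hC => h C (List.mem_cons_of_mem _ hC)
    obtain ⟨n, α, Q, rfl⟩ := h C List.mem_cons_self
    exact ⟨⟨n, α, Q⟩ :: Ss, rfl⟩

/-- Sequential agents are images of linear ones: the occurrences of names can be replaced by any
list `L` of preimages. -/
theorem exists_fnarray_eq {𝒩 : Type} (g : 𝒩 → 𝒩) (Cs : List (Seq 𝒩)) (L : List 𝒩)
    (h : L.map g = fnarray Cs) : ∃ Ss : List (Seq 𝒩), Ss.map (Seq.map g) = Cs ∧ fnarray Ss = L := by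
  induction Cs generalizing L with
  | nil => exact ⟨[], rfl, by simpa [fnarray, eq_comm] using h⟩
  | cons C Cs ih =>
    rw [fnarray, List.flatMap_cons, List.map_eq_append_iff] at h
    obtain ⟨L₁, L₂, rfl, h₁, h₂⟩ := h
    obtain ⟨Ss, rfl, rfl⟩ := ih L₂ h₂
    obtain ⟨A, hA, hA'⟩ := Agent.exists_map_eq C.toAgent g L₁ h₁
    obtain ⟨n, α, P⟩ := C
    cases A with
    | sum m β Q =>
      refine ⟨⟨m, β, Q⟩ :: Ss, ?_, ?_⟩
      · simp only [Agent.map, Seq.toAgent, Agent.sum.injEq] at hA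
        obtain ⟨rfl, h1, h2⟩ := hA
        simp only [heq_eq_eq] at h1 h2
        subst h1 h2
        rfl
      · rw [fnarray, List.flatMap_cons]
        congr 1
    | _ => simp [Agent.map, Seq.toAgent] at hA

section

variable {𝒩 : Type}

theorem fnarray_map (f : 𝒩 → 𝒩) (Ss : List (Seq 𝒩)) :
    fnarray (Ss.map (Seq.map f)) = (fnarray Ss).map f := by
  simp [fnarray, List.flatMap_map, List.map_flatMap, Seq.occ_map]

theorem fnarray_append (Ss Ts : List (Seq 𝒩)) : fnarray (Ss ++ Ts) = fnarray Ss ++ fnarray Ts := by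
  simp [fnarray]

theorem Seq.map_map (S : Seq 𝒩) (f g : 𝒩 → 𝒩) : (S.map f).map g = S.map (g ∘ f) := by
  simp [Seq.map, Prefix.map_map, Agent.map_map]

theorem Seq.toAgent_map (S : Seq 𝒩) (f : 𝒩 → 𝒩) : (S.map f).toAgent = S.toAgent.map f := rfl

theorem Seq.map_congr (S : Seq 𝒩) {f g : 𝒩 → 𝒩} (h : ∀ x ∈ S.occ, f x = g x) :
    S.map f = S.map g := by
  have : S.toAgent.map f = S.toAgent.map g := Agent.map_congr _ h
  simpa [Seq.toAgent, Agent.map, Seq.map] using this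

/-- The parallel composition `Ss σ` of sequential agents to which a substitution is applied. -/
def body (Ss : List (Seq 𝒩)) (σ : 𝒩 → 𝒩) : Agent 𝒩 Empty :=
  Agent.parAll (Ss.map (fun S => (S.map σ).toAgent))

theorem occ_body (Ss : List (Seq 𝒩)) (σ : 𝒩 → 𝒩) : (body Ss σ).occ = (fnarray Ss).map σ := by
  simp only [body, Agent.occ_parAll, fnarray, List.flatMap_map, List.map_flatMap]
  exact List.flatMap_congr fun S _ => Seq.occ_map σ S

theorem body_map (Ss : List (Seq 𝒩)) (σ f : 𝒩 → 𝒩) : (body Ss σ).map f = body Ss (f ∘ σ) := by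
  simp only [body, Agent.parAll_map, List.map_map]
  congr 2
  funext S
  simp [← Seq.toAgent_map, Seq.map_map]

theorem body_congr {Ss : List (Seq 𝒩)} {σ τ : 𝒩 → 𝒩} (h : ∀ x ∈ fnarray Ss, σ x = τ x) :
    body Ss σ = body Ss τ := by
  simp only [body]
  congr 1
  refine List.map_congr_left fun S hS => ?_
  rw [Seq.map_congr S fun x hx => h x (List.mem_flatMap.2 ⟨S, hS, hx⟩)]

theorem body_append_cong (Ss Ts : List (Seq 𝒩)) (σ : 𝒩 → 𝒩) :
    (body (Ss ++ Ts) σ).Cong (.par (body Ss σ) (body Ts σ)) := by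
  simp only [body, List.map_append]
  exact Agent.parAll_append_cong _ _

variable [DecidableEq 𝒩]

theorem vecSubst_self (l : List 𝒩) (x : 𝒩) : vecSubst l l x = x := by
  by_cases h : x ∈ l
  · simp [vecSubst, List.getElem?_idxOf h]
  · simp [vecSubst, List.idxOf_eq_length h]

theorem vecSubst_of_notMem {as bs : List 𝒩} (hl : as.length = bs.length) {x : 𝒩} (h : x ∉ as) :
    vecSubst as bs x = x := by
  simp [vecSubst, List.idxOf_eq_length h, hl]

theorem map_vecSubst {as bs : List 𝒩} (hl : as.length = bs.length) (h : as.Nodup) :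
    as.map (vecSubst as bs) = bs := by
  refine List.ext_getElem (by simpa using hl) fun i h1 h2 => ?_
  simp only [List.length_map] at h1
  simp [vecSubst, h.idxOf_getElem i h1, h2]

/-- Every guarded agent has a normal form which retains all its free names; the bound names and the
names of the linear agents can be chosen outside a given finite set. -/
theorem exists_normalForm [Infinite 𝒩] (P : Agent 𝒩 Empty) (hP : P.Guarded) (A : Finset 𝒩) :
    ∃ (v : List 𝒩) (Ss : List (Seq 𝒩)) (σ : 𝒩 → 𝒩), (Agent.scopes v (body Ss σ)).Cong P ∧
      v.Nodup ∧ (fnarray Ss).Nodup ∧ (∀ x ∈ v, x ∉ A ∧ x ∉ P.occ) ∧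
      (∀ x ∈ fnarray Ss, x ∉ A ∧ x ∉ v ∧ x ∉ P.occ) ∧
      ∀ y, y ∈ (fnarray Ss).map σ ↔ y ∈ v ∨ y ∈ P.occ := by
  obtain ⟨n, hn⟩ := Agent.exists_flat P ⟨hP, fun X => X.elim⟩
  obtain ⟨B, hBn, hB, hBA⟩ := exists_fresh_list n (A ∪ P.occ.toFinset)
  simp only [Finset.mem_union, List.mem_toFinset, not_or] at hBA
  obtain ⟨l, hl⟩ := hn id B hBn
  have hcong := hl.cong hB (by simpa using fun b hb => (hBA b hb).2)
  rw [Agent.map_id] at hcong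
  obtain ⟨Cs, rfl⟩ := Seq.exists_of_forall_sum l hl.eq_sum
  obtain ⟨L, hLn, hL, hLA⟩ := exists_fresh_list (fnarray Cs).length
    (A ∪ P.occ.toFinset ∪ B.toFinset)
  simp only [Finset.mem_union, List.mem_toFinset, not_or] at hLA
  have hmap := map_vecSubst (as := L) (bs := fnarray Cs) hLn hL
  obtain ⟨Ss, hSs, rfl⟩ := exists_fnarray_eq _ _ _ hmap
  have hbody : Agent.parAll (Cs.map Seq.toAgent) = body Ss (vecSubst (fnarray Ss) (fnarray Cs)) := by
    conv_lhs => rw [← hSs]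
    rw [body, List.map_map]
    rfl
  rw [hbody] at hcong
  set σ := vecSubst (fnarray Ss) (fnarray Cs)
  refine ⟨B.filter (· ∈ (fnarray Ss).map σ), Ss, σ, .trans ?_ hcong.symm, hB.filter _, hL,
    fun x hx => hBA x (List.mem_of_mem_filter hx), fun x hx => ?_, fun y => ?_⟩
  · refine Agent.scopes_cong_of_mem_iff fun x hx => ?_
    rw [occ_body] at hx
    simp only [List.mem_filter, decide_eq_true_eq, and_iff_left_iff_imp]
    exact fun _ => hx
  · obtain ⟨⟨h1, h2⟩, h3⟩ := hLA x hx
    exact ⟨h1, fun h => h3 (List.mem_of_mem_filter h), h2⟩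
  · simp only [List.mem_filter, decide_eq_true_eq]
    rw [hmap]
    constructor
    · intro hy
      obtain ⟨S, hS, hyS⟩ := List.mem_flatMap.1 hy
      rcases hl.mem_occ _ (List.mem_map_of_mem hS) y hyS with h | h
      · exact .inl ⟨h, hy⟩
      · exact .inr (by simpa using h)
    · rintro (h | h)
      · exact h.2
      · obtain ⟨C, hC, hyC⟩ := hl.exists_mem_occ y h
        obtain ⟨S, hS, rfl⟩ := List.mem_map.1 hC
        exact List.mem_flatMap.2 ⟨S, hS, hyC⟩

/-! ### Substitutive effects -/

theorem exists_isSubstEffect {ν : Type} (r : ν → ν → Prop) : ∃ σ : ν → ν, IsSubstEffect σ r := by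
  refine ⟨fun x => (Quot.mk r x).out, fun x => ?_, fun x y => ?_⟩
  · simp
  · rw [← Quot.eq]
    refine ⟨fun h => ?_, fun h => congrArg Quot.out h⟩
    rw [← Quot.out_eq (Quot.mk r x), ← Quot.out_eq (Quot.mk r y)]
    exact congrArg (Quot.mk r) h

theorem IsSubstEffect.congr {ν : Type} {σ : ν → ν} {r s : ν → ν → Prop} (h : IsSubstEffect σ r)
    (hrs : ∀ x y, Relation.EqvGen r x y ↔ Relation.EqvGen s x y) : IsSubstEffect σ s :=
  ⟨h.1, fun x y => (h.2 x y).trans (hrs x y)⟩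

theorem IsSubstEffect.eqvGen_apply {ν : Type} {σ : ν → ν} {r : ν → ν → Prop}
    (h : IsSubstEffect σ r) (x : ν) : Relation.EqvGen r x (σ x) :=
  (h.2 _ _).1 (h.1 x).symm

theorem eqvGen_closed {ν : Type} {r : ν → ν → Prop} {p : ν → Prop}
    (hr : ∀ x y, r x y → p x ∧ p y) {x y : ν} (h : Relation.EqvGen r x y) : x = y ∨ (p x ∧ p y) := by
  induction h with
  | rel x y h => exact .inr (hr x y h)
  | refl x => exact .inl rfl
  | symm x y _ ih => exact ih.imp Eq.symm And.symm
  | trans x y z _ _ ih ih' =>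
    rcases ih with rfl | ih
    · exact ih'
    · rcases ih' with rfl | ih'
      · exact .inr ih
      · exact .inr ⟨ih.1, ih'.2⟩

/-- A substitutive effect moves only names satisfying a property of the names in the equations, and
only to such names. -/
theorem IsSubstEffect.eq_or {ν : Type} {σ : ν → ν} {r : ν → ν → Prop} (h : IsSubstEffect σ r)
    {p : ν → Prop} (hr : ∀ x y, r x y → p x ∧ p y) (x : ν) : σ x = x ∨ (p x ∧ p (σ x)) :=
  (eqvGen_closed hr (h.eqvGen_apply x)).imp Eq.symm id

theorem eqvGen_imp {ν ν' : Type} {r : ν → ν → Prop} {s : ν' → ν' → Prop} (f : ν → ν')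
    (h : ∀ x y, r x y → Relation.EqvGen s (f x) (f y)) {x y : ν} (hxy : Relation.EqvGen r x y) :
    Relation.EqvGen s (f x) (f y) := by
  induction hxy with
  | rel x y h' => exact h x y h'
  | refl x => exact .refl _
  | symm x y _ ih => exact ih.symm
  | trans x y z _ _ ih ih' => exact ih.trans _ _ _ ih'

/-- Equations can be pulled back along a function that is injective on the names that occur in
them. -/
theorem eqvGen_of_map {ν ν' : Type} {E : List (ν × ν)} {g : ν → ν'} {p : ν → Prop}
    (hE : ∀ x y, eqRel E x y → p x ∧ p y) (hg : ∀ x y, p x → p y → g x = g y → x = y) {x y : ν}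
    (hx : p x) (hy : p y)
    (h : Relation.EqvGen (eqRel (E.map (Prod.map g g))) (g x) (g y)) :
    Relation.EqvGen (eqRel E) x y := by
  have key : ∀ a b, Relation.EqvGen (eqRel (E.map (Prod.map g g))) a b → a = b ∨
      ∃ x y, p x ∧ p y ∧ g x = a ∧ g y = b ∧ Relation.EqvGen (eqRel E) x y := by
    intro a b h
    induction h with
    | rel a b h =>
      obtain ⟨⟨x, y⟩, hxy, he⟩ := List.mem_map.1 h
      cases he
      exact .inr ⟨x, y, (hE x y hxy).1, (hE x y hxy).2, rfl, rfl, .rel _ _ hxy⟩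
    | refl a => exact .inl rfl
    | symm a b _ ih =>
      exact ih.imp Eq.symm fun ⟨x, y, hx, hy, ha, hb, h⟩ => ⟨y, x, hy, hx, hb, ha, h.symm⟩
    | trans a b c _ _ ih ih' =>
      rcases ih with rfl | ⟨x, y, hx, hy, ha, hb, h⟩
      · exact ih'
      · rcases ih' with rfl | ⟨x', y', hx', hy', ha', hb', h'⟩
        · exact .inr ⟨x, y, hx, hy, ha, hb, h⟩
        · obtain rfl := hg y x' hy hx' (hb.trans ha'.symm)
          exact .inr ⟨x, y', hx, hy', ha, hb', h.trans _ _ _ h'⟩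
  rcases key _ _ h with h | ⟨x', y', hx', hy', ha, hb, h'⟩
  · rw [hg x y hx hy h]
    exact .refl _
  · obtain rfl := hg _ _ hx' hx ha
    obtain rfl := hg _ _ hy' hy hb
    exact h'

end


/-! ### Reductions of normal forms -/

section

variable {𝒩 : Type}

theorem Agent.Flat.of_scopes [DecidableEq 𝒩] {D : Type} {v : List 𝒩} {Q : Agent 𝒩 Empty}
    (hv : v.Nodup) {f : 𝒩 → D} {C : List D} {m : List (Agent D Empty)}
    (h : (scopes v Q).Flat f C m) :
    ∃ g C', C = v.map g ++ C' ∧ Q.Flat g C' m ∧ ∀ x, x ∉ v → g x = f x := by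
  induction v generalizing f C with
  | nil => exact ⟨f, C, rfl, h, fun _ _ => rfl⟩
  | cons x v ih =>
    rw [List.nodup_cons] at hv
    obtain ⟨d, C, rfl, h⟩ := h
    rw [flat_map] at h
    obtain ⟨g, C', rfl, h, hg⟩ := ih hv.2 h
    refine ⟨g, C', ?_, h, fun y hy => ?_⟩
    · simp [hg x hv.1]
    · rw [List.mem_cons, not_or] at hy
      simp [hg y hy.2, hy.1]

theorem Agent.Flat.scopes [DecidableEq 𝒩] {Q : Agent 𝒩 Empty} {B : List 𝒩}
    {l : List (Agent 𝒩 Empty)} (h : Q.Flat id B l) (zs : List 𝒩) :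
    (scopes zs Q).Flat id (zs ++ B) l := by
  induction zs with
  | nil => exact h
  | cons z zs ih =>
    refine ⟨z, zs ++ B, rfl, ?_⟩
    rw [flat_map]
    have : ((fun o : Option 𝒩 => o.elim z id) ∘ fun y => if y = z then none else some y) = id := by
      funext y
      by_cases hy : y = z <;> simp [hy]
    rw [this]
    exact ih

theorem Agent.Flat.of_body {D : Type} {Ss : List (Seq 𝒩)} {σ : 𝒩 → 𝒩} {f : 𝒩 → D} {C : List D}
    {m : List (Agent D Empty)} (h : (body Ss σ).Flat f C m) :
    C = [] ∧ m = Ss.map (fun S => (S.map σ).toAgent.map f) := by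
  induction Ss generalizing C m with
  | nil => exact h
  | cons S Ss ih =>
    obtain ⟨B₁, B₂, l₁, l₂, rfl, rfl, ⟨rfl, rfl⟩, h⟩ := h
    obtain ⟨rfl, rfl⟩ := ih h
    exact ⟨rfl, rfl⟩

/-- The effect of the equations `E₀` on a normal form, with body `par Y K` and all names bound by
`v`, agrees with the effect of the corresponding equations `E₁` on the redex `par R K'`, where
`R` has the components `lR` and the bound names `B`. The function `g` is the correspondence of
bound names. -/
theorem scopes_map_effect_cong [DecidableEq 𝒩] {v zs B : List 𝒩} {Y K R K' : Agent 𝒩 Empty}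
    {lR : List (Agent 𝒩 Empty)} {E₀ E₁ : List (𝒩 × 𝒩)} {g τ σ' : 𝒩 → 𝒩} {O : 𝒩 → Prop}
    (hg : ∀ x ∈ v, ∀ y ∈ v, g x = g y → x = y)
    (hY : ∀ x ∈ Y.occ ++ K.occ, x ∈ v)
    (hE₀ : ∀ x y, eqRel E₀ x y → x ∈ v ∧ y ∈ v)
    (hYW : (Y.map g).Cong (Agent.parAll lR)) (hK : (K.map g).Cong K')
    (hE : ∀ x y, Relation.EqvGen (eqRel E₁) x y ↔
      Relation.EqvGen (eqRel (E₀.map (Prod.map g g))) x y)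
    (hR : R.Flat id B lR) (hB : B.Nodup) (hBO : ∀ b ∈ B, ¬ O b ∧ b ∉ zs)
    (hRO : ∀ x ∈ R.occ ++ K'.occ, O x)
    (hE₁ : ∀ x y, eqRel E₁ x y → O x ∧ O y)
    (hvO : ∀ x ∈ v, O (g x) → g x ∈ zs)
    (hτ : IsSubstEffect τ (eqRel E₀)) (hσ : IsSubstEffect σ' (eqRel E₁))
    (hdom : ∀ x, σ' x ≠ x → x ∈ zs) :
    (Agent.scopes v ((Agent.par Y K).map τ)).Cong
      (Agent.scopes zs ((Agent.par R K').map σ')) := by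
  have hEm : ∀ x y, eqRel (E₀.map (Prod.map g g)) x y → x ∈ v.map g ∧ y ∈ v.map g := by
    intro x y h
    obtain ⟨⟨a, b⟩, hab, he⟩ := List.mem_map.1 h
    cases he
    exact ⟨List.mem_map_of_mem (hE₀ a b hab).1, List.mem_map_of_mem (hE₀ a b hab).2⟩
  have hσC : ∀ x ∈ v.map g, σ' x ∈ v.map g := by
    intro x hx
    rcases (hσ.congr hE).eq_or hEm x with h | h
    · rwa [h]
    · exact h.2
  have hτv : ∀ x ∈ v, τ x ∈ v := by
    intro x hx
    rcases hτ.eq_or hE₀ x with h | h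
    · rwa [h]
    · exact h.2
  have hgτ : ∀ x, σ' (g (τ x)) = σ' (g x) := by
    intro x
    rw [hσ.2, hE]
    exact eqvGen_imp g (fun a b hab => .rel _ _ (List.mem_map.2 ⟨(a, b), hab, rfl⟩))
      (hτ.eqvGen_apply x).symm
  have hpar : ∀ x ∈ (Agent.par Y K).occ, x ∈ v := hY
  set C := v.map g with hC
  -- rename the bound names of the normal form along `g`
  have h1 : (Agent.scopes v ((Agent.par Y K).map τ)).Cong
      (Agent.scopes C (((Agent.par Y K).map g).map σ')) := by
    have : ((Agent.par Y K).map g).map σ' = ((Agent.par Y K).map τ).map (σ' ∘ g) := by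
      rw [Agent.map_map, Agent.map_map]
      exact Agent.map_congr _ fun x _ => (hgτ x).symm
    rw [this]
    have hv : ∀ x ∈ ((Agent.par Y K).map τ).occ, x ∈ v := by
      intro x hx
      rw [Agent.occ_map, List.mem_map] at hx
      obtain ⟨y, hy, rfl⟩ := hx
      exact hτv y (hpar y hy)
    refine Agent.scopes_cong_map ?_ ?_ ?_
    · intro x hx y hy hxy
      have hxy' : Relation.EqvGen (eqRel E₀) x y :=
        eqvGen_of_map hE₀ (fun a b ha hb => hg a ha b hb) (hv x hx) (hv y hy)
          ((hE _ _).1 ((hσ.2 _ _).1 hxy))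
      simp only [Set.mem_ofPred_eq, Agent.occ_map, List.mem_map] at hx hy
      obtain ⟨x, -, rfl⟩ := hx
      obtain ⟨y, -, rfl⟩ := hy
      have := (hτ.2 _ _).2 hxy'
      rwa [hτ.1, hτ.1] at this
    · exact fun x hx => iff_of_true (hv x hx) (hσC _ (List.mem_map_of_mem (hv x hx)))
    · exact fun x hx h => (h (hv x hx)).elim
  set W := Agent.par (Agent.parAll lR) K' with hW
  have hZW : (((Agent.par Y K).map g).map σ').Cong (W.map σ') :=
    (Agent.Cong.par hYW hK).map σ'
  have hZC : ∀ x ∈ (((Agent.par Y K).map g).map σ').occ, x ∈ C := by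
    intro x hx
    simp only [Agent.occ_map, List.mem_map] at hx
    obtain ⟨_, ⟨y, hy, rfl⟩, rfl⟩ := hx
    exact hσC _ (List.mem_map_of_mem (hpar y hy))
  have hWO : ∀ x ∈ W.occ, x ∈ B ∨ O x := by
    intro x hx
    rcases List.mem_append.1 hx with hx | hx
    · rw [Agent.occ_parAll] at hx
      obtain ⟨D, hD, hx⟩ := List.mem_flatMap.1 hx
      rcases hR.mem_occ D hD x hx with h | h
      · exact .inl h
      · exact .inr (hRO x (List.mem_append_left _ (by simpa using h)))
    · exact .inr (hRO x (List.mem_append_right _ hx))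
  -- names that occur on one side only are superfluous, so their binders can be exchanged
  have h2 : (Agent.scopes C (((Agent.par Y K).map g).map σ')).Cong
      (Agent.scopes (zs ++ B) (W.map σ')) := by
    refine (Agent.scopes_cong_of_mem_iff (ys := C ++ (zs ++ B)) fun x hx => ?_).trans
      ((hZW.scopes _).trans (Agent.scopes_cong_of_mem_iff fun x hx => ?_))
    · exact iff_of_true (hZC x hx) (List.mem_append_left _ (hZC x hx))
    · rw [List.mem_append, or_iff_right_iff_imp]
      intro hxC
      rw [Agent.occ_map, List.mem_map] at hx
      obtain ⟨y, hy, rfl⟩ := hx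
      have hO : σ' y ∈ B ∨ O (σ' y) := by
        rcases hσ.eq_or hE₁ y with h | h
        · rw [h]; exact hWO y hy
        · exact .inr h.2
      rcases hO with h | h
      · exact List.mem_append_right _ h
      · obtain ⟨z, hz, hzy⟩ := List.mem_map.1 hxC
        rw [← hzy] at h ⊢
        exact List.mem_append_left _ (hvO z hz h)
  have hσB : ∀ b ∈ B, σ' b = b := fun b hb => by
    by_contra h
    exact (hBO b hb).2 (hdom b h)
  have h3 : (Agent.scopes B (W.map σ')).Cong ((Agent.par R K').map σ') := by
    have hRB : R.Cong (Agent.scopes B (Agent.parAll lR)) := by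
      have := hR.cong hB fun b hb h => (hBO b hb).1 (hRO b (List.mem_append_left _ (by simpa using h)))
      rwa [Agent.map_id] at this
    have : (Agent.par R K').Cong (Agent.scopes B W) :=
      (Agent.Cong.par hRB (.refl _)).trans (Agent.scopes_par_cong fun b hb h =>
        (hBO b hb).1 (hRO b (List.mem_append_right _ h)))
    refine (Agent.Cong.of_eq ?_).trans (this.map σ').symm
    rw [Agent.scopes_map]
    · congr 1
      conv_lhs => rw [← List.map_id B]
      exact List.map_congr_left fun b hb => (hσB b hb).symm
    · intro b hb y _ h
      rw [hσB b hb] at h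
      rcases hσ.eq_or hE₁ y with h' | h'
      · rw [← h', h]
      · exact ((hBO b hb).1 (h ▸ h'.2)).elim
  rw [Agent.scopes_append] at h2
  exact h1.trans (h2.trans (h3.scopes zs))

/-- Components of a normal form that correspond to a given list of components. -/
theorem exists_components_of_sumsEqv {D : Type} {Ss : List (Seq 𝒩)}
    {h : Seq 𝒩 → Agent D Empty} {l₁ l₂ : List (Agent D Empty)}
    (he : Agent.SumsEqv (l₁ ++ l₂) (Ss.map h)) :
    ∃ Sr Ts : List (Seq 𝒩), (Sr ++ Ts).Perm Ss ∧
      List.Forall₂ Agent.SumEqv l₁ (Sr.map h) ∧ List.Forall₂ Agent.SumEqv l₂ (Ts.map h) := by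
  obtain ⟨a, hla, ham⟩ := he
  obtain ⟨Ss', hperm, rfl⟩ : ∃ Ss' : List (Seq 𝒩), Ss'.Perm Ss ∧ Ss'.map h = a := by
    have : Relation.Comp List.Perm (List.Forall₂ fun b S => b = h S) a Ss := by
      refine ⟨Ss.map h, ham, ?_⟩
      rw [List.forall₂_map_left_iff, List.forall₂_same]
      exact fun _ _ => rfl
    rw [← List.forall₂_comp_perm_eq_perm_comp_forall₂] at this
    obtain ⟨Ss', h1, h2⟩ := this
    refine ⟨Ss', h2, ?_⟩
    clear hla ham h2
    induction h1 with
    | nil => rfl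
    | cons h _ ih => rw [List.map_cons, ih, h]
  refine ⟨Ss'.take l₁.length, Ss'.drop l₁.length, by simpa using hperm, ?_, ?_⟩
  · rw [List.map_take]
    simpa using List.forall₂_take l₁.length hla
  · rw [List.map_drop]
    simpa using List.forall₂_drop l₁.length hla

theorem Prefix.Same.eq_input {ν : Type} {c : ν} {xs : List ν} {β : Prefix ν}
    (h : (Prefix.input c xs).Same β) : β = .input c xs := by
  cases h; rfl

theorem Prefix.Same.eq_output {ν : Type} {c : ν} {xs : List ν} {β : Prefix ν}
    (h : (Prefix.output c xs).Same β) : β = .output c xs := by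
  cases h; rfl

theorem Prefix.Same.eq_fusion {ν : Type} {E : List (ν × ν)} {β : Prefix ν}
    (h : (Prefix.fusion E).Same β) : ∃ F, β = .fusion F ∧
      ∀ x y, Relation.EqvGen (eqRel E) x y ↔ Relation.EqvGen (eqRel F) x y := by
  cases h with
  | refl => exact ⟨E, rfl, fun _ _ => .rfl⟩
  | fusion _ F h => exact ⟨F, rfl, h⟩

theorem Prefix.map_eq_input {ν ν' : Type} {f : ν → ν'} {α : Prefix ν} {c : ν'} {xs : List ν'}
    (h : α.map f = .input c xs) : ∃ c' xs', α = .input c' xs' ∧ f c' = c ∧ xs'.map f = xs := by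
  cases α <;> simp_all [Prefix.map]

theorem Prefix.map_eq_output {ν ν' : Type} {f : ν → ν'} {α : Prefix ν} {c : ν'} {xs : List ν'}
    (h : α.map f = .output c xs) : ∃ c' xs', α = .output c' xs' ∧ f c' = c ∧ xs'.map f = xs := by
  cases α <;> simp_all [Prefix.map]

theorem Prefix.map_eq_fusion {ν ν' : Type} {f : ν → ν'} {α : Prefix ν} {E : List (ν' × ν')}
    (h : α.map f = .fusion E) : ∃ E', α = .fusion E' ∧ E'.map (Prod.map f f) = E := by
  cases α <;> simp_all [Prefix.map]

theorem Agent.SumEqv.exists_of_toAgent {ν : Type} {n : ℕ} {α : Fin n → Prefix ν}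
    {P : Fin n → Agent ν Empty} {S : Seq ν} (h : SumEqv (Agent.sum n α P) S.toAgent) (i : Fin n) :
    ∃ j : Fin S.n, (α i).Same (S.pre j) ∧ (P i).Cong (S.cont j) := by
  obtain ⟨m, β, Q⟩ := S
  obtain ⟨e, hα, hP⟩ := h
  exact ⟨e i, hα i, hP i⟩

theorem Seq.occ_pre_subset {ν : Type} (S : Seq ν) (i : Fin S.n) : (S.pre i).occ ⊆ S.occ := by
  intro x hx
  exact List.mem_flatMap.2 ⟨i, List.mem_finRange i, List.mem_append_left _ hx⟩

theorem Seq.occ_cont_subset {ν : Type} (S : Seq ν) (i : Fin S.n) : (S.cont i).occ ⊆ S.occ := by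
  intro x hx
  exact List.mem_flatMap.2 ⟨i, List.mem_finRange i, List.mem_append_right _ hx⟩

theorem mem_occ_of_mem_fusion {ν : Type} {E : List (ν × ν)} {p : ν × ν} (h : p ∈ E) :
    p.1 ∈ (Prefix.fusion E).occ ∧ p.2 ∈ (Prefix.fusion E).occ :=
  ⟨List.mem_flatMap.2 ⟨p, h, by simp⟩, List.mem_flatMap.2 ⟨p, h, by simp⟩⟩

/-- The reductions of a normal form `(v)(Ss σ)` without free names, described in terms of its
sequential agents: a communication of two of them, or a fusion. The effect of the reduction is a
substitutive effect `τ` of the images under `σ` of the equations of the prefixes. -/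
inductive NormalStep [DecidableEq 𝒩] (v : List 𝒩) (Ss : List (Seq 𝒩)) (σ : 𝒩 → 𝒩)
    (P' : Agent 𝒩 Empty) : Prop
  | comm (Sr : List (Seq 𝒩)) (T₁ T₂ : Seq 𝒩) (hperm : (Sr ++ [T₁, T₂]).Perm Ss) (i : Fin T₁.n)
      (j : Fin T₂.n) (c₁ c₂ : 𝒩) (xs ys : List 𝒩) (hi : T₁.pre i = .input c₁ xs)
      (hj : T₂.pre j = .output c₂ ys) (hc : σ c₁ = σ c₂) (hlen : xs.length = ys.length)
      (hP' : ∀ τ, IsSubstEffect τ (eqRel ((xs.zip ys).map (Prod.map σ σ))) →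
        (Agent.scopes v ((Agent.par (body Sr σ)
          (.par ((T₁.cont i).map σ) ((T₂.cont j).map σ))).map τ)).Cong P')
  | fuse (Sr : List (Seq 𝒩)) (T : Seq 𝒩) (hperm : (Sr ++ [T]).Perm Ss) (i : Fin T.n)
      (E : List (𝒩 × 𝒩)) (hi : T.pre i = .fusion E)
      (hP' : ∀ τ, IsSubstEffect τ (eqRel (E.map (Prod.map σ σ))) →
        (Agent.scopes v ((Agent.par (body Sr σ) ((T.cont i).map σ)).map τ)).Cong P')

theorem NormalStep.of_cong [DecidableEq 𝒩] {v : List 𝒩} {Ss : List (Seq 𝒩)} {σ : 𝒩 → 𝒩}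
    {P' P'' : Agent 𝒩 Empty} (h : NormalStep v Ss σ P') (hP : P'.Cong P'') :
    NormalStep v Ss σ P'' := by
  cases h with
  | comm Sr T₁ T₂ hperm i j c₁ c₂ xs ys hi hj hc hlen hP' =>
    exact .comm Sr T₁ T₂ hperm i j c₁ c₂ xs ys hi hj hc hlen fun τ hτ => (hP' τ hτ).trans hP
  | fuse Sr T hperm i E hi hP' => exact .fuse Sr T hperm i E hi fun τ hτ => (hP' τ hτ).trans hP

theorem zip_map_prod {α β : Type} (f : α → β) (xs ys : List α) :
    (xs.zip ys).map (Prod.map f f) = (xs.map f).zip (ys.map f) := by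
  rw [List.zip_map]

theorem eqRel_zip_mem {ν : Type} {xs ys : List ν} {a b : ν} (h : eqRel (xs.zip ys) a b) :
    a ∈ xs ∧ b ∈ ys := List.of_mem_zip h

/-- The components of a normal form match those of a structurally congruent redex. -/
theorem exists_matching [Infinite 𝒩] [DecidableEq 𝒩] {v : List 𝒩} {Ss : List (Seq 𝒩)}
    {σ : 𝒩 → 𝒩} (hv : v.Nodup) (hN : (Agent.scopes v (body Ss σ)).Guarded) {zs : List 𝒩}
    {R S : Agent 𝒩 Empty} {l₂ : List (Agent 𝒩 Empty)} (hS : S.Flat id [] l₂)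
    (hcong : (Agent.scopes v (body Ss σ)).Cong (Agent.scopes zs (.par R S))) :
    ∃ (B : List 𝒩) (lR : List (Agent 𝒩 Empty)) (g : 𝒩 → 𝒩) (Sr Ts : List (Seq 𝒩)),
      R.Flat id B lR ∧ B.Nodup ∧ (∀ b ∈ B, b ∉ R.occ ++ S.occ ∧ b ∉ zs) ∧
      (∀ x ∈ v, ∀ y ∈ v, g x = g y → x = y) ∧
      (∀ x ∈ v, g x ∈ R.occ ++ S.occ → g x ∈ zs) ∧ (Sr ++ Ts).Perm Ss ∧
      List.Forall₂ Agent.SumEqv lR (Sr.map fun T => ((T.map σ).map g).toAgent) ∧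
      List.Forall₂ Agent.SumEqv l₂ (Ts.map fun T => ((T.map σ).map g).toAgent) := by
  have hcong' : (Agent.scopes zs (.par R S)).Cong (Agent.scopes zs.dedup (.par R S)) :=
    Agent.scopes_cong_of_mem_iff fun x _ => by simp
  have hP := hcong.trans hcong'
  have hR : R.HeadGuarded :=
    ⟨((Agent.guarded_scopes _ _).1 (hP.guarded_iff.1 hN)).1, fun X => X.elim⟩
  -- the redex has no restrictions at its head, those of `R` are instantiated with fresh names
  obtain ⟨n, hn⟩ := Agent.exists_flat R hR
  obtain ⟨B, hBn, hB, hBA⟩ := exists_fresh_list n ((R.occ ++ S.occ).toFinset ∪ zs.toFinset)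
  simp only [Finset.mem_union, List.mem_toFinset, not_or] at hBA
  obtain ⟨lR, hlR⟩ := hn id B hBn
  have hflat : (Agent.scopes zs.dedup (.par R S)).Flat id (zs.dedup ++ (B ++ [])) (lR ++ l₂) :=
    Agent.Flat.scopes (Q := .par R S) ⟨B, [], lR, l₂, rfl, rfl, hlR, hS⟩ _
  rw [List.append_nil] at hflat
  obtain ⟨C, m, hm, hC, hCA, he⟩ := (hP.transfers ⟨hN, fun X => X.elim⟩).2 𝒩 id
    {x | x ∈ R.occ ++ S.occ ∧ x ∉ zs} _ _
    ((R.occ ++ S.occ).finite_toSet.subset fun x hx => hx.1) hflat (by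
      refine List.nodup_append.2 ⟨List.nodup_dedup _, hB, ?_⟩
      rintro a ha _ hb rfl
      exact (hBA a hb).2 (List.mem_dedup.1 ha)) (by
      rintro b hb ⟨h1, h2⟩
      rcases List.mem_append.1 hb with hb | hb
      · exact h2 (List.mem_dedup.1 hb)
      · exact (hBA b hb).1 h1)
  obtain ⟨g, C', rfl, hm, -⟩ := hm.of_scopes hv
  obtain ⟨rfl, rfl⟩ := hm.of_body
  obtain ⟨Sr, Ts, hperm, h1, h2⟩ := exists_components_of_sumsEqv he
  rw [List.append_nil] at hC hCA
  refine ⟨B, lR, g, Sr, Ts, hlR, hB, hBA, ?_, ?_, hperm, h1, h2⟩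
  · exact fun x hx y hy h => List.inj_on_of_nodup_map hC hx hy h
  · intro x hx h
    by_contra h'
    exact hCA _ (List.mem_map_of_mem hx) ⟨h, h'⟩

theorem body_cong_of_forall₂ {Sr : List (Seq 𝒩)} {σ g : 𝒩 → 𝒩} {lR : List (Agent 𝒩 Empty)}
    (h : List.Forall₂ Agent.SumEqv lR (Sr.map fun T => ((T.map σ).map g).toAgent)) :
    ((body Sr σ).map g).Cong (Agent.parAll lR) := by
  refine Agent.Cong.symm ?_
  rw [body, Agent.parAll_map, List.map_map]
  exact Agent.parAll_forall₂_cong (h.imp fun _ _ h => h.cong)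

/-- Every reduction of a guarded agent without free names is a reduction of each of its normal
forms. -/
theorem Red.normalStep [Infinite 𝒩] [DecidableEq 𝒩] {P P' : Agent 𝒩 Empty} (h : Red P P')
    {v : List 𝒩} {Ss : List (Seq 𝒩)} {σ : 𝒩 → 𝒩} (hv : v.Nodup)
    (hσ : ∀ x ∈ fnarray Ss, σ x ∈ v) (hN : (Agent.scopes v (body Ss σ)).Guarded)
    (hcong : (Agent.scopes v (body Ss σ)).Cong P) : NormalStep v Ss σ P' := by
  induction h with
  | struct h₁ _ h₃ ih => exact (ih (hcong.trans h₁)).of_cong h₃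
  | comm zs R n α P i m β Q j c xs ys σ' hα hβ hlen hσ' hdom =>
    obtain ⟨B, lR, g, Sr, Ts, hR, hB, hBO, hg, hgO, hperm, h1, h2⟩ :=
      exists_matching hv hN (S := .par (.sum n α P) (.sum m β Q))
        (l₂ := [.sum n α P, .sum m β Q])
        ⟨[], [], [.sum n α P], [.sum m β Q], rfl, rfl, ⟨rfl, by rw [Agent.map_id]⟩,
          ⟨rfl, by rw [Agent.map_id]⟩⟩ hcong
    obtain ⟨T₁, T₂, rfl⟩ : ∃ T₁ T₂, Ts = [T₁, T₂] := by
      have := h2.length_eq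
      simpa [List.length_eq_two, eq_comm] using this
    simp only [List.map_cons, List.map_nil, List.forall₂_cons, List.Forall₂.nil, and_true] at h2
    obtain ⟨e₁, e₂⟩ := h2
    obtain ⟨i', hi', hPi⟩ := e₁.exists_of_toAgent i
    obtain ⟨j', hj', hQj⟩ := e₂.exists_of_toAgent j
    rw [hα] at hi'
    rw [hβ] at hj'
    obtain ⟨c₁', xs', h3, rfl, rfl⟩ := Prefix.map_eq_input hi'.eq_input
    obtain ⟨c₁, xs, hi, rfl, rfl⟩ := Prefix.map_eq_input h3
    obtain ⟨c₂', ys', h3, hc, rfl⟩ := Prefix.map_eq_output hj'.eq_output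
    obtain ⟨c₂, ys, hj, rfl, rfl⟩ := Prefix.map_eq_output h3
    have hT : ∀ T ∈ Sr ++ [T₁, T₂], ∀ x ∈ T.occ, σ x ∈ v := fun T hT x hx =>
      hσ x (List.mem_flatMap.2 ⟨T, hperm.mem_iff.1 hT, hx⟩)
    have hT₁ : ∀ x ∈ T₁.occ, σ x ∈ v := hT T₁ (by simp)
    have hT₂ : ∀ x ∈ T₂.occ, σ x ∈ v := hT T₂ (by simp)
    have hp₁ := T₁.occ_pre_subset i'
    have hp₂ := T₂.occ_pre_subset j'
    have hk₁ := T₁.occ_cont_subset i'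
    have hk₂ := T₂.occ_cont_subset j'
    change (T₁.pre i').occ ⊆ _ at hp₁
    rw [hi] at hp₁
    rw [hj] at hp₂
    refine .comm Sr T₁ T₂ hperm i' j' c₁ c₂ xs ys hi hj ?_ (by simpa using hlen) fun τ hτ => ?_
    -- `g` is injective on `v`, so the subjects agree in the normal form already
    · exact hg _ (hT₁ _ (hp₁ List.mem_cons_self)) _ (hT₂ _ (hp₂ List.mem_cons_self)) hc.symm
    · have hPα : ∀ x ∈ (α i).occ ++ (P i).occ, x ∈ (Agent.sum n α P).occ := fun x hx =>
        List.mem_flatMap.2 ⟨i, List.mem_finRange i, hx⟩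
      have hQβ : ∀ x ∈ (β j).occ ++ (Q j).occ, x ∈ (Agent.sum m β Q).occ := fun x hx =>
        List.mem_flatMap.2 ⟨j, List.mem_finRange j, hx⟩
      refine scopes_map_effect_cong (E₀ := (xs.zip ys).map (Prod.map σ σ)) (lR := lR)
        (O := fun x => x ∈ R.occ ++ (Agent.par (.sum n α P) (.sum m β Q)).occ) hg ?_ ?_
        (body_cong_of_forall₂ h1) (.par hPi.symm hQj.symm) ?_ hR hB hBO ?_ ?_ hgO hτ hσ' hdom
      · intro x hx
        simp only [occ_body, Agent.occ, Agent.occ_map, List.mem_append, List.mem_map] at hx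
        rcases hx with ⟨y, hy, rfl⟩ | ⟨y, hy, rfl⟩ | ⟨y, hy, rfl⟩
        · obtain ⟨T, hTm, hy⟩ := List.mem_flatMap.1 hy
          exact hT T (List.mem_append_left _ hTm) y hy
        · exact hT₁ y (hk₁ hy)
        · exact hT₂ y (hk₂ hy)
      · rw [zip_map_prod]
        intro x y hxy
        obtain ⟨hx, hy⟩ := eqRel_zip_mem hxy
        obtain ⟨a, ha, rfl⟩ := List.mem_map.1 hx
        obtain ⟨b, hb, rfl⟩ := List.mem_map.1 hy
        exact ⟨hT₁ a (hp₁ (List.mem_cons_of_mem _ ha)), hT₂ b (hp₂ (List.mem_cons_of_mem _ hb))⟩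
      · intro x y
        rw [zip_map_prod, zip_map_prod]
      · intro x hx
        simp only [Agent.occ, List.mem_append] at hx ⊢
        rcases hx with hx | hx | hx
        · exact .inl hx
        · exact .inr (.inl (hPα x (List.mem_append_right _ hx)))
        · exact .inr (.inr (hQβ x (List.mem_append_right _ hx)))
      · intro x y hxy
        obtain ⟨hx, hy⟩ := eqRel_zip_mem hxy
        refine ⟨List.mem_append_right _ (List.mem_append_left _ (hPα x ?_)),
          List.mem_append_right _ (List.mem_append_right _ (hQβ y ?_))⟩
        · rw [hα]; exact List.mem_append_left _ (List.mem_cons_of_mem _ hx)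
        · rw [hβ]; exact List.mem_append_left _ (List.mem_cons_of_mem _ hy)
  | fuse zs R n α P i E σ' hα hσ' hdom =>
    obtain ⟨B, lR, g, Sr, Ts, hR, hB, hBO, hg, hgO, hperm, h1, h2⟩ :=
      exists_matching hv hN (S := .sum n α P)
        (l₂ := [.sum n α P]) ⟨rfl, by rw [Agent.map_id]⟩ hcong
    obtain ⟨T, rfl⟩ : ∃ T, Ts = [T] := by
      have := h2.length_eq
      simpa [List.length_eq_one_iff, eq_comm] using this
    simp only [List.map_cons, List.map_nil, List.forall₂_cons, List.Forall₂.nil, and_true] at h2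
    obtain ⟨i', hi', hPi⟩ := h2.exists_of_toAgent i
    rw [hα] at hi'
    obtain ⟨F, hF, hEF⟩ := hi'.eq_fusion
    obtain ⟨F', h3, rfl⟩ := Prefix.map_eq_fusion hF
    obtain ⟨F, hi, rfl⟩ := Prefix.map_eq_fusion h3
    have hT : ∀ T' ∈ Sr ++ [T], ∀ x ∈ T'.occ, σ x ∈ v := fun T hT x hx =>
      hσ x (List.mem_flatMap.2 ⟨T, hperm.mem_iff.1 hT, hx⟩)
    have hT₁ : ∀ x ∈ T.occ, σ x ∈ v := hT T (by simp)
    have hp₁ := T.occ_pre_subset i'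
    have hk₁ := T.occ_cont_subset i'
    rw [hi] at hp₁
    refine .fuse Sr T hperm i' F hi fun τ hτ => ?_
    have hPα : ∀ x ∈ (α i).occ ++ (P i).occ, x ∈ (Agent.sum n α P).occ := fun x hx =>
      List.mem_flatMap.2 ⟨i, List.mem_finRange i, hx⟩
    refine scopes_map_effect_cong (E₀ := F.map (Prod.map σ σ)) (lR := lR)
      (O := fun x => x ∈ R.occ ++ (Agent.sum n α P).occ) hg ?_ ?_
      (body_cong_of_forall₂ h1) hPi.symm hEF hR hB hBO ?_ ?_ hgO hτ hσ' hdom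
    · intro x hx
      simp only [occ_body, Agent.occ_map, List.mem_append, List.mem_map] at hx
      rcases hx with ⟨y, hy, rfl⟩ | ⟨y, hy, rfl⟩
      · obtain ⟨T, hTm, hy⟩ := List.mem_flatMap.1 hy
        exact hT T (List.mem_append_left _ hTm) y hy
      · exact hT₁ y (hk₁ hy)
    · intro x y hxy
      obtain ⟨⟨a, b⟩, hab, he⟩ := List.mem_map.1 hxy
      cases he
      exact ⟨hT₁ a (hp₁ (mem_occ_of_mem_fusion hab).1), hT₁ b (hp₁ (mem_occ_of_mem_fusion hab).2)⟩
    · intro x hx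
      simp only [List.mem_append] at hx ⊢
      exact hx.imp_right fun hx => hPα x (List.mem_append_right _ hx)
    · intro x y hxy
      have := mem_occ_of_mem_fusion hxy
      rw [← hα] at this
      exact ⟨List.mem_append_right _ (hPα x (List.mem_append_left _ this.1)),
        List.mem_append_right _ (hPα y (List.mem_append_left _ this.2))⟩

end


/-! ### Graphs -/

section

variable {L : Type u} [RankedAlphabet L] {𝒩 : Type}

theorem Edge.rename_rename (f g : 𝒩 → 𝒩) (e : Edge L 𝒩) :
    (e.rename f).rename g = e.rename (g ∘ f) := by
  simp [Edge.rename]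

theorem Edge.rename_congr {f g : 𝒩 → 𝒩} {e : Edge L 𝒩} (h : ∀ x ∈ e.att, f x = g x) :
    e.rename f = e.rename g :=
  Edge.ext rfl (List.map_congr_left h)

theorem Edge.rename_eq_self {f : 𝒩 → 𝒩} {e : Edge L 𝒩} (h : ∀ x ∈ e.att, f x = x) :
    e.rename f = e :=
  Edge.ext rfl (by
    conv_rhs => rw [← List.map_id e.att]
    exact List.map_congr_left h)

theorem Graph.rename_rename (f g : 𝒩 → 𝒩) (G : Graph L 𝒩) :
    Graph.rename g (Graph.rename f G) = Graph.rename (g ∘ f) G := by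
  simp [Graph.rename, Edge.rename_rename]

theorem Graph.rename_add (f : 𝒩 → 𝒩) (G H : Graph L 𝒩) :
    Graph.rename f (G + H) = Graph.rename f G + Graph.rename f H := by
  simp [Graph.rename]

variable [DecidableEq 𝒩]

theorem Graph.mem_names {G : Graph L 𝒩} {x : 𝒩} :
    x ∈ Graph.names G ↔ ∃ e ∈ G, x ∈ e.att := by
  simp [Graph.names]

theorem Graph.names_add (G H : Graph L 𝒩) :
    Graph.names (G + H) = Graph.names G ∪ Graph.names H := by
  ext x
  simp only [Graph.mem_names, Multiset.mem_add, Finset.mem_union, or_and_right, exists_or]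

theorem Graph.mem_names_rename {f : 𝒩 → 𝒩} {G : Graph L 𝒩} {y : 𝒩} :
    y ∈ Graph.names (Graph.rename f G) ↔ ∃ x ∈ Graph.names G, f x = y := by
  simp only [Graph.mem_names, Graph.rename, Multiset.mem_map]
  constructor
  · rintro ⟨_, ⟨e, he, rfl⟩, hy⟩
    obtain ⟨x, hx, rfl⟩ := List.mem_map.1 hy
    exact ⟨x, ⟨e, he, hx⟩, rfl⟩
  · rintro ⟨x, ⟨e, he, hx⟩, rfl⟩
    exact ⟨_, ⟨e, he, rfl⟩, List.mem_map_of_mem hx⟩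

theorem Graph.rename_congr {f g : 𝒩 → 𝒩} {G : Graph L 𝒩}
    (h : ∀ x ∈ Graph.names G, f x = g x) : Graph.rename f G = Graph.rename g G :=
  Multiset.map_congr rfl fun e he => Edge.rename_congr fun x hx =>
    h x (Graph.mem_names.2 ⟨e, he, hx⟩)

theorem Graph.rename_eq_self {f : 𝒩 → 𝒩} {G : Graph L 𝒩}
    (h : ∀ x ∈ Graph.names G, f x = x) : Graph.rename f G = G := by
  rw [Graph.rename_congr (g := id) h]
  conv_rhs => rw [← Multiset.map_id G]
  exact Multiset.map_congr rfl fun e _ => Edge.rename_eq_self fun _ _ => rfl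

end

section

variable {𝒩 : Type}

/-- The parallel composition of the edges `n(x)` for `x` in a list. -/
def nEdges (l : List 𝒩) : Graph Label 𝒩 := Multiset.ofList (l.map nEdge)

/-- The parallel composition of binary routers `m(x, y)` for a list of pairs. -/
def links (l : List (𝒩 × 𝒩)) : Graph Label 𝒩 :=
  Multiset.ofList (l.map fun p => mEdge p.1 p.2 [])

theorem nEdges_append (l m : List 𝒩) : nEdges (l ++ m) = nEdges l + nEdges m := by
  simp [nEdges]

theorem links_append (l m : List (𝒩 × 𝒩)) : links (l ++ m) = links l + links m := by
  simp [links]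

theorem mEdge_rename (f : 𝒩 → 𝒩) (x y : 𝒩) (zs : List 𝒩) :
    (mEdge x y zs).rename f = mEdge (f x) (f y) (zs.map f) :=
  Edge.ext (by simp [Edge.rename, mEdge]) rfl

theorem rename_links (f : 𝒩 → 𝒩) (l : List (𝒩 × 𝒩)) :
    Graph.rename f (links l) = links (l.map (Prod.map f f)) := by
  simp only [Graph.rename, links, Multiset.map_coe, List.map_map]
  rfl

variable [DecidableEq 𝒩]

/-- The parallel composition of the translations of linear sequential agents. -/
def procs (Ss : List (Seq 𝒩)) : Graph Label 𝒩 := Multiset.ofList (Ss.map procEdge)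

theorem procs_append (Ss Ts : List (Seq 𝒩)) : procs (Ss ++ Ts) = procs Ss + procs Ts := by
  simp [procs]

theorem procs_perm {Ss Ts : List (Seq 𝒩)} (h : Ss.Perm Ts) : procs Ss = procs Ts :=
  Multiset.coe_eq_coe.2 (h.map _)

theorem mem_names_procs {Ss : List (Seq 𝒩)} {x : 𝒩} :
    x ∈ Graph.names (procs Ss) ↔ x ∈ fnarray Ss := by
  simp [Graph.mem_names, procs, fnarray, procEdge]

theorem mem_names_nEdges {l : List 𝒩} {x : 𝒩} : x ∈ Graph.names (nEdges l) ↔ x ∈ l := by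
  simp [Graph.mem_names, nEdges, nEdge]

theorem mem_names_links {l : List (𝒩 × 𝒩)} {x : 𝒩} :
    x ∈ Graph.names (links l) ↔ x ∈ l.map Prod.fst ∨ x ∈ l.map Prod.snd := by
  simp only [Graph.mem_names, links, mEdge, Multiset.mem_coe, List.mem_map]
  constructor
  · rintro ⟨_, ⟨p, hp, rfl⟩, hx⟩
    simp only [List.mem_cons, List.not_mem_nil, or_false] at hx
    exact hx.imp (fun h => ⟨p, hp, h.symm⟩) fun h => ⟨p, hp, h.symm⟩
  · rintro (⟨p, hp, rfl⟩ | ⟨p, hp, rfl⟩)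
    · exact ⟨_, ⟨p, hp, rfl⟩, by simp⟩
    · exact ⟨_, ⟨p, hp, rfl⟩, by simp⟩

/-- The edge of `substGraph dom σ` at the node `x` of the image of `σ`. The value `n(x)` for `x`
outside of the image is a default. -/
def router (dom : List 𝒩) (σ : 𝒩 → 𝒩) (x : 𝒩) : Edge Label 𝒩 :=
  match dom.filter (fun y => σ y = x) with
  | [] => nEdge x
  | y :: ys => mEdge x y ys

theorem router_att (dom : List 𝒩) (σ : 𝒩 → 𝒩) (x : 𝒩) :
    (router dom σ x).att = x :: dom.filter (fun y => σ y = x) := by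
  unfold router
  split
  · next h => rw [h]; rfl
  · next h => rw [h]; rfl

theorem router_eq_mEdge {dom : List 𝒩} {σ : 𝒩 → 𝒩} {x : 𝒩} (hx : x ∈ dom.map σ) :
    ∃ y ys, dom.filter (fun y => σ y = x) = y :: ys ∧ router dom σ x = mEdge x y ys := by
  unfold router
  split
  · next h =>
    obtain ⟨y, hy, rfl⟩ := List.mem_map.1 hx
    simp only [List.filter_eq_nil_iff, decide_eq_true_eq] at h
    exact (h y hy rfl).elim
  · next y ys h => exact ⟨y, ys, h, rfl⟩

theorem substGraph_eq (dom : List 𝒩) (σ : 𝒩 → 𝒩) :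
    substGraph dom σ = Multiset.ofList ((dom.map σ).dedup.map (router dom σ)) := by
  rw [← Multiset.map_coe, ← Multiset.bind_singleton, substGraph]
  refine Multiset.bind_congr fun x hx => ?_
  rw [Multiset.mem_coe, List.mem_dedup] at hx
  obtain ⟨y, ys, h, h'⟩ := router_eq_mEdge hx
  rw [h, h']

theorem mem_substGraph {dom : List 𝒩} {σ : 𝒩 → 𝒩} {e : Edge Label 𝒩} :
    e ∈ substGraph dom σ ↔ ∃ y ∈ dom, router dom σ (σ y) = e := by
  simp [substGraph_eq]

theorem mem_names_substGraph {dom : List 𝒩} {σ : 𝒩 → 𝒩} {x : 𝒩} :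
    x ∈ Graph.names (substGraph dom σ) ↔ x ∈ dom ∨ x ∈ dom.map σ := by
  simp only [Graph.mem_names, mem_substGraph]
  constructor
  · rintro ⟨_, ⟨y, hy, rfl⟩, hx⟩
    rw [router_att, List.mem_cons] at hx
    rcases hx with rfl | hx
    · exact .inr (List.mem_map_of_mem hy)
    · exact .inl (List.mem_of_mem_filter hx)
  · rintro (hx | hx)
    · exact ⟨_, ⟨x, hx, rfl⟩, by simp [router_att, hx]⟩
    · obtain ⟨y, hy, rfl⟩ := List.mem_map.1 hx
      exact ⟨_, ⟨y, hy, rfl⟩, by simp [router_att]⟩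

/-- The translation of an injective renaming consists of binary routers. -/
theorem substGraph_of_injOn {dom : List 𝒩} {σ : 𝒩 → 𝒩} (hd : dom.Nodup)
    (h : ∀ x ∈ dom, ∀ y ∈ dom, σ x = σ y → x = y) :
    substGraph dom σ = links (dom.map fun x => (σ x, x)) := by
  rw [substGraph_eq, List.Nodup.dedup (hd.map_on h), links]
  congr 1
  simp only [List.map_map]
  refine List.map_congr_left fun x hx => ?_
  simp only [Function.comp]
  have : dom.filter (fun y => σ y = σ x) = [x] := by
    have h1 : dom.filter (fun y => σ y = σ x) = dom.filter (fun y => y = x) :=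
      List.filter_congr fun y hy => by
        simp only [decide_eq_decide]
        exact ⟨fun h' => h y hy x hx h', fun h' => by rw [h']⟩
    rw [h1, List.filter_eq, List.count_eq_one_of_mem hd hx]
    rfl
  unfold router
  rw [this]

theorem substGraph_map (e : Equiv.Perm 𝒩) (dom : List 𝒩) (σ : 𝒩 → 𝒩) :
    substGraph (dom.map e) (e ∘ σ ∘ e.symm) = Graph.rename e (substGraph dom σ) := by
  rw [substGraph_eq, substGraph_eq, Graph.rename, Multiset.map_coe]
  have h1 : (dom.map e).map (e ∘ σ ∘ e.symm) = (dom.map σ).map e := by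
    simp
  rw [h1, List.dedup_map_of_injective e.injective, List.map_map, List.map_map]
  congr 1
  refine List.map_congr_left fun x hx => ?_
  have h2 : (dom.map e).filter (fun y => (e ∘ σ ∘ e.symm) y = e x) =
      (dom.filter (fun y => σ y = x)).map e := by
    rw [List.filter_map]
    congr 1
    refine List.filter_congr fun y _ => ?_
    simp
  simp only [Function.comp_apply]
  unfold router
  rw [h2]
  cases dom.filter (fun y => σ y = x) with
  | nil => rfl
  | cons y ys => rw [List.map_cons, mEdge_rename]

theorem idxOf_map_of_injective {f : 𝒩 → 𝒩} (hf : Function.Injective f) (l : List 𝒩) (x : 𝒩) :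
    (l.map f).idxOf (f x) = l.idxOf x := by
  induction l with
  | nil => rfl
  | cons y l ih =>
    by_cases h : y = x
    · simp [h]
    · rw [List.map_cons, List.idxOf_cons_ne _ (fun h' => h (hf h')), List.idxOf_cons_ne _ h, ih]

theorem procEdge_map {f : 𝒩 → 𝒩} (hf : Function.Injective f) (S : Seq 𝒩) :
    procEdge (S.map f) = (procEdge S).rename f := by
  have : (S.map f).std = S.std := by
    simp only [Seq.std, Seq.occ_map]
    simp only [Seq.map, Prefix.map_map, Agent.map_map]
    congr 1 <;> funext i <;> congr 1 <;> funext x <;> exact idxOf_map_of_injective hf _ _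
  refine Edge.ext ?_ (Seq.occ_map f S)
  change Label.proc _ = Label.proc _
  rw [this]

theorem procs_map {f : 𝒩 → 𝒩} (hf : Function.Injective f) (Ss : List (Seq 𝒩)) :
    procs (Ss.map (Seq.map f)) = Graph.rename f (procs Ss) := by
  simp only [procs, Graph.rename, Multiset.map_coe, List.map_map]
  congr 1
  exact List.map_congr_left fun S _ => procEdge_map hf S

theorem translGraph_self (v : List 𝒩) (Ss : List (Seq 𝒩)) (σ : 𝒩 → 𝒩) :
    translGraph v Ss σ v (fnarray Ss) = procs Ss + substGraph (fnarray Ss) σ + nEdges v := by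
  rw [translGraph, Graph.rename_eq_self fun x _ => vecSubst_self _ x,
    Graph.rename_eq_self fun x _ => vecSubst_self _ x]
  rfl

/-- Each translation of an agent without free names is given by a normal form whose names are the
nodes of the translation. -/
theorem IsTranslation.exists_canonical {P : Agent 𝒩 Empty} {v w : List 𝒩}
    {J : Judgement Label 𝒩} (h : IsTranslation P v w J) (hP : P.Closed) :
    ∃ (Ss : List (Seq 𝒩)) (σ : 𝒩 → 𝒩), fnarray Ss = w ∧ v.Nodup ∧ w.Nodup ∧
      (∀ x ∈ w, x ∉ v) ∧ (∀ x ∈ w, σ x ∈ v) ∧ (∀ y ∈ v, y ∈ w.map σ) ∧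
      (Agent.scopes v (body Ss σ)).Cong P ∧ J.Γ = (v ++ w).toFinset ∧
      J.G = procs Ss + substGraph w σ + nEdges v := by
  obtain ⟨xs, Ss, σ, hN, hv, hw, -, hnd, hΓ, hG⟩ := h
  have hσ : ∀ x ∈ fnarray Ss, σ x ∈ xs := by
    intro x hx
    by_contra h
    have := hN.free _ (List.mem_map_of_mem hx) h
    rw [show P.occ = [] from hP] at this
    simp at this
  have hdisj : ∀ x ∈ fnarray Ss, x ∉ xs := fun x hx h => hN.fresh x hx (hN.occurs x h)
  have hnd' : (xs ++ fnarray Ss).Nodup := List.nodup_append.2 ⟨hN.nodup, hN.linear, by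
    rintro a ha _ hb rfl
    exact hdisj a hb ha⟩
  have hlen : (xs ++ fnarray Ss).length = (v ++ w).length := by simp [hv, hw]
  have hmap := map_vecSubst hlen hnd'
  obtain ⟨e, he⟩ := exists_perm_eqOn (xs ++ fnarray Ss).toFinset
    (vecSubst (xs ++ fnarray Ss) (v ++ w)) fun x hx y hy hxy =>
      List.inj_on_of_nodup_map (hmap ▸ hnd) (by simpa using hx) (by simpa using hy) hxy
  simp only [List.mem_toFinset] at he
  rw [← List.map_congr_left he, List.map_append] at hmap
  obtain ⟨hev, hew⟩ := List.append_inj hmap (by simp [hv])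
  have hfree : freeNames xs Ss σ = [] := by
    simp only [freeNames, List.filter_eq_nil_iff, List.mem_map]
    rintro _ ⟨y, hy, rfl⟩
    simpa using hσ y hy
  have hw' : ∀ x ∈ fnarray Ss, vecSubst (fnarray Ss) w x = e x := by
    intro x hx
    have h1 := map_vecSubst hw.symm hN.linear
    rw [← hew] at h1
    rw [← hew]
    exact List.map_inj_left.1 h1 x hx
  rw [List.nodup_append] at hnd
  refine ⟨Ss.map (Seq.map e), e ∘ σ ∘ e.symm, by rw [fnarray_map, hew], hnd.1, hnd.2.1,
    fun x hx hx' => hnd.2.2 x hx' x hx rfl, ?_, ?_, ?_, by rw [hΓ, hfree]; rfl, ?_⟩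
  · rw [← hew, ← hev]
    intro x hx
    obtain ⟨y, hy, rfl⟩ := List.mem_map.1 hx
    simpa using hσ y hy
  · rw [← hew, ← hev]
    intro x hx
    obtain ⟨y, hy, rfl⟩ := List.mem_map.1 hx
    obtain ⟨z, hz, rfl⟩ := List.mem_map.1 (hN.occurs y hy)
    exact List.mem_map.2 ⟨e z, List.mem_map_of_mem hz, by simp⟩
  · refine (Agent.Cong.of_eq ?_).trans hN.cong
    have h1 : body (Ss.map (Seq.map e)) (e ∘ σ ∘ e.symm) = (body Ss σ).map e := by
      rw [body_map]
      simp only [body, List.map_map]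
      congr 2
      funext S
      simp only [Function.comp_apply, Seq.map_map]
      congr 2
      funext x
      simp
    rw [h1, ← hev, ← Agent.scopes_map _ _ fun _ _ _ _ h => e.injective h]
    refine Agent.map_eq_self _ fun x hx => ?_
    rw [Agent.mem_occ_scopes, occ_body, List.mem_map] at hx
    obtain ⟨⟨y, hy, rfl⟩, h⟩ := hx
    exact (h (hσ y hy)).elim
  · rw [hG, translGraph, procs_map e.injective, ← hew, substGraph_map]
    congr 1
    congr 1
    · rw [hew]
      exact Graph.rename_congr fun x hx => hw' x (mem_names_procs.1 hx)
    · rw [hew]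
      refine Graph.rename_congr fun x hx => (he x ?_).symm
      rw [mem_names_substGraph] at hx
      rcases hx with hx | hx
      · exact List.mem_append_right _ hx
      · obtain ⟨y, hy, rfl⟩ := List.mem_map.1 hx
        exact List.mem_append_left _ (hσ y hy)

end


/-! ### Composition of transitions without node fusions -/

section

variable {L : Type u} [RankedAlphabet L] {A : Type} [ActionAlphabet A] {𝒩 : Type} [DecidableEq 𝒩]

/-- A transition whose fusion component is the identity. -/
def Transition.mkId (src : Judgement L 𝒩) (Λ : 𝒩 → A × List 𝒩) (tgt : Judgement L 𝒩)
    (arity : ∀ x ∈ src.Γ, (Λ x).2.length = ActionAlphabet.ar (Λ x).1)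
    (Λ_out : ∀ x, x ∉ src.Γ → Λ x = (ActionAlphabet.eps, []))
    (kept : ∀ x ∈ src.Γ, x ∈ tgt.Γ)
    (fresh_kept : ∀ x ∈ src.Γ, ∀ z ∈ (Λ x).2, z ∉ src.Γ → z ∈ tgt.Γ)
    (no_isolated : ∀ z ∈ tgt.Γ, z ∉ src.Γ → (∀ x ∈ src.Γ, z ∉ (Λ x).2) →
      z ∈ Graph.names tgt.G) : Transition L A 𝒩 where
  src := src
  Λ := Λ
  π := id
  tgt := tgt
  arity := arity
  Λ_out := Λ_out
  π_mem := fun _ h => h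
  π_out := fun _ _ => rfl
  π_idem := fun _ => rfl
  exposed_rep := fun _ _ _ _ => rfl
  nodes_kept := kept
  fresh_kept := fresh_kept
  no_isolated := fun z hz h1 h2 => by
    rw [Finset.image_id] at h1
    exact no_isolated z hz h1 fun x hx h => h2 ⟨h1, x, hx, h⟩

theorem Transition.kept {t : Transition L A 𝒩} (hπ : t.π = id) {x : 𝒩} (hx : x ∈ t.src.Γ) :
    x ∈ t.tgt.Γ := by
  have := t.nodes_kept x hx
  rwa [hπ] at this

theorem Transition.mem_names_of_mem {t : Transition L A 𝒩} (hπ : t.π = id) {z : 𝒩}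
    (hz : z ∈ t.tgt.Γ) (h : z ∉ t.src.Γ) (h' : ∀ x ∈ t.src.Γ, z ∉ (t.Λ x).2) :
    z ∈ Graph.names t.tgt.G := by
  refine t.no_isolated z hz (by rwa [hπ, Finset.image_id]) ?_
  rintro ⟨-, x, hx, hzx⟩
  exact h' x hx hzx

theorem Derives.exists_par {Prods : Set (Transition L A 𝒩)} {t₁ t₂ : Transition L A 𝒩}
    (h₁ : Derives Prods t₁) (h₂ : Derives Prods t₂) (hπ₁ : t₁.π = id) (hπ₂ : t₂.π = id)
    (hdisj : Disjoint (t₁.src.Γ ∪ t₁.tgt.Γ) (t₂.src.Γ ∪ t₂.tgt.Γ)) :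
    ∃ t, Derives Prods t ∧ t.π = id ∧ t.src.Γ = t₁.src.Γ ∪ t₂.src.Γ ∧
      t.src.G = t₁.src.G + t₂.src.G ∧ (∀ x ∈ t₁.src.Γ, t.Λ x = t₁.Λ x) ∧
      (∀ x ∈ t₂.src.Γ, t.Λ x = t₂.Λ x) ∧ t.tgt.Γ = t₁.tgt.Γ ∪ t₂.tgt.Γ ∧
      t.tgt.G = t₁.tgt.G + t₂.tgt.G := by
  have hd : ∀ x ∈ t₂.src.Γ, x ∉ t₁.src.Γ := fun x hx hx' =>
    Finset.disjoint_left.1 hdisj (Finset.mem_union_left _ hx') (Finset.mem_union_left _ hx)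
  have hΛ₁ : ∀ x ∈ t₁.src.Γ, (if x ∈ t₁.src.Γ then t₁.Λ x else t₂.Λ x) = t₁.Λ x :=
    fun x hx => if_pos hx
  have hΛ₂ : ∀ x ∈ t₂.src.Γ, (if x ∈ t₁.src.Γ then t₁.Λ x else t₂.Λ x) = t₂.Λ x :=
    fun x hx => if_neg (hd x hx)
  let t : Transition L A 𝒩 := Transition.mkId
    ⟨t₁.src.Γ ∪ t₂.src.Γ, t₁.src.G + t₂.src.G, by
      rw [Graph.names_add]; exact Finset.union_subset_union t₁.src.wf t₂.src.wf⟩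
    (fun x => if x ∈ t₁.src.Γ then t₁.Λ x else t₂.Λ x)
    ⟨t₁.tgt.Γ ∪ t₂.tgt.Γ, t₁.tgt.G + t₂.tgt.G, by
      rw [Graph.names_add]; exact Finset.union_subset_union t₁.tgt.wf t₂.tgt.wf⟩
    (by
      intro x hx
      rcases Finset.mem_union.1 hx with hx | hx
      · rw [hΛ₁ x hx]; exact t₁.arity x hx
      · rw [hΛ₂ x hx]; exact t₂.arity x hx)
    (by
      intro x hx
      rw [Finset.mem_union, not_or] at hx
      rw [if_neg hx.1]
      exact t₂.Λ_out x hx.2)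
    (by
      intro x hx
      rcases Finset.mem_union.1 hx with hx | hx
      · exact Finset.mem_union_left _ (t₁.kept hπ₁ hx)
      · exact Finset.mem_union_right _ (t₂.kept hπ₂ hx))
    (by
      intro x hx z hz hz'
      rw [Finset.mem_union, not_or] at hz'
      rcases Finset.mem_union.1 hx with hx | hx
      · rw [hΛ₁ x hx] at hz
        exact Finset.mem_union_left _ (t₁.fresh_kept x hx z hz hz'.1)
      · rw [hΛ₂ x hx] at hz
        exact Finset.mem_union_right _ (t₂.fresh_kept x hx z hz hz'.2))
    (by
      intro z hz hz' h
      rw [Finset.mem_union, not_or] at hz'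
      rw [Graph.names_add]
      rcases Finset.mem_union.1 hz with hz | hz
      · refine Finset.mem_union_left _ (t₁.mem_names_of_mem hπ₁ hz hz'.1 fun x hx hzx => ?_)
        exact h x (Finset.mem_union_left _ hx) (by rwa [hΛ₁ x hx])
      · refine Finset.mem_union_right _ (t₂.mem_names_of_mem hπ₂ hz hz'.2 fun x hx hzx => ?_)
        exact h x (Finset.mem_union_right _ hx) (by rwa [hΛ₂ x hx]))
  exact ⟨t, .par h₁ h₂ hdisj rfl rfl hΛ₁ hΛ₂ (fun x _ => by rw [hπ₁]; rfl)
    (fun x _ => by rw [hπ₂]; rfl) rfl rfl, rfl, rfl, rfl, hΛ₁, hΛ₂, rfl, rfl⟩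

/-- The merge rule, for a substitution `ρ` which fixes the nodes of the result, so that no nodes are
fused. -/
theorem Derives.exists_merge {Prods : Set (Transition L A 𝒩)} {t : Transition L A 𝒩}
    (h : Derives Prods t) (hπ : t.π = id) (σ ρ : 𝒩 → 𝒩)
    (hσ_mem : ∀ x ∈ t.src.Γ, σ x ∈ t.src.Γ) (hσ_out : ∀ x, x ∉ t.src.Γ → σ x = x)
    (hσ_idem : ∀ x, σ (σ x) = σ x)
    (hact : ∀ x ∈ t.src.Γ, ∀ y ∈ t.src.Γ, σ x = σ y → x ≠ y → (t.Λ x).1 = (t.Λ y).1)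
    (hρ : IsSubstEffect ρ (mergeEqs t σ)) (hρσ : ∀ x ∈ t.src.Γ.image σ, ρ x = x) :
    ∃ t' : Transition L A 𝒩, Derives Prods t' ∧ t'.π = id ∧ t'.src.Γ = t.src.Γ.image σ ∧
      t'.src.G = Graph.rename σ t.src.G ∧
      (∀ z ∈ t.src.Γ, t'.Λ (σ z) = ((t.Λ z).1, (t.Λ z).2.map (ρ ∘ σ))) ∧
      t'.tgt.Γ = t.tgt.Γ.image (ρ ∘ σ) ∧ t'.tgt.G = Graph.rename (ρ ∘ σ) t.tgt.G := by
  have himg : ∀ x ∈ t.src.Γ.image σ, x ∈ t.src.Γ ∧ σ x = x := by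
    intro x hx
    obtain ⟨y, hy, rfl⟩ := Finset.mem_image.1 hx
    exact ⟨hσ_mem y hy, hσ_idem y⟩
  have hsrc : Graph.names (Graph.rename σ t.src.G) ⊆ t.src.Γ.image σ := by
    intro x hx
    obtain ⟨y, hy, rfl⟩ := Graph.mem_names_rename.1 hx
    exact Finset.mem_image_of_mem _ (t.src.wf hy)
  have htgt : Graph.names (Graph.rename (ρ ∘ σ) t.tgt.G) ⊆ t.tgt.Γ.image (ρ ∘ σ) := by
    intro x hx
    obtain ⟨y, hy, rfl⟩ := Graph.mem_names_rename.1 hx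
    exact Finset.mem_image_of_mem _ (t.tgt.wf hy)
  let Λ' : 𝒩 → A × List 𝒩 := fun x =>
    if x ∈ t.src.Γ.image σ then ((t.Λ x).1, (t.Λ x).2.map (ρ ∘ σ)) else (ActionAlphabet.eps, [])
  have hΛ' : ∀ x ∈ t.src.Γ.image σ, Λ' x = ((t.Λ x).1, (t.Λ x).2.map (ρ ∘ σ)) :=
    fun x hx => if_pos hx
  have hΛ : ∀ z ∈ t.src.Γ, Λ' (σ z) = ((t.Λ z).1, (t.Λ z).2.map (ρ ∘ σ)) := by
    intro z hz
    rw [hΛ' _ (Finset.mem_image_of_mem _ hz)]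
    by_cases hzz : σ z = z
    · rw [hzz]
    -- merged nodes expose the same vectors after `σ` and `ρ`, since `ρ` unifies these vectors
    have hact' := hact _ (hσ_mem z hz) z hz (hσ_idem z) hzz
    refine Prod.ext hact' ?_
    have hlen : (t.Λ (σ z)).2.length = (t.Λ z).2.length := by
      rw [t.arity _ (hσ_mem z hz), t.arity _ hz, hact']
    refine List.ext_getElem (by simpa using hlen) fun i h1 h2 => ?_
    simp only [List.getElem_map, Function.comp_apply]
    simp only [List.length_map] at h1 h2
    refine (hρ.2 _ _).2 (.rel _ _ ⟨σ z, hσ_mem z hz, z, hz, .inl ⟨hσ_idem z, ?_⟩⟩)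
    rw [List.mem_iff_getElem]
    exact ⟨i, by simp; omega, by simp⟩
  let t' : Transition L A 𝒩 := Transition.mkId ⟨t.src.Γ.image σ, Graph.rename σ t.src.G, hsrc⟩ Λ'
    ⟨t.tgt.Γ.image (ρ ∘ σ), Graph.rename (ρ ∘ σ) t.tgt.G, htgt⟩
    (by
      intro x hx
      rw [hΛ' x hx, List.length_map]
      exact t.arity x (himg x hx).1)
    (fun x hx => if_neg hx)
    (by
      intro x hx
      refine Finset.mem_image.2 ⟨x, t.kept hπ (himg x hx).1, ?_⟩
      rw [Function.comp_apply, (himg x hx).2, hρσ x hx])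
    (by
      intro x hx z hz _
      rw [hΛ' x hx] at hz
      obtain ⟨y, hy, rfl⟩ := List.mem_map.1 hz
      refine Finset.mem_image_of_mem _ ?_
      by_cases hyΓ : y ∈ t.src.Γ
      · exact t.kept hπ hyΓ
      · exact t.fresh_kept x (himg x hx).1 y hy hyΓ)
    (by
      intro z hz h1 h2
      obtain ⟨y, hy, rfl⟩ := Finset.mem_image.1 hz
      refine Graph.mem_names_rename.2 ⟨y, t.mem_names_of_mem hπ hy ?_ ?_, rfl⟩
      · intro hyΓ
        apply h1
        have hm := Finset.mem_image_of_mem σ hyΓ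
        rw [Function.comp_apply, hρσ _ hm]
        exact hm
      · intro x hx hyx
        apply h2 (σ x) (Finset.mem_image_of_mem _ hx)
        rw [hΛ x hx]
        exact List.mem_map_of_mem hyx)
  refine ⟨t', .merge h σ ρ hσ_mem hσ_out hσ_idem hact hρ ?_ rfl rfl hΛ ?_ rfl, rfl, rfl, rfl, hΛ,
    rfl, rfl⟩
  · intro z y hy hyz
    rw [← hyz, hρσ y hy]
    exact hy
  · intro z hz
    exact (hρσ z hz).symm

/-- Two transitions with disjoint nodes are composed by merging some nodes of the second one with
nodes of the first one, at which the same actions take place. -/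
theorem Derives.exists_join {Prods : Set (Transition L A 𝒩)} {t₁ t₂ : Transition L A 𝒩}
    (h₁ : Derives Prods t₁) (h₂ : Derives Prods t₂) (hπ₁ : t₁.π = id) (hπ₂ : t₂.π = id)
    (hdisj : Disjoint (t₁.src.Γ ∪ t₁.tgt.Γ) (t₂.src.Γ ∪ t₂.tgt.Γ)) (θ ρ : 𝒩 → 𝒩)
    (hθ_out : ∀ x, x ∉ t₂.src.Γ → θ x = x)
    (hθ : ∀ x ∈ t₂.src.Γ, θ x = x ∨ (θ x ∈ t₁.src.Γ ∧ (t₁.Λ (θ x)).1 = (t₂.Λ x).1))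
    (hinj : ∀ x ∈ t₂.src.Γ, ∀ y ∈ t₂.src.Γ, θ x = θ y → x = y)
    (hexp : ∀ x ∈ t₂.src.Γ, ∀ z ∈ (t₂.Λ x).2, z ∉ t₂.src.Γ)
    (hρ : IsSubstEffect ρ fun a b => ∃ x ∈ t₂.src.Γ, θ x ∈ t₁.src.Γ ∧
      (a, b) ∈ (t₁.Λ (θ x)).2.zip (t₂.Λ x).2)
    (hρ_fix : ∀ x, x ∈ t₁.src.Γ ∨ x ∈ t₂.src.Γ → ρ x = x) :
    ∃ t : Transition L A 𝒩, Derives Prods t ∧ t.π = id ∧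
      t.src.Γ = t₁.src.Γ ∪ t₂.src.Γ.image θ ∧
      t.src.G = t₁.src.G + Graph.rename θ t₂.src.G ∧
      (∀ z ∈ t₁.src.Γ, t.Λ z = ((t₁.Λ z).1, (t₁.Λ z).2.map ρ)) ∧
      (∀ z ∈ t₂.src.Γ, t.Λ (θ z) = ((t₂.Λ z).1, (t₂.Λ z).2.map ρ)) ∧
      t.tgt.Γ = t₁.tgt.Γ.image ρ ∪ t₂.tgt.Γ.image (ρ ∘ θ) ∧
      t.tgt.G = Graph.rename ρ t₁.tgt.G + Graph.rename (ρ ∘ θ) t₂.tgt.G := by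
  obtain ⟨t, ht, hπ, hΓ, hG, hΛ₁, hΛ₂, hΓ', hG'⟩ := h₁.exists_par h₂ hπ₁ hπ₂ hdisj
  have hd : ∀ x ∈ t₁.src.Γ ∪ t₁.tgt.Γ, x ∉ t₂.src.Γ := fun x hx hx' =>
    Finset.disjoint_left.1 hdisj hx (Finset.mem_union_left _ hx')
  have hθ₁ : ∀ x ∈ t₁.src.Γ, θ x = x := fun x hx => hθ_out x (hd x (Finset.mem_union_left _ hx))
  have hexp₁ : ∀ x ∈ t₁.src.Γ, ∀ z ∈ (t₁.Λ x).2, z ∉ t₂.src.Γ := by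
    intro x hx z hz
    by_cases hzΓ : z ∈ t₁.src.Γ
    · exact hd z (Finset.mem_union_left _ hzΓ)
    · exact hd z (Finset.mem_union_right _ (t₁.fresh_kept x hx z hz hzΓ))
  have hvec₁ : ∀ x ∈ t₁.src.Γ, (t.Λ x).2.map θ = (t₁.Λ x).2 := by
    intro x hx
    rw [hΛ₁ x hx]
    conv_rhs => rw [← List.map_id (t₁.Λ x).2]
    exact List.map_congr_left fun z hz => hθ_out z (hexp₁ x hx z hz)
  have hvec₂ : ∀ x ∈ t₂.src.Γ, (t.Λ x).2.map θ = (t₂.Λ x).2 := by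
    intro x hx
    rw [hΛ₂ x hx]
    conv_rhs => rw [← List.map_id (t₂.Λ x).2]
    exact List.map_congr_left fun z hz => hθ_out z (hexp x hx z hz)
  have hmix : ∀ x ∈ t₁.src.Γ, ∀ y ∈ t₂.src.Γ, θ x = θ y →
      θ y = x ∧ (t₁.Λ x).1 = (t₂.Λ y).1 := by
    intro x hx y hy hxy
    rw [hθ₁ x hx] at hxy
    rcases hθ y hy with h | ⟨-, h⟩
    · exact (hd x (Finset.mem_union_left _ hx) (by rw [hxy, h]; exact hy)).elim
    · exact ⟨hxy.symm, by rw [hxy, h]⟩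
  have hzip : ∀ (l : List 𝒩) (a b : 𝒩), (a, b) ∈ l.zip l → a = b := by
    intro l a b h
    rw [List.mem_iff_getElem] at h
    obtain ⟨i, hi, h⟩ := h
    simp only [List.getElem_zip, Prod.mk.injEq] at h
    exact h.1.symm.trans h.2
  -- `ρ` unifies the vectors exposed at merged nodes, and the fusions of `t₁` and `t₂` are trivial
  obtain ⟨t', ht', hπ', hΓ1, hG1, hΛ1, hΓ1', hG1'⟩ := ht.exists_merge hπ θ ρ
    (by
      intro x hx
      rw [hΓ, Finset.mem_union] at hx ⊢
      rcases hx with hx | hx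
      · rw [hθ₁ x hx]; exact .inl hx
      · rcases hθ x hx with h | h
        · rw [h]; exact .inr hx
        · exact .inl h.1)
    (by
      intro x hx
      rw [hΓ, Finset.mem_union, not_or] at hx
      exact hθ_out x hx.2)
    (by
      intro x
      by_cases hx : x ∈ t₂.src.Γ
      · rcases hθ x hx with h | h
        · rw [h, h]
        · exact hθ₁ _ h.1
      · rw [hθ_out x hx, hθ_out x hx])
    (by
      intro x hx y hy hxy hne
      rw [hΓ, Finset.mem_union] at hx hy
      rcases hx with hx | hx <;> rcases hy with hy | hy
      · rw [hθ₁ x hx, hθ₁ y hy] at hxy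
        exact (hne hxy).elim
      · rw [hΛ₁ x hx, hΛ₂ y hy]
        exact (hmix x hx y hy hxy).2
      · rw [hΛ₂ x hx, hΛ₁ y hy]
        exact (hmix y hy x hx hxy.symm).2.symm
      · exact (hne (hinj x hx y hy hxy)).elim)
    (by
      refine hρ.congr fun a b => ⟨?_, ?_⟩
      · refine eqvGen_imp id ?_
        rintro a b ⟨x, hx, hx', hab⟩
        refine .rel _ _ ⟨θ x, by rw [hΓ]; exact Finset.mem_union_left _ hx', x,
          by rw [hΓ]; exact Finset.mem_union_right _ hx, .inl ⟨hθ₁ _ hx', ?_⟩⟩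
        rw [hvec₁ _ hx', hvec₂ x hx]
        exact hab
      · refine eqvGen_imp id ?_
        rintro a b ⟨x, hx, y, hy, ⟨hxy, hab⟩ | ⟨hxy, rfl, rfl⟩⟩
        · rw [hΓ, Finset.mem_union] at hx hy
          rcases hx with hx | hx <;> rcases hy with hy | hy
          · rw [hθ₁ x hx, hθ₁ y hy] at hxy
            subst hxy
            obtain rfl := hzip _ _ _ hab
            exact .refl _
          · rw [hvec₁ x hx, hvec₂ y hy] at hab
            obtain ⟨h, -⟩ := hmix x hx y hy hxy
            exact .rel _ _ ⟨y, hy, by rwa [h], by rwa [h]⟩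
          · rw [hvec₂ x hx, hvec₁ y hy] at hab
            obtain ⟨h, -⟩ := hmix y hy x hx hxy.symm
            refine .symm _ _ (.rel _ _ ⟨x, hx, by rwa [h], ?_⟩)
            rw [h, ← List.zip_swap, List.mem_map]
            exact ⟨(a, b), hab, rfl⟩
          · obtain rfl := hinj x hx y hy hxy
            obtain rfl := hzip _ _ _ hab
            exact .refl _
        · rw [hπ] at hxy
          obtain rfl : x = y := hxy
          exact .refl _)
    (by
      intro x hx
      obtain ⟨y, hy, rfl⟩ := Finset.mem_image.1 hx
      rw [hΓ, Finset.mem_union] at hy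
      rcases hy with hy | hy
      · rw [hθ₁ y hy]; exact hρ_fix y (.inl hy)
      · rcases hθ y hy with h | h
        · rw [h]; exact hρ_fix y (.inr hy)
        · exact hρ_fix _ (.inl h.1))
  have himg : t₁.src.Γ.image θ = t₁.src.Γ := by
    conv_rhs => rw [← Finset.image_id (s := t₁.src.Γ)]
    exact Finset.image_congr fun x hx => hθ₁ x hx
  refine ⟨t', ht', hπ', ?_, ?_, ?_, ?_, ?_, ?_⟩
  · rw [hΓ1, hΓ, Finset.image_union, himg]
  · rw [hG1, hG, Graph.rename_add, Graph.rename_eq_self fun x hx => hθ₁ x (t₁.src.wf hx)]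
  · intro z hz
    have := hΛ1 z (by rw [hΓ]; exact Finset.mem_union_left _ hz)
    rw [hθ₁ z hz] at this
    rw [this, ← List.map_map, hvec₁ z hz, hΛ₁ z hz]
  · intro z hz
    rw [hΛ1 z (by rw [hΓ]; exact Finset.mem_union_right _ hz), ← List.map_map, hvec₂ z hz,
      hΛ₂ z hz]
  · rw [hΓ1', hΓ', Finset.image_union]
    congr 1
    refine Finset.image_congr fun x hx => ?_
    rw [Function.comp_apply, hθ_out x (hd x (Finset.mem_union_right _ hx))]
  · rw [hG1', hG', Graph.rename_add]
    congr 1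
    refine Graph.rename_congr fun x hx => ?_
    rw [Function.comp_apply, hθ_out x (hd x (Finset.mem_union_right _ (t₁.tgt.wf hx)))]

/-- Fresh copies of the nodes in `Sh`: the permutation `e` makes copies of nodes of `Γ`, and `θ`
sends them back. -/
theorem exists_copy [Infinite 𝒩] (Γ Sh A : Finset 𝒩) :
    ∃ (e : Equiv.Perm 𝒩) (θ : 𝒩 → 𝒩), (∀ x ∈ Γ, x ∈ Sh → e x ∉ A) ∧
      (∀ x ∈ Γ, x ∉ Sh → e x = x) ∧ (∀ x ∈ Γ, θ (e x) = x) ∧ ∀ x, x ∉ Γ.image e → θ x = x := by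
  obtain ⟨l, hl, hnd, hA⟩ := exists_fresh_list (Γ ∩ Sh).card (A ∪ Γ)
  have hlen : (Γ ∩ Sh).toList.length = l.length := by simp [hl]
  have hmap := map_vecSubst hlen (Finset.nodup_toList _)
  set f := vecSubst (Γ ∩ Sh).toList l with hf
  have hfSh : ∀ x ∈ Γ, x ∈ Sh → f x ∈ l := fun x hx hx' => by
    rw [← hmap]
    exact List.mem_map_of_mem (by simp [hx, hx'])
  have hf' : ∀ x, x ∉ Sh → f x = x := fun x hx => vecSubst_of_notMem hlen (by simp [hx])
  obtain ⟨e, he⟩ := exists_perm_eqOn Γ f (by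
    intro x hx y hy hxy
    by_cases hx' : x ∈ Sh <;> by_cases hy' : y ∈ Sh
    · rw [← hmap] at hnd
      exact List.inj_on_of_nodup_map hnd (by simpa using ⟨hx, hx'⟩) (by simpa using ⟨hy, hy'⟩) hxy
    · have := hA _ (hfSh x hx hx')
      rw [hxy, hf' y hy'] at this
      exact (this (Finset.mem_union_right _ hy)).elim
    · have := hA _ (hfSh y hy hy')
      rw [← hxy, hf' x hx'] at this
      exact (this (Finset.mem_union_right _ hx)).elim
    · rwa [hf' x hx', hf' y hy'] at hxy)
  refine ⟨e, fun x => if x ∈ Γ.image e then e.symm x else x, ?_, ?_, ?_, fun x hx => if_neg hx⟩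
  · intro x hx hx' h
    rw [he x hx] at h
    exact hA _ (hfSh x hx hx') (Finset.mem_union_left _ h)
  · intro x hx hx'
    rw [he x hx, hf' x hx']
  · intro x hx
    simp only [if_pos (Finset.mem_image_of_mem e hx), Equiv.symm_apply_apply]

/-- A transition can take place in an idle context `K`, which may share nodes with it. The idle rule
is applied to a copy of `K`, whose copies of shared nodes are merged with the originals. -/
theorem Derives.exists_context [Infinite 𝒩] {Prods : Set (Transition L A 𝒩)}
    {t : Transition L A 𝒩} (h : Derives Prods t) (hπ : t.π = id) (K : Judgement L 𝒩)
    (hidle : ∀ x ∈ K.Γ, x ∈ t.src.Γ → t.Λ x = (ActionAlphabet.eps, []))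
    (hfresh : ∀ x ∈ K.Γ, x ∈ t.tgt.Γ → x ∈ t.src.Γ) :
    ∃ t' : Transition L A 𝒩, Derives Prods t' ∧ t'.π = id ∧ t'.src.Γ = t.src.Γ ∪ K.Γ ∧
      t'.src.G = t.src.G + K.G ∧ t'.tgt.G = t.tgt.G + K.G := by
  obtain ⟨e, θ, he, he', hθ, hθ'⟩ := exists_copy K.Γ t.src.Γ (t.src.Γ ∪ t.tgt.Γ)
  let K' : Judgement L 𝒩 := ⟨K.Γ.image e, Graph.rename e K.G, by
    intro x hx
    obtain ⟨y, hy, rfl⟩ := Graph.mem_names_rename.1 hx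
    exact Finset.mem_image_of_mem _ (K.wf hy)⟩
  let t₂ : Transition L A 𝒩 := Transition.mkId K' (fun _ => (ActionAlphabet.eps, [])) K'
    (fun _ _ => ActionAlphabet.ar_eps.symm) (fun _ _ => rfl) (fun _ h => h) (by simp)
    (fun z hz h => (h hz).elim)
  have ht₂ : Derives Prods t₂ := .idle (fun _ => rfl) rfl rfl
  have hθe : ∀ G : Graph L 𝒩, Graph.names G ⊆ K.Γ → Graph.rename θ (Graph.rename e G) = G := by
    intro G hG
    rw [Graph.rename_rename]
    exact Graph.rename_eq_self fun x hx => hθ x (hG hx)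
  obtain ⟨t', ht', hπ', hΓ, hG, -, -, -, hG'⟩ := h.exists_join ht₂ hπ rfl (by
      rw [Finset.disjoint_right]
      intro x hx
      change x ∈ K.Γ.image e ∪ K.Γ.image e at hx
      rw [Finset.union_self] at hx
      obtain ⟨y, hy, rfl⟩ := Finset.mem_image.1 hx
      by_cases hy' : y ∈ t.src.Γ
      · exact he y hy hy'
      · rw [he' y hy hy', Finset.mem_union, not_or]
        exact ⟨hy', fun h => hy' (hfresh y hy h)⟩) θ id hθ' (by
      intro x hx
      obtain ⟨y, hy, rfl⟩ := Finset.mem_image.1 hx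
      rw [hθ y hy]
      by_cases hy' : y ∈ t.src.Γ
      · exact .inr ⟨hy', by rw [hidle y hy hy']; rfl⟩
      · exact .inl (he' y hy hy').symm) (by
      intro x hx y hy hxy
      obtain ⟨x, hx', rfl⟩ := Finset.mem_image.1 hx
      obtain ⟨y, hy', rfl⟩ := Finset.mem_image.1 hy
      rw [hθ x hx', hθ y hy'] at hxy
      rw [hxy]) (by
      intro x _ z hz
      change z ∈ [] at hz
      simp at hz) ⟨fun _ => rfl, fun x y => ⟨by rintro rfl; exact .refl _, fun h => by
      refine (eqvGen_closed (p := fun _ => False) ?_ h).elim id fun h => h.1.elim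
      rintro x y ⟨z, -, -, hz⟩
      change (x, y) ∈ List.zip _ [] at hz
      simp at hz⟩⟩ (fun _ _ => rfl)
  refine ⟨t', ht', hπ', ?_, ?_, ?_⟩
  · rw [hΓ]
    congr 1
    change (K.Γ.image e).image θ = K.Γ
    rw [Finset.image_image]
    conv_rhs => rw [← Finset.image_id (s := K.Γ)]
    exact Finset.image_congr fun x hx => hθ x hx
  · rw [hG]
    congr 1
    exact hθe _ K.wf
  · rw [hG', Graph.rename_eq_self (f := id) fun _ _ => rfl]
    congr 1
    exact hθe _ K.wf

end


/-! ### Process transitions and communications -/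

section

variable {𝒩 : Type} [DecidableEq 𝒩]

/-- `(v)(Ss σ)` is a normal form of `Q` with exactly the same free names, and its bound names and
the names of its linear agents are outside of `A`, a set which contains the free names of `Q`. -/
structure IsFreshNormalForm (Q : Agent 𝒩 Empty) (A : Finset 𝒩) (v : List 𝒩)
    (Ss : List (Seq 𝒩)) (σ : 𝒩 → 𝒩) : Prop where
  cong : (Agent.scopes v (body Ss σ)).Cong Q
  nodup : (v ++ fnarray Ss).Nodup
  fresh : ∀ x ∈ v ++ fnarray Ss, x ∉ A
  mem_map_iff : ∀ y, y ∈ (fnarray Ss).map σ ↔ y ∈ v ∨ y ∈ Q.occ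
  occ_subset : ∀ x ∈ Q.occ, x ∈ A

theorem exists_isFreshNormalForm [Infinite 𝒩] {Q : Agent 𝒩 Empty} (hQ : Q.Guarded)
    {A : Finset 𝒩} (hA : ∀ x ∈ Q.occ, x ∈ A) :
    ∃ v Ss σ, IsFreshNormalForm Q A v Ss σ := by
  obtain ⟨v, Ss, σ, h1, h2, h3, h4, h5, h6⟩ := exists_normalForm Q hQ A
  refine ⟨v, Ss, σ, h1, List.nodup_append.2 ⟨h2, h3, ?_⟩, ?_, h6, hA⟩
  · rintro a ha _ hb rfl
    exact (h5 a hb).2.1 ha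
  · intro x hx
    rcases List.mem_append.1 hx with hx | hx
    · exact (h4 x hx).1
    · exact (h5 x hx).1

theorem IsFreshNormalForm.isNormalForm {Q : Agent 𝒩 Empty} {A : Finset 𝒩} {v : List 𝒩}
    {Ss : List (Seq 𝒩)} {σ : 𝒩 → 𝒩} (h : IsFreshNormalForm Q A v Ss σ) :
    IsNormalForm Q v Ss σ where
  cong := h.cong
  nodup := (List.nodup_append.1 h.nodup).1
  occurs := fun x hx => (h.mem_map_iff x).2 (.inl hx)
  linear := (List.nodup_append.1 h.nodup).2.1
  fresh := by
    intro x hx hx'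
    rcases (h.mem_map_iff x).1 hx' with h' | h'
    · exact (List.nodup_append.1 h.nodup).2.2 x h' x hx rfl
    · exact h.fresh x (List.mem_append_right _ hx) (h.occ_subset x h')
  free := fun x hx hxv => ((h.mem_map_iff x).1 hx).resolve_left hxv

theorem IsFreshNormalForm.par {Q₁ Q₂ : Agent 𝒩 Empty} {A A' : Finset 𝒩} {v₁ v₂ : List 𝒩}
    {S₁ S₂ : List (Seq 𝒩)} {σ₁ σ₂ : 𝒩 → 𝒩} (h₁ : IsFreshNormalForm Q₁ A v₁ S₁ σ₁)
    (h₂ : IsFreshNormalForm Q₂ A' v₂ S₂ σ₂) (hQ₂ : ∀ x ∈ Q₂.occ, x ∈ A)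
    (hA : A ∪ (v₁ ++ fnarray S₁).toFinset ⊆ A') :
    IsFreshNormalForm (.par Q₁ Q₂) A (v₁ ++ v₂) (S₁ ++ S₂)
      (fun x => if x ∈ fnarray S₁ then σ₁ x else σ₂ x) := by
  have hsep : ∀ x ∈ v₂ ++ fnarray S₂, x ∉ v₁ ∧ x ∉ fnarray S₁ ∧ x ∉ A := by
    intro x hx
    have h := fun h' => h₂.fresh x hx (hA h')
    simp only [Finset.mem_union, List.mem_toFinset, List.mem_append] at h
    exact ⟨fun h' => h (.inr (.inl h')), fun h' => h (.inr (.inr h')), fun h' => h (.inl h')⟩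
  have hσ₁ : ∀ x ∈ fnarray S₁, (if x ∈ fnarray S₁ then σ₁ x else σ₂ x) = σ₁ x :=
    fun x hx => if_pos hx
  have hσ₂ : ∀ x ∈ fnarray S₂, (if x ∈ fnarray S₁ then σ₁ x else σ₂ x) = σ₂ x :=
    fun x hx => if_neg (hsep x (List.mem_append_right _ hx)).2.1
  have hn₁ := List.nodup_append.1 h₁.nodup
  have hn₂ := List.nodup_append.1 h₂.nodup
  refine ⟨?_, ?_, ?_, ?_, ?_⟩
  · refine ((body_append_cong S₁ S₂ _).scopes _).trans ?_
    rw [body_congr hσ₁, body_congr hσ₂]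
    refine (Agent.scopes_par_scopes_cong ?_ ?_).symm.trans (.par h₁.cong h₂.cong)
    · intro x hx h
      rw [occ_body, h₂.mem_map_iff] at h
      rcases h with h | h
      · exact (hsep x (List.mem_append_left _ h)).1 hx
      · exact h₁.fresh x (List.mem_append_left _ hx) (hQ₂ x h)
    · intro x hx h
      rw [occ_body, h₁.mem_map_iff] at h
      rcases h with h | h
      · exact (hsep x (List.mem_append_left _ hx)).1 h
      · exact (hsep x (List.mem_append_left _ hx)).2.2 (h₁.occ_subset x h)
  · rw [fnarray_append]
    have hperm : ((v₁ ++ fnarray S₁) ++ (v₂ ++ fnarray S₂)).Perm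
        (v₁ ++ v₂ ++ (fnarray S₁ ++ fnarray S₂)) := by
      simp only [List.append_assoc]
      refine List.Perm.append_left _ ?_
      rw [← List.append_assoc, ← List.append_assoc]
      exact List.Perm.append_right _ List.perm_append_comm
    refine hperm.nodup_iff.1 (List.nodup_append.2 ⟨h₁.nodup, h₂.nodup, ?_⟩)
    rintro a ha _ hb rfl
    rcases List.mem_append.1 ha with ha | ha
    · exact (hsep a hb).1 ha
    · exact (hsep a hb).2.1 ha
  · intro x hx
    simp only [fnarray_append, List.mem_append] at hx
    rcases hx with (hx | hx) | (hx | hx)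
    · exact h₁.fresh x (List.mem_append_left _ hx)
    · exact (hsep x (List.mem_append_left _ hx)).2.2
    · exact h₁.fresh x (List.mem_append_right _ hx)
    · exact (hsep x (List.mem_append_right _ hx)).2.2
  · intro y
    rw [fnarray_append, List.map_append, List.map_congr_left hσ₁, List.map_congr_left hσ₂,
      List.mem_append, h₁.mem_map_iff, h₂.mem_map_iff]
    simp only [List.mem_append, Agent.occ]
    tauto
  · intro x hx
    rcases List.mem_append.1 hx with hx | hx
    · exact h₁.occ_subset x hx
    · exact hQ₂ x hx

theorem substGraph_congr {dom : List 𝒩} {σ τ : 𝒩 → 𝒩} (h : ∀ x ∈ dom, σ x = τ x) :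
    substGraph dom σ = substGraph dom τ := by
  rw [substGraph_eq, substGraph_eq, List.map_congr_left h]
  congr 1
  refine List.map_congr_left fun x _ => ?_
  unfold router
  rw [List.filter_congr fun y hy => by rw [h y hy]]

theorem substGraph_append {d₁ d₂ : List 𝒩} {σ : 𝒩 → 𝒩}
    (h : ∀ x ∈ d₁, ∀ y ∈ d₂, σ x ≠ σ y) :
    substGraph (d₁ ++ d₂) σ = substGraph d₁ σ + substGraph d₂ σ := by
  have hdisj : List.Disjoint (d₁.map σ) (d₂.map σ) := by
    intro a ha hb
    obtain ⟨x, hx, rfl⟩ := List.mem_map.1 ha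
    obtain ⟨y, hy, hxy⟩ := List.mem_map.1 hb
    exact h x hx y hy hxy.symm
  rw [substGraph_eq, substGraph_eq, substGraph_eq, List.map_append, hdisj.dedup_append,
    List.map_append, ← Multiset.coe_add]
  congr 2
  · refine List.map_congr_left fun x hx => ?_
    rw [List.mem_dedup] at hx
    have : d₂.filter (fun y => σ y = x) = [] := by
      simp only [List.filter_eq_nil_iff, decide_eq_true_eq]
      rintro y hy rfl
      exact hdisj hx (List.mem_map_of_mem hy)
    unfold router
    rw [List.filter_append, this, List.append_nil]
  · refine List.map_congr_left fun x hx => ?_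
    rw [List.mem_dedup] at hx
    have : d₁.filter (fun y => σ y = x) = [] := by
      simp only [List.filter_eq_nil_iff, decide_eq_true_eq]
      rintro y hy rfl
      exact hdisj (List.mem_map_of_mem hy) hx
    unfold router
    rw [List.filter_append, this, List.nil_append]

theorem PrefixTransl.arity {α : Prefix 𝒩} {Λ : 𝒩 → Act × List 𝒩} {π : 𝒩 → 𝒩}
    (h : PrefixTransl α Λ π) (x : 𝒩) : (Λ x).2.length = ActionAlphabet.ar (Λ x).1 := by
  cases h with
  | input c xs =>
    by_cases hx : x = c
    · subst hx; simp [single, ActionAlphabet.ar]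
    · simp [single, Function.update_of_ne hx, ActionAlphabet.ar]
  | output c xs =>
    by_cases hx : x = c
    · subst hx; simp [single, ActionAlphabet.ar]
    · simp [single, Function.update_of_ne hx, ActionAlphabet.ar]
  | fusion E π h => rfl

theorem PrefixTransl.out {α : Prefix 𝒩} {Λ : 𝒩 → Act × List 𝒩} {π : 𝒩 → 𝒩}
    (h : PrefixTransl α Λ π) {x : 𝒩} (hx : x ∉ α.occ) : Λ x = (ActionAlphabet.eps, []) := by
  cases h with
  | input c xs =>
    have : x ≠ c := fun h => hx (h ▸ List.mem_cons_self)
    simp [single, Function.update_of_ne this, ActionAlphabet.eps]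
  | output c xs =>
    have : x ≠ c := fun h => hx (h ▸ List.mem_cons_self)
    simp [single, Function.update_of_ne this, ActionAlphabet.eps]
  | fusion E π h => rfl

theorem PrefixTransl.exposed_mem {α : Prefix 𝒩} {Λ : 𝒩 → Act × List 𝒩} {π : 𝒩 → 𝒩}
    (h : PrefixTransl α Λ π) {x z : 𝒩} (hz : z ∈ (Λ x).2) : z ∈ α.occ := by
  cases h with
  | input c xs =>
    by_cases hx : x = c
    · subst hx
      simp only [single, Function.update_self] at hz
      exact List.mem_cons_of_mem _ hz
    · simp [single, Function.update_of_ne hx] at hz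
  | output c xs =>
    by_cases hx : x = c
    · subst hx
      simp only [single, Function.update_self] at hz
      exact List.mem_cons_of_mem _ hz
    · simp [single, Function.update_of_ne hx] at hz
  | fusion E π h => simp at hz

theorem PrefixTransl.fusion_mem {α : Prefix 𝒩} {Λ : 𝒩 → Act × List 𝒩} {π : 𝒩 → 𝒩}
    (h : PrefixTransl α Λ π) (x : 𝒩) : π x = x ∨ π x ∈ α.occ := by
  cases h with
  | input c xs => exact .inl rfl
  | output c xs => exact .inl rfl
  | fusion E π h =>
    exact (h.eq_or (p := fun x => x ∈ (Prefix.fusion E).occ)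
      (fun _ _ h => mem_occ_of_mem_fusion h) x).imp id And.right

theorem exists_std_map {T : Seq 𝒩} [Nonempty 𝒩] (hT : T.occ.Nodup) :
    T.std.occ = List.range T.std.occ.length ∧ ∃ ρ : ℕ → 𝒩, T.std.occ.map ρ = T.occ ∧
      (∀ i : Fin T.n, (T.std.pre i).map ρ = T.pre i) ∧
      ∀ i : Fin T.n, (T.std.cont i).map ρ = T.cont i := by
  have hocc : T.std.occ = T.occ.map (fun x => T.occ.idxOf x) := Seq.occ_map _ _
  have hρ : ∀ x ∈ T.occ, ((T.occ[T.occ.idxOf x]?).getD (Classical.arbitrary 𝒩)) = x := by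
    intro x hx
    simp [List.getElem?_idxOf hx]
  refine ⟨?_, fun n => (T.occ[n]?).getD (Classical.arbitrary 𝒩), ?_, fun i => ?_, fun i => ?_⟩
  · rw [hocc, List.length_map]
    refine List.ext_getElem (by simp) fun i h1 h2 => ?_
    simp only [List.length_map] at h1
    simp [hT.idxOf_getElem i h1]
  · rw [hocc, List.map_map]
    conv_rhs => rw [← List.map_id T.occ]
    exact List.map_congr_left fun x hx => hρ x hx
  · conv_rhs => rw [← Prefix.map_id (T.pre i)]
    simp only [Seq.std, Seq.map]
    rw [Prefix.map_map]
    exact Prefix.map_congr _ fun x hx => hρ x (T.occ_pre_subset i hx)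
  · conv_rhs => rw [← Agent.map_id (T.cont i)]
    simp only [Seq.std, Seq.map]
    rw [Agent.map_map]
    exact Agent.map_congr _ fun x hx => hρ x (T.occ_cont_subset i hx)

/-- The graph of the right-hand side of a process production for `T`, apart from the part for the
prefix, where `(v)(Ss σ)` is a normal form of the renamed continuation `Cξ`. -/
def contGraph (C : Agent 𝒩 Empty) (ξ : 𝒩 → 𝒩) (v : List 𝒩) (Ss : List (Seq 𝒩)) (σ : 𝒩 → 𝒩) :
    Graph Label 𝒩 :=
  procs Ss + substGraph (fnarray Ss) σ + nEdges v + links (C.occ.map fun x => (ξ x, x))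

theorem mem_closedNodes {nodes : List 𝒩} {Λ : 𝒩 → Act × List 𝒩} {π : 𝒩 → 𝒩}
    {P : Agent 𝒩 Empty} {x : 𝒩} : x ∈ closedNodes nodes Λ π P ↔
      x ∈ nodes ∧ ¬ (∃ y, x ∈ (Λ y).2) ∧ ¬ (∃ y, y ≠ x ∧ π x = π y) ∧ x ∉ P.occ := by
  simp [closedNodes]

/-- The transition of a sequential agent given by one of its prefixes, for a chosen normal form of
the continuation. -/
theorem exists_process_transition [Nonempty 𝒩] {T : Seq 𝒩} (hT : T.occ.Nodup) (i : Fin T.n)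
    {Λ : 𝒩 → Act × List 𝒩} {π : 𝒩 → 𝒩} (hΛ : PrefixTransl (T.pre i) Λ π) {ξ : 𝒩 → 𝒩}
    (hξ : ∀ x ∈ T.occ, ∀ y ∈ T.occ, ξ x = ξ y → x = y)
    (hξT : ∀ x ∈ T.occ, ξ x ∉ T.occ) (hC : (T.cont i).occ.Nodup) {A : Finset 𝒩} {v : List 𝒩}
    {Ss : List (Seq 𝒩)} {σ : 𝒩 → 𝒩}
    (hN : IsFreshNormalForm ((T.cont i).map ξ) A v Ss σ) (hTA : ∀ x ∈ T.occ, x ∈ A) :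
    ∃ t : Transition Label Act 𝒩, Derives (productions 𝒩) t ∧ t.π = id ∧
      t.src.Γ = T.occ.toFinset ∧ t.src.G = {procEdge T} ∧ t.Λ = Λ ∧
      (∀ x, x ∈ t.tgt.Γ → x ∈ T.occ ∨ x ∈ v ++ fnarray Ss ∨ x ∈ T.occ.map ξ) ∧
      t.tgt.G = contGraph (T.cont i) ξ v Ss σ +
        substGraph (T.occ.filter (fun x => π x ≠ x)) π +
        nEdges (closedNodes T.occ Λ π (T.cont i)) := by
  obtain ⟨hrange, ρ, hρ, hpre, hcont⟩ := exists_std_map hT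
  have hsub := T.occ_cont_subset i
  have hpsub := T.occ_pre_subset i
  have hinj : Set.InjOn ξ {x | x ∈ (T.cont i).occ} := fun x hx y hy =>
    hξ x (hsub hx) y (hsub hy)
  have hlinks := substGraph_of_injOn (σ := ξ) hC fun x hx y hy => hξ x (hsub hx) y (hsub hy)
  have hdisj : ∀ x ∈ T.occ, x ∉ v ++ fnarray Ss := fun x hx hx' => hN.fresh x hx' (hTA x hx)
  have hfree : ∀ x, x ∈ freeNames v Ss σ ↔ x ∈ ((T.cont i).map ξ).occ := by
    intro x
    simp only [freeNames, List.mem_filter, hN.mem_map_iff, decide_eq_true_eq]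
    constructor
    · exact fun h => h.1.resolve_left h.2
    · exact fun h => ⟨.inr h, fun h' =>
        hN.fresh x (List.mem_append_left _ h') (hN.occ_subset x h)⟩
  let K : Judgement Label 𝒩 := ⟨(freeNames v Ss σ ++ v ++ fnarray Ss).toFinset,
    procs Ss + substGraph (fnarray Ss) σ + nEdges v, by
      intro x hx
      simp only [Graph.names_add, Finset.mem_union, mem_names_procs, mem_names_substGraph,
        mem_names_nEdges, hN.mem_map_iff, ← hfree] at hx
      simp only [List.mem_toFinset, List.mem_append]
      tauto⟩
  have hK : IsTranslation ((T.cont i).map ξ) v (fnarray Ss) K := by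
    refine ⟨v, Ss, σ, hN.isNormalForm, rfl, rfl, ?_, hN.nodup, rfl, (translGraph_self v Ss σ).symm⟩
    intro x hx hx'
    exact hN.fresh x hx' (hN.occ_subset x ((hfree x).1 hx))
  have hKmem : ∀ x, x ∈ K.Γ ↔ x ∈ ((T.cont i).map ξ).occ ∨ x ∈ v ∨ x ∈ fnarray Ss := by
    intro x
    simp only [K, List.mem_toFinset, List.mem_append, hfree, or_assoc]
  have hKnames : ∀ x ∈ K.Γ, x ∈ Graph.names K.G := by
    intro x hx
    rw [hKmem] at hx
    simp only [K, Graph.names_add, Finset.mem_union, mem_names_procs, mem_names_substGraph,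
      mem_names_nEdges, hN.mem_map_iff]
    tauto
  let G : Graph Label 𝒩 := K.G + substGraph (T.cont i).occ ξ +
    substGraph (T.occ.filter (fun x => π x ≠ x)) π +
    nEdges (closedNodes T.occ Λ π (T.cont i))
  have hG : Graph.names G ⊆ K.Γ ∪ T.occ.toFinset := by
    intro x hx
    refine Finset.mem_union.2 (Or.imp_right List.mem_toFinset.2 ?_)
    simp only [G, Graph.names_add, Finset.mem_union, mem_names_substGraph,
      mem_names_nEdges, mem_closedNodes, List.mem_map, List.mem_filter] at hx
    rcases hx with ((hx | hx | ⟨y, hy, rfl⟩) | hx | ⟨y, ⟨hy, -⟩, rfl⟩) | hx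
    · exact .inl (K.wf hx)
    · exact .inr (hsub hx)
    · refine .inl ((hKmem _).2 (.inl ?_))
      rw [Agent.occ_map]
      exact List.mem_map_of_mem hy
    · exact .inr hx.1
    · rcases hΛ.fusion_mem y with h | h
      · rw [h]; exact .inr hy
      · exact .inr (hpsub h)
    · exact .inr hx.1
  let t : Transition Label Act 𝒩 := Transition.mkId
    ⟨T.occ.toFinset, {procEdge T}, by
      intro x hx
      simpa [Graph.mem_names, procEdge] using hx⟩ Λ
    ⟨K.Γ ∪ T.occ.toFinset, G, hG⟩
    (fun x _ => hΛ.arity x)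
    (fun x hx => hΛ.out fun h => hx (List.mem_toFinset.2 (hpsub h)))
    (fun x hx => Finset.mem_union_right _ hx)
    (fun x _ z hz hz' => (hz' (List.mem_toFinset.2 (hpsub (hΛ.exposed_mem hz)))).elim)
    (fun z hz hz' _ => by
      simp only [G, Graph.names_add, Finset.mem_union]
      exact .inl (.inl (.inl (hKnames z ((Finset.mem_union.1 hz).resolve_right hz')))))
  have ht : IsProcessProduction t := by
    refine ⟨T.std, ρ, i, Λ, π, ξ, v, fnarray Ss, K, hrange, ?_, ?_, ?_, ?_, ?_, ?_, ?_, ?_, rfl,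
      rfl, ?_, ?_⟩
    · rwa [hρ]
    · rwa [hpre]
    · rw [hcont]; exact hinj
    · rw [hcont, hρ]
      intro x hx
      refine ⟨hξT x (hsub hx), fun h => hN.fresh _ h (hN.occ_subset _ ?_)⟩
      rw [Agent.occ_map]
      exact List.mem_map_of_mem hx
    · rw [hρ]; exact fun x hx hx' => hdisj x hx hx'
    · rwa [hcont]
    · rw [hρ]; rfl
    · change ({procEdge T} : Multiset (Edge Label 𝒩)) = {stdEdge T.std ρ}
      congr 1
      exact Edge.ext rfl hρ.symm
    · rw [hρ]; rfl
    · rw [hρ, hcont]; rfl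
  refine ⟨t, .prod (.inl ht), rfl, rfl, rfl, rfl, ?_, ?_⟩
  · intro x hx
    change x ∈ K.Γ ∪ T.occ.toFinset at hx
    rw [Finset.mem_union, hKmem, List.mem_toFinset, Agent.occ_map] at hx
    rw [List.mem_append]
    rcases hx with (hx | hx) | hx
    · exact .inr (.inr (List.map_subset ξ hsub hx))
    · exact .inr (.inl hx)
    · exact .inl hx
  · change G = _
    simp only [G, K, hlinks, contGraph]

theorem isSubstEffect_vecSubst {as bs : List 𝒩} (hl : as.length = bs.length) (h : as.Nodup)
    (hd : ∀ x ∈ as, x ∉ bs) : IsSubstEffect (vecSubst as bs) (eqRel (as.zip bs)) := by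
  have hbs : ∀ x ∈ bs, vecSubst as bs x = x := fun x hx =>
    vecSubst_of_notMem hl fun h => hd x h hx
  have hmap := map_vecSubst hl h
  have has : ∀ x ∈ as, vecSubst as bs x ∈ bs := fun x hx => by
    have := List.mem_map_of_mem (f := vecSubst as bs) hx
    rwa [hmap] at this
  have hself : ∀ x, Relation.EqvGen (eqRel (as.zip bs)) x (vecSubst as bs x) := by
    intro x
    by_cases hx : x ∈ as
    · refine .rel _ _ ?_
      have : as.zip bs = as.map fun x => (x, vecSubst as bs x) := by
        have := List.zip_map' (f := id) (g := vecSubst as bs) (l := as)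
        rwa [hmap, List.map_id] at this
      rw [eqRel, this]
      exact List.mem_map_of_mem (f := fun x => (x, vecSubst as bs x)) hx
    · rw [vecSubst_of_notMem hl hx]
      exact .refl _
  refine ⟨fun x => ?_, fun x y => ⟨fun hxy => ?_, fun hxy => ?_⟩⟩
  · by_cases hx : x ∈ as
    · exact hbs _ (has x hx)
    · rw [vecSubst_of_notMem hl hx, vecSubst_of_notMem hl hx]
  · exact (hself x).trans _ _ _ (hxy ▸ (hself y).symm)
  · induction hxy with
    | rel x y hxy =>
      obtain ⟨i, hi, he⟩ := List.mem_iff_getElem.1 hxy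
      simp only [List.getElem_zip, Prod.mk.injEq] at he
      simp only [List.length_zip, lt_min_iff] at hi
      have h1 : vecSubst as bs as[i] = bs[i] := by
        simp [vecSubst, h.idxOf_getElem i hi.1, hi.2]
      rw [← he.1, ← he.2, h1, hbs _ (List.getElem_mem _)]
    | refl => rfl
    | symm _ _ _ ih => exact ih.symm
    | trans _ _ _ _ _ ih ih' => exact ih.trans ih'

/-- The joint transition of an input, an output and the router which connects their subjects. The
objects of the two prefixes are linked by binary routers. The auxiliary production of the router is
applied to fresh copies of the nodes that it shares with the two agents, and its fresh names are
unified with the objects. -/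
theorem exists_comm_transition [Infinite 𝒩] {T₁ T₂ : Transition Label Act 𝒩}
    (h₁ : Derives (productions 𝒩) T₁) (h₂ : Derives (productions 𝒩) T₂) (hπ₁ : T₁.π = id)
    (hπ₂ : T₂.π = id)
    (hdisj : Disjoint (T₁.src.Γ ∪ T₁.tgt.Γ) (T₂.src.Γ ∪ T₂.tgt.Γ)) {c₁ c₂ : 𝒩}
    {xs ys : List 𝒩} (hlen : xs.length = ys.length)
    (hΛ₁ : T₁.Λ = single c₁ (.inp xs.length) xs) (hΛ₂ : T₂.Λ = single c₂ (.out ys.length) ys)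
    (hc₁ : c₁ ∈ T₁.src.Γ) (hc₂ : c₂ ∈ T₂.src.Γ) (hxs : ∀ x ∈ xs, x ∈ T₁.src.Γ)
    (hys : ∀ x ∈ ys, x ∈ T₂.src.Γ) {a b : 𝒩} {cs : List 𝒩} (hnd : (a :: b :: cs).Nodup)
    (hca : c₁ ∈ a :: b :: cs) (hcb : c₂ ∈ a :: b :: cs)
    (hfresh : ∀ x ∈ a :: b :: cs, x ∈ T₁.tgt.Γ ∪ T₂.tgt.Γ → x ∈ T₁.src.Γ ∪ T₂.src.Γ) :
    ∃ t : Transition Label Act 𝒩, Derives (productions 𝒩) t ∧ t.π = id ∧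
      t.src.Γ = T₁.src.Γ ∪ T₂.src.Γ ∪ (a :: b :: cs).toFinset ∧
      t.src.G = T₁.src.G + T₂.src.G + {mEdge a b cs} ∧
      (∀ x, x ≠ c₁ → x ≠ c₂ → t.Λ x = (ActionAlphabet.eps, [])) ∧
      (∀ x ∈ t.tgt.Γ, x ∈ T₁.tgt.Γ ∪ T₂.tgt.Γ ∨ x ∈ t.src.Γ) ∧
      t.tgt.G = T₁.tgt.G + T₂.tgt.G + {mEdge a b cs} + links (xs.zip ys) := by
  obtain ⟨t, ht, hπ, hΓ, hG, ht₁, ht₂, hΓ', hG'⟩ := h₁.exists_par h₂ hπ₁ hπ₂ hdisj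
  have hc : c₁ ≠ c₂ := by
    rintro rfl
    exact Finset.disjoint_left.1 hdisj (Finset.mem_union_left _ hc₁) (Finset.mem_union_left _ hc₂)
  set R := a :: b :: cs with hR
  obtain ⟨e, θ, he, he', hθ, hθ'⟩ := exists_copy R.toFinset t.src.Γ
    (t.src.Γ ∪ t.tgt.Γ)
  simp only [List.mem_toFinset] at he he' hθ
  -- the names exposed by the router
  obtain ⟨l, hll, hlnd, hlA⟩ := exists_fresh_list (xs.length + xs.length)
    (t.src.Γ ∪ t.tgt.Γ ∪ (R.map e).toFinset)
  obtain ⟨y₁, y₂, rfl, hy₁, hy₂⟩ : ∃ y₁ y₂, l = y₁ ++ y₂ ∧ y₁.length = xs.length ∧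
      y₂.length = xs.length :=
    ⟨l.take xs.length, l.drop xs.length, by simp, by simp [hll], by simp [hll]⟩
  simp only [Finset.mem_union, List.mem_toFinset, not_or] at hlA
  have hec : e c₁ ≠ e c₂ := e.injective.ne hc
  have hec₁ : e c₁ ∈ R.map e := List.mem_map_of_mem hca
  have hec₂ : e c₂ ∈ R.map e := List.mem_map_of_mem hcb
  let Λ : 𝒩 → Act × List 𝒩 :=
    Function.update (single (e c₁) (.inp y₁.length) y₁) (e c₂) (.out y₂.length, y₂)
  have hΛc₁ : Λ (e c₁) = (.inp y₁.length, y₁) := by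
    simp [Λ, Function.update_of_ne hec, single]
  have hΛc₂ : Λ (e c₂) = (.out y₂.length, y₂) := by simp [Λ]
  have hΛne : ∀ x, x ≠ e c₁ → x ≠ e c₂ → Λ x = (ActionAlphabet.eps, []) := by
    intro x h1 h2
    simp [Λ, Function.update_of_ne h2, single, Function.update_of_ne h1, ActionAlphabet.eps]
  have hRe : R.map e = e a :: e b :: cs.map e := rfl
  let G : Graph Label 𝒩 := {mEdge (e a) (e b) (cs.map e)} + links (y₁.zip y₂)
  have hnm : Graph.names ({mEdge (e a) (e b) (cs.map e)} : Graph Label 𝒩) =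
      (R.map e).toFinset := by
    ext x
    simp [Graph.mem_names, mEdge, hRe]
  have hlen' : y₁.length = y₂.length := hy₁.trans hy₂.symm
  have hGnames : Graph.names G = (R.map e ++ y₁ ++ y₂).toFinset := by
    ext x
    simp only [G, Graph.names_add, hnm, Finset.mem_union, mem_names_links,
      List.map_fst_zip hlen'.le, List.map_snd_zip hlen'.ge, List.mem_toFinset, List.mem_append,
      or_assoc]
  let tm : Transition Label Act 𝒩 := Transition.mkId
    ⟨(R.map e).toFinset, {mEdge (e a) (e b) (cs.map e)}, hnm.le⟩ Λ
    ⟨(R.map e ++ y₁ ++ y₂).toFinset, G, hGnames.le⟩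
    (by
      intro x _
      by_cases h1 : x = e c₁
      · rw [h1, hΛc₁]; rfl
      · by_cases h2 : x = e c₂
        · rw [h2, hΛc₂]; rfl
        · rw [hΛne x h1 h2]; rfl)
    (by
      intro x hx
      rw [List.mem_toFinset] at hx
      exact hΛne x (fun h => hx (h ▸ hec₁)) (fun h => hx (h ▸ hec₂)))
    (by
      intro x hx
      rw [List.mem_toFinset] at hx ⊢
      exact List.mem_append_left _ (List.mem_append_left _ hx))
    (by
      intro x _ z hz _
      rw [List.mem_toFinset, List.mem_append, List.mem_append]
      by_cases h1 : x = e c₁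
      · rw [h1, hΛc₁] at hz; exact .inl (.inr hz)
      · by_cases h2 : x = e c₂
        · rw [h2, hΛc₂] at hz; exact .inr hz
        · rw [hΛne x h1 h2] at hz; simp at hz)
    (by
      intro z hz _ _
      rw [hGnames]
      exact hz)
  have htm : Derives (productions 𝒩) tm := by
    refine .prod (.inr ⟨e a, e b, cs.map e, e c₁, e c₂, y₁, y₂, ?_, hec₁, hec₂, hec, hlen', rfl,
      rfl, rfl, rfl, rfl, ?_⟩)
    · change (R.map e ++ y₁ ++ y₂).Nodup
      rw [List.append_assoc]
      refine List.nodup_append.2 ⟨hnd.map e.injective, hlnd, ?_⟩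
      rintro x hx _ hy rfl
      exact (hlA x hy).2 hx
    · change {mEdge (e a) (e b) (cs.map e)} + links (y₁.zip y₂) = _
      rw [Multiset.singleton_add, links, List.zip_eq_zipWith, List.map_zipWith]
  have hdisj' : Disjoint (t.src.Γ ∪ t.tgt.Γ) (tm.src.Γ ∪ tm.tgt.Γ) := by
    rw [Finset.disjoint_right]
    intro x hx
    have hx' : x ∈ R.map e ∨ x ∈ y₁ ++ y₂ := by
      change x ∈ (R.map e).toFinset ∪ (R.map e ++ y₁ ++ y₂).toFinset at hx
      simp only [Finset.mem_union, List.mem_toFinset, List.mem_append] at hx ⊢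
      tauto
    rcases hx' with hx' | hx'
    · obtain ⟨y, hy, rfl⟩ := List.mem_map.1 hx'
      by_cases hyt : y ∈ t.src.Γ
      · exact he y hy hyt
      · rw [he' y hy hyt, Finset.mem_union, not_or]
        refine ⟨hyt, fun h => hyt ?_⟩
        rw [hΓ]
        exact hfresh y hy (hΓ' ▸ h)
    · rw [Finset.mem_union, not_or]
      exact (hlA x hx').1
  have hsrcΛ : ∀ x ∈ R, x ∈ t.src.Γ →
      (t.Λ x = (ActionAlphabet.eps, []) ∧ Λ (e x) = (ActionAlphabet.eps, [])) ∨
      (x = c₁ ∧ t.Λ x = (.inp xs.length, xs)) ∨ (x = c₂ ∧ t.Λ x = (.out ys.length, ys)) := by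
    intro x hx hxt
    rw [hΓ, Finset.mem_union] at hxt
    by_cases h1 : x = c₁
    · subst h1
      rw [ht₁ x hc₁, hΛ₁]
      exact .inr (.inl ⟨rfl, by simp [single]⟩)
    · by_cases h2 : x = c₂
      · subst h2
        rw [ht₂ x hc₂, hΛ₂]
        exact .inr (.inr ⟨rfl, by simp [single]⟩)
      · refine .inl ⟨?_, hΛne _ (e.injective.ne h1) (e.injective.ne h2)⟩
        rcases hxt with hxt | hxt
        · rw [ht₁ x hxt, hΛ₁]
          simp [single, Function.update_of_ne h1, ActionAlphabet.eps]
        · rw [ht₂ x hxt, hΛ₂]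
          simp [single, Function.update_of_ne h2, ActionAlphabet.eps]
  have hobj : ∀ x ∈ xs ++ ys, x ∈ t.src.Γ := by
    intro x hx
    rw [hΓ, Finset.mem_union]
    exact (List.mem_append.1 hx).imp (hxs x) (hys x)
  have hzlen : (y₁ ++ y₂).length = (xs ++ ys).length := by simp [hy₁, hy₂, hlen]
  -- the objects are nodes, hence they are the representatives
  set ρ := vecSubst (y₁ ++ y₂) (xs ++ ys) with hρ
  have hρ_fix : ∀ x, x ∉ y₁ ++ y₂ → ρ x = x := fun x hx => vecSubst_of_notMem hzlen hx
  have hρ_eff : IsSubstEffect ρ (eqRel ((y₁ ++ y₂).zip (xs ++ ys))) :=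
    isSubstEffect_vecSubst hzlen hlnd fun x hx hx' => (hlA x hx).1.1 (hobj x hx')
  have hct₁ : c₁ ∈ t.src.Γ := hΓ ▸ Finset.mem_union_left _ hc₁
  have hct₂ : c₂ ∈ t.src.Γ := hΓ ▸ Finset.mem_union_right _ hc₂
  have htc₁ : t.Λ c₁ = (.inp xs.length, xs) := by
    rw [ht₁ _ hc₁, hΛ₁]; simp [single]
  have htc₂ : t.Λ c₂ = (.out ys.length, ys) := by
    rw [ht₂ _ hc₂, hΛ₂]; simp [single]
  have hρ_map : (y₁ ++ y₂).map ρ = xs ++ ys := map_vecSubst hzlen hlnd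
  have hρ_map' : y₁.map ρ = xs ∧ y₂.map ρ = ys := by
    rw [List.map_append] at hρ_map
    exact List.append_inj hρ_map (by simp [hy₁])
  have hsw : ∀ (l m : List 𝒩) (p q : 𝒩), (p, q) ∈ l.zip m → (q, p) ∈ m.zip l := by
    intro l m p q h
    rw [← List.zip_swap, List.mem_map]
    exact ⟨(p, q), h, rfl⟩
  obtain ⟨t', ht', hπ', hΓt, hGt, hΛt, hΛt', hΓt', hGt'⟩ := ht.exists_join htm hπ rfl hdisj' θ ρ
    (by
      intro x hx
      refine hθ' x fun h => hx ?_
      change x ∈ (R.map e).toFinset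
      simpa using h)
    (by
      intro x hx
      obtain ⟨y, hy, rfl⟩ := List.mem_map.1 (List.mem_toFinset.1 hx)
      rw [hθ y hy]
      by_cases hyt : y ∈ t.src.Γ
      · refine .inr ⟨hyt, ?_⟩
        change (t.Λ y).1 = (Λ (e y)).1
        rcases hsrcΛ y hy hyt with ⟨h1, h2⟩ | ⟨rfl, h⟩ | ⟨rfl, h⟩
        · rw [h1, h2]
        · rw [h, hΛc₁, hy₁]
        · rw [h, hΛc₂, hy₂, hlen]
      · exact .inl (he' y hy hyt).symm)
    (by
      intro x hx y hy hxy
      obtain ⟨x, hx', rfl⟩ := List.mem_map.1 (List.mem_toFinset.1 hx)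
      obtain ⟨y, hy', rfl⟩ := List.mem_map.1 (List.mem_toFinset.1 hy)
      rw [hθ x hx', hθ y hy'] at hxy
      rw [hxy])
    (by
      intro x _ z hz hz'
      have hz' : z ∈ R.map e := List.mem_toFinset.1 hz'
      change z ∈ (Λ x).2 at hz
      by_cases h1 : x = e c₁
      · rw [h1, hΛc₁] at hz
        exact (hlA z (List.mem_append_left _ hz)).2 hz'
      · by_cases h2 : x = e c₂
        · rw [h2, hΛc₂] at hz
          exact (hlA z (List.mem_append_right _ hz)).2 hz'
        · rw [hΛne x h1 h2] at hz
          simp at hz)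
    (by
      refine hρ_eff.congr fun p q => ⟨eqvGen_imp id ?_, eqvGen_imp id ?_⟩
      · intro p q h
        rw [eqRel, List.zip_append (by simp [hy₁]), List.mem_append] at h
        refine .symm _ _ (.rel _ _ ?_)
        rcases h with h | h
        · refine ⟨e c₁, List.mem_toFinset.2 hec₁, by rw [hθ c₁ hca]; exact hct₁, ?_⟩
          change _ ∈ (t.Λ _).2.zip (Λ (e c₁)).2
          rw [hθ c₁ hca, htc₁, hΛc₁]
          exact hsw _ _ _ _ h
        · refine ⟨e c₂, List.mem_toFinset.2 hec₂, by rw [hθ c₂ hcb]; exact hct₂, ?_⟩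
          change _ ∈ (t.Λ _).2.zip (Λ (e c₂)).2
          rw [hθ c₂ hcb, htc₂, hΛc₂]
          exact hsw _ _ _ _ h
      · rintro p q ⟨x, hx, hxt, hpq⟩
        obtain ⟨y, hy, rfl⟩ := List.mem_map.1 (List.mem_toFinset.1 hx)
        change (p, q) ∈ (t.Λ _).2.zip (Λ (e y)).2 at hpq
        rw [hθ y hy] at hxt hpq
        refine .symm _ _ (.rel _ _ ?_)
        rw [eqRel, List.zip_append (by simp [hy₁]), List.mem_append]
        rcases hsrcΛ y hy hxt with ⟨h1, h2⟩ | ⟨rfl, h⟩ | ⟨rfl, h⟩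
        · rw [h1, h2] at hpq
          simp at hpq
        · rw [h, hΛc₁] at hpq
          exact .inl (hsw _ _ _ _ hpq)
        · rw [h, hΛc₂] at hpq
          exact .inr (hsw _ _ _ _ hpq))
    (by
      intro x hx
      refine hρ_fix x fun h => ?_
      rcases hx with hx | hx
      · exact (hlA x h).1.1 hx
      · exact (hlA x h).2 (List.mem_toFinset.1 hx))
  have himg : tm.src.Γ.image θ = R.toFinset := by
    ext x
    rw [Finset.mem_image]
    constructor
    · rintro ⟨y, hy, rfl⟩
      obtain ⟨z, hz, rfl⟩ := List.mem_map.1 (List.mem_toFinset.1 hy)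
      rw [hθ z hz]
      exact List.mem_toFinset.2 hz
    · intro hx
      rw [List.mem_toFinset] at hx
      exact ⟨e x, List.mem_toFinset.2 (List.mem_map_of_mem hx), hθ x hx⟩
  have hmθ : (mEdge (e a) (e b) (cs.map e) : Edge Label 𝒩).rename θ = mEdge a b cs := by
    rw [mEdge_rename, List.map_map, hθ a (by simp [hR]), hθ b (by simp [hR])]
    congr 1
    conv_rhs => rw [← List.map_id cs]
    exact List.map_congr_left fun x hx => hθ x (by simp [hR, hx])
  have hθy : ∀ x ∈ y₁ ++ y₂, θ x = x := by
    intro x hx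
    refine hθ' x fun h => (hlA x hx).2 ?_
    simpa using h
  have hρR : ∀ x ∈ R, ρ x = x := by
    intro x hx
    by_cases hxt : x ∈ t.src.Γ
    · exact hρ_fix x fun h => (hlA x h).1.1 hxt
    · refine hρ_fix x fun h => (hlA x h).2 ?_
      rw [← he' x hx hxt]
      exact List.mem_map_of_mem hx
  refine ⟨t', ht', hπ', by rw [hΓt, himg, hΓ], ?_, ?_, ?_, ?_⟩
  · rw [hGt, hG]
    congr 1
    change Graph.rename θ {mEdge (e a) (e b) (cs.map e)} = _
    rw [Graph.rename, Multiset.map_singleton, hmθ]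
  · intro x h1 h2
    by_cases hxt : x ∈ t'.src.Γ
    · rw [hΓt, Finset.mem_union] at hxt
      by_cases hx : x ∈ t.src.Γ
      · rw [hΛt x hx]
        have : t.Λ x = (ActionAlphabet.eps, []) := by
          rw [hΓ, Finset.mem_union] at hx
          rcases hx with hx | hx
          · rw [ht₁ x hx, hΛ₁]
            simp [single, Function.update_of_ne h1, ActionAlphabet.eps]
          · rw [ht₂ x hx, hΛ₂]
            simp [single, Function.update_of_ne h2, ActionAlphabet.eps]
        rw [this]; rfl
      · have hxR : x ∈ R := by
          have := hxt.resolve_left hx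
          rw [himg] at this
          exact List.mem_toFinset.1 this
        have := hΛt' (e x) (List.mem_toFinset.2 (List.mem_map_of_mem hxR))
        rw [hθ x hxR] at this
        rw [this]
        change ((Λ (e x)).1, (Λ (e x)).2.map ρ) = _
        rw [hΛne _ (e.injective.ne h1) (e.injective.ne h2)]
        rfl
    · exact t'.Λ_out x hxt
  · intro x hx
    rw [hΓt', Finset.mem_union, Finset.mem_image, Finset.mem_image] at hx
    rcases hx with ⟨y, hy, rfl⟩ | ⟨y, hy, rfl⟩
    · have : y ∉ y₁ ++ y₂ := fun h => (hlA y h).1.2 hy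
      rw [hρ_fix y this]
      exact .inl (hΓ' ▸ hy)
    · right
      rw [hΓt, himg, Finset.mem_union]
      have hy : y ∈ R.map e ++ y₁ ++ y₂ := List.mem_toFinset.1 hy
      rw [List.append_assoc, List.mem_append] at hy
      rcases hy with hy | hy
      · obtain ⟨z, hz, rfl⟩ := List.mem_map.1 hy
        rw [Function.comp_apply, hθ z hz, hρR z hz]
        exact .inr (List.mem_toFinset.2 hz)
      · rw [Function.comp_apply, hθy y hy]
        left
        refine hobj _ ?_
        rw [← hρ_map]
        exact List.mem_map_of_mem hy
  · rw [hGt', hG', Graph.rename_eq_self fun x hx => hρ_fix x fun h =>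
      (hlA x h).1.2 (t.tgt.wf (hG' ▸ hx)), add_assoc (T₁.tgt.G + T₂.tgt.G)]
    congr 1
    change Graph.rename (ρ ∘ θ) ({mEdge (e a) (e b) (cs.map e)} + links (y₁.zip y₂)) = _
    rw [← Graph.rename_rename, Graph.rename_add, Graph.rename_add]
    congr 1
    · have h1 : Graph.rename θ {mEdge (e a) (e b) (cs.map e)} = {mEdge a b cs} := by
        rw [Graph.rename, Multiset.map_singleton, hmθ]
      rw [h1, Graph.rename, Multiset.map_singleton,
        Edge.rename_eq_self fun x hx => hρR x hx]
    · rw [Graph.rename_eq_self (f := θ), rename_links, zip_map_prod, hρ_map'.1, hρ_map'.2]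
      intro x hx
      rw [mem_names_links, List.map_fst_zip hlen'.le, List.map_snd_zip hlen'.ge] at hx
      exact hθy x (List.mem_append.2 hx)

end


/-! ### Amoeboids from alternating graphs -/

section

variable {𝒩 : Type}

/-- Two nodes are linked in `M` if they are attached to a common edge. -/
def Linked (M : Graph Label 𝒩) (x y : 𝒩) : Prop := ∃ e ∈ M, x ∈ e.att ∧ y ∈ e.att

theorem Linked.symm {M : Graph Label 𝒩} {x y : 𝒩} (h : Linked M x y) : Linked M y x := by
  obtain ⟨e, he, hx, hy⟩ := h
  exact ⟨e, he, hy, hx⟩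

theorem exists_isWalk {M : Graph Label 𝒩} {x y : 𝒩} (h : Relation.EqvGen (Linked M) x y) :
    ∃ p, IsWalk x p y ∧ ∀ q ∈ p, q.1 ∈ M := by
  have : Relation.ReflTransGen (Linked M) x y := by
    induction h with
    | rel x y h => exact .single h
    | refl x => exact .refl
    | symm x y _ ih =>
      have : Std.Symm (Linked M) := ⟨fun _ _ => Linked.symm⟩
      exact Std.Symm.symm _ _ ih
    | trans x y z _ _ ih ih' => exact ih.trans ih'
  clear h
  induction this using Relation.ReflTransGen.head_induction_on with
  | refl => exact ⟨[], rfl, by simp⟩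
  | head h _ ih =>
    obtain ⟨e, he, hx, hz⟩ := h
    obtain ⟨p, hp, hpM⟩ := ih
    exact ⟨(e, _) :: p, ⟨hx, hz, hp⟩, by simpa using ⟨he, fun a b h => hpM (a, b) h⟩⟩

variable [DecidableEq 𝒩]

theorem edgeCount_add (M N : Graph Label 𝒩) (x : 𝒩) :
    edgeCount (M + N) x = edgeCount M x + edgeCount N x := Multiset.countP_add _ _ _

theorem edgeCount_cons (e : Edge Label 𝒩) (M : Graph Label 𝒩) (x : 𝒩) :
    edgeCount (e ::ₘ M) x = edgeCount M x + if x ∈ e.att then 1 else 0 :=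
  Multiset.countP_cons _ _ _

theorem notMem_att_of_edgeCount_eq_zero {M : Graph Label 𝒩} {x : 𝒩} (h : edgeCount M x = 0)
    {e : Edge Label 𝒩} (he : e ∈ M) : x ∉ e.att := fun hx =>
  (Multiset.countP_pos.2 ⟨e, he, hx⟩).ne' h

/-- A walk through distinct edges of two matchings `MA` and `MB` (no node is attached to two edges
of one of them) alternates between the matchings. So its length is odd if neither of its ends is
attached to an edge of `MB`. -/
theorem IsWalk.odd_length {y : 𝒩} (p : List (Edge Label 𝒩 × 𝒩)) :
    ∀ {MA MB : Graph Label 𝒩} {x : 𝒩}, IsWalk x p y →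
      Multiset.ofList (p.map Prod.fst) ≤ MA + MB → (∀ z, edgeCount MA z ≤ 1) →
      (∀ z, edgeCount MB z ≤ 1) → edgeCount MB y = 0 →
      (edgeCount MB x = 0 → p = [] ∨ Odd p.length) ∧
      (edgeCount MA x = 0 → Even p.length) := by
  induction p with
  | nil => intros; exact ⟨fun _ => .inl rfl, fun _ => by simp⟩
  | cons q p ih =>
    obtain ⟨e, z⟩ := q
    rintro MA MB x ⟨hx, hz, hp⟩ hle hA hB hy
    rw [List.map_cons, ← Multiset.cons_coe] at hle
    have he : e ∈ MA + MB := Multiset.mem_of_le hle (Multiset.mem_cons_self _ _)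
    refine ⟨fun hx0 => .inr ?_, fun hx0 => ?_⟩
    · have heA : e ∈ MA := (Multiset.mem_add.1 he).resolve_right fun h =>
        notMem_att_of_edgeCount_eq_zero hx0 h hx
      obtain ⟨MA', rfl⟩ := Multiset.exists_cons_of_mem heA
      rw [Multiset.cons_add, Multiset.cons_le_cons_iff] at hle
      have hz0 := hA z
      rw [edgeCount_cons, if_pos hz] at hz0
      have := (ih hp hle (fun u => (Nat.le_add_right _ _).trans
        ((edgeCount_cons e MA' u).symm.le.trans (hA u))) hB hy).2 (by omega)
      rw [List.length_cons]
      exact this.add_one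
    · have heB : e ∈ MB := (Multiset.mem_add.1 he).resolve_left fun h =>
        notMem_att_of_edgeCount_eq_zero hx0 h hx
      have hey := notMem_att_of_edgeCount_eq_zero hy heB
      obtain ⟨MB', rfl⟩ := Multiset.exists_cons_of_mem heB
      rw [Multiset.add_cons, Multiset.cons_le_cons_iff] at hle
      have hz0 := hB z
      rw [edgeCount_cons, if_pos hz] at hz0
      rw [edgeCount_cons] at hy
      have := (ih hp hle hA (fun u => (Nat.le_add_right _ _).trans
        ((edgeCount_cons e MB' u).symm.le.trans (hB u))) (by omega)).1 (by omega)
      rw [List.length_cons]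
      rcases this with rfl | h
      · exact (hey ((show z = y from hp) ▸ hz)).elim
      · exact h.add_one

/-- A multiset is the sum of its fibres over `R`, if `g` takes its values in `R`. -/
theorem sum_filter_eq {α β : Type*} [DecidableEq β] (g : α → β) {R : List β} (hR : R.Nodup)
    (M : Multiset α) (hM : ∀ a ∈ M, g a ∈ R) : (R.map fun r => M.filter (g · = r)).sum = M := by
  rw [← List.sum_toFinset _ hR]
  induction M using Multiset.induction_on with
  | empty => simp
  | cons a M ih =>
    have : ∀ r, (a ::ₘ M).filter (g · = r) =
        (if g a = r then {a} else 0) + M.filter (g · = r) := by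
      intro r
      rw [Multiset.filter_cons]
    simp only [this, Finset.sum_add_distrib, Finset.sum_ite_eq, List.mem_toFinset]
    rw [if_pos (hM a (Multiset.mem_cons_self _ _)),
      ih fun b hb => hM b (Multiset.mem_cons_of_mem hb), Multiset.singleton_add]

/-- A graph of `m` and `n` edges which is the union of two matchings `A` and `B` decomposes into
amoeboids, if its nodes outside of `B` are `ws` and if `cl` assigns to each node a representative
in its connected component that is closed by an `n` edge of `B`. The components without nodes of
`ws` are pseudoamoeboids. The other components, without the `n` edges of their representatives, are
equivalent to the routers of `cl` on `ws`. -/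
theorem equalUpTo_of_matchings [Nonempty 𝒩] {J J' : Judgement Label 𝒩} {Pr A B : Graph Label 𝒩}
    {ws : List 𝒩} {cl : 𝒩 → 𝒩} (hJ : J.G = Pr + (A + B))
    (hJ' : J'.G = Pr + substGraph ws cl + nEdges (ws.map cl).dedup)
    (hPr : ∀ x ∈ Graph.names Pr, x ∈ ws)
    (hlabel : ∀ e ∈ A + B, e.label = .n ∨ ∃ i, e.label = .m i)
    (hA : ∀ x, edgeCount A x ≤ 1) (hA' : ∀ x ∈ Graph.names (A + B), edgeCount A x = 1)
    (hB : ∀ x, edgeCount B x ≤ 1) (hBws : ∀ x ∈ ws, edgeCount B x = 0)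
    (hB' : ∀ x ∈ Graph.names (A + B), x ∉ ws → edgeCount B x = 1)
    (hws : ∀ x ∈ ws, x ∈ Graph.names (A + B))
    (hcl : ∀ e ∈ A + B, ∀ x ∈ e.att, ∀ y ∈ e.att, cl x = cl y)
    (hcl_n : ∀ x ∈ Graph.names (A + B), nEdge (cl x) ∈ B)
    (hcl_idem : ∀ x ∈ Graph.names (A + B), cl (cl x) = cl x)
    (hcl_ws : ∀ x ∈ Graph.names (A + B), cl x ∉ ws)
    (hreach : ∀ x ∈ Graph.names (A + B), Relation.EqvGen (Linked (A + B)) x (cl x)) :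
    EqualUpTo J J' := by
  obtain ⟨g, hg⟩ : ∃ g : Edge Label 𝒩 → 𝒩, ∀ e ∈ A + B, ∀ x ∈ e.att, cl x = g e := by
    refine ⟨fun e => if h : e.att = [] then Classical.arbitrary 𝒩 else cl (e.att.head h),
      fun e he x hx => ?_⟩
    change _ = dite _ _ _
    rw [dif_neg (List.ne_nil_of_mem hx)]
    exact hcl e he _ hx _ (List.head_mem _)
  have hatt : ∀ e ∈ A + B, ∃ x, x ∈ e.att := by
    intro e he
    have := e.att_length
    rcases hlabel e he with h | ⟨i, h⟩
    all_goals
      rw [h] at this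
      refine List.exists_mem_of_length_pos ?_
      rw [this]
      exact Nat.succ_pos _
  have hnames : ∀ e ∈ A + B, ∀ x ∈ e.att, x ∈ Graph.names (A + B) :=
    fun e he x hx => Graph.mem_names.2 ⟨e, he, hx⟩
  have hcl_names : ∀ x ∈ Graph.names (A + B), cl x ∈ Graph.names (A + B) := fun x hx =>
    hnames _ (Multiset.mem_add.2 (.inr (hcl_n x hx))) _ (by simp [nEdge])
  set reps : List 𝒩 := (ws.map cl).dedup with hreps
  have hreps_mem : ∀ r, r ∈ reps ↔ ∃ x ∈ ws, cl x = r := by simp [hreps]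
  -- the representatives of the components without nodes of `ws`
  let others : List 𝒩 := (((Graph.names (A + B)).image cl) \ reps.toFinset).toList
  have hothers_mem : ∀ r, r ∈ others ↔ (∃ x ∈ Graph.names (A + B), cl x = r) ∧ r ∉ reps := by
    intro r
    simp [others]
  have hnd : (reps ++ others).Nodup := by
    refine List.nodup_append.2 ⟨List.nodup_dedup _, Finset.nodup_toList _, ?_⟩
    rintro r hr _ hr' rfl
    exact ((hothers_mem r).1 hr').2 hr
  let M : 𝒩 → Graph Label 𝒩 := fun r => (A + B).filter (g · = r)
  have hM_mem : ∀ {r e}, e ∈ M r ↔ e ∈ A + B ∧ g e = r := Multiset.mem_filter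
  have hMsum : ((reps ++ others).map M).sum = A + B := by
    refine sum_filter_eq g hnd _ fun e he => ?_
    obtain ⟨x, hx⟩ := hatt e he
    rw [← hg e he x hx, List.mem_append, hothers_mem]
    by_cases h : cl x ∈ reps
    · exact .inl h
    · exact .inr ⟨⟨x, hnames e he x hx, rfl⟩, h⟩
  have hM_names : ∀ {r x}, x ∈ Graph.names (M r) → x ∈ Graph.names (A + B) ∧ cl x = r := by
    intro r x hx
    obtain ⟨e, he, hxe⟩ := Graph.mem_names.1 hx
    rw [hM_mem] at he
    exact ⟨hnames e he.1 x hxe, (hg e he.1 x hxe).trans he.2⟩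
  have hM_count : ∀ {r x}, cl x = r → edgeCount (M r) x = edgeCount (A + B) x := by
    intro r x hx
    rw [edgeCount, Multiset.countP_filter]
    refine Multiset.countP_congr rfl fun e he => propext ⟨And.left, fun h => ⟨h, ?_⟩⟩
    rw [← hg e he x h, hx]
  -- the `n` edge at the representative only links it to itself
  have hstep : ∀ {N : Graph Label 𝒩} {r}, (∀ e ∈ M r, e ∈ N ∨ e = nEdge r) → ∀ {x y},
      Relation.EqvGen (Linked (A + B)) x y →
        cl x = cl y ∧ (cl x = r → Relation.EqvGen (Linked N) x y) := by
    intro N r hN x y h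
    induction h with
    | rel x y h =>
      obtain ⟨e, he, hx, hy⟩ := h
      refine ⟨hcl e he x hx y hy, fun hr => ?_⟩
      rcases hN e (hM_mem.2 ⟨he, (hg e he x hx).symm.trans hr⟩) with h | rfl
      · exact .rel _ _ ⟨e, h, hx, hy⟩
      · simp only [nEdge, List.mem_singleton] at hx hy
        rw [hx, hy]
        exact .refl _
    | refl x => exact ⟨rfl, fun _ => .refl _⟩
    | symm x y _ ih => exact ⟨ih.1.symm, fun h => (ih.2 (ih.1.trans h)).symm⟩
    | trans x y z _ _ ih ih' =>
      exact ⟨ih.1.trans ih'.1, fun h => (ih.2 h).trans _ _ _ (ih'.2 (ih.1.symm.trans h))⟩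
  have hconn : ∀ {N : Graph Label 𝒩} {r}, (∀ e ∈ M r, e ∈ N ∨ e = nEdge r) → (N ≤ M r) →
      ∀ x ∈ Graph.names N, ∀ y ∈ Graph.names N, ∃ p, IsWalk x p y ∧ ∀ q ∈ p, q.1 ∈ N := by
    intro N r hN hNM x hx y hy
    have hsub : ∀ {z}, z ∈ Graph.names N → z ∈ Graph.names (A + B) ∧ cl z = r := by
      intro z hz
      obtain ⟨e, he, hze⟩ := Graph.mem_names.1 hz
      exact hM_names (Graph.mem_names.2 ⟨e, Multiset.mem_of_le hNM he, hze⟩)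
    have h1 := (hstep hN (hreach x (hsub hx).1)).2 (hsub hx).2
    have h2 := (hstep hN (hreach y (hsub hy).1)).2 (hsub hy).2
    rw [(hsub hx).2] at h1
    rw [(hsub hy).2] at h2
    exact exists_isWalk (h1.trans _ _ _ h2.symm)
  have hrep_names : ∀ {r}, r ∈ reps → r ∈ Graph.names (A + B) ∧ cl r = r ∧ r ∉ ws ∧
      nEdge r ∈ B := by
    intro r hr
    obtain ⟨x, hx, rfl⟩ := (hreps_mem r).1 hr
    exact ⟨hcl_names x (hws x hx), hcl_idem x (hws x hx), hcl_ws x (hws x hx),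
      hcl_n x (hws x hx)⟩
  -- the amoeboid at `r` is the component without its `n` edge at `r`
  have hM' : ∀ r, ∃ N, r ∈ reps → M r = nEdge r ::ₘ N := by
    intro r
    by_cases hr : r ∈ reps
    · obtain ⟨-, h1, -, h2⟩ := hrep_names hr
      have hn : nEdge r ∈ M r := hM_mem.2 ⟨Multiset.mem_add.2 (.inr h2),
        (hg _ (Multiset.mem_add.2 (.inr h2)) r (by simp [nEdge])).symm.trans h1⟩
      obtain ⟨N, hN⟩ := Multiset.exists_cons_of_mem hn
      exact ⟨N, fun _ => hN⟩
    · exact ⟨0, fun h => (hr h).elim⟩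
  choose M' hM' using hM'
  have hM'M : ∀ {r}, r ∈ reps → M' r ≤ M r := fun hr => hM' _ hr ▸ Multiset.le_cons_self _ _
  have hM'_names : ∀ {r x}, r ∈ reps → x ∈ Graph.names (M' r) →
      x ∈ Graph.names (A + B) ∧ cl x = r := by
    intro r x hr hx
    obtain ⟨e, he, hxe⟩ := Graph.mem_names.1 hx
    exact hM_names (Graph.mem_names.2 ⟨e, Multiset.mem_of_le (hM'M hr) he, hxe⟩)
  have hext : ∀ r x, x ∈ (router ws cl r).att.toFinset ↔ x = r ∨ (x ∈ ws ∧ cl x = r) := by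
    intro r x
    simp [router_att]
  have hM'_count : ∀ {r x}, r ∈ reps → cl x = r →
      edgeCount (M' r) x + (if x = r then 1 else 0) = edgeCount A x + edgeCount B x := by
    intro r x hr hx
    rw [← edgeCount_add, ← hM_count hx, hM' r hr, edgeCount_cons]
    simp [nEdge]
  have hext_count : ∀ {r x}, r ∈ reps → (x = r ∨ (x ∈ ws ∧ cl x = r)) →
      x ∈ Graph.names (A + B) ∧ cl x = r := by
    rintro r x hr (rfl | ⟨hx, hxr⟩)
    · exact ⟨(hrep_names hr).1, (hrep_names hr).2.1⟩
    · exact ⟨hws x hx, hxr⟩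
  have hnJ' : ∀ x ∈ Graph.names J'.G, x ∈ ws ∨ x ∈ reps := by
    intro x hx
    rw [hJ', Graph.names_add, Graph.names_add, Finset.mem_union, Finset.mem_union,
      mem_names_substGraph, mem_names_nEdges, hreps_mem] at hx
    rw [hreps_mem]
    rcases hx with (hx | hx | hx) | hx
    · exact .inl (hPr x hx)
    · exact .inl hx
    · exact .inr (List.mem_map.1 hx)
    · exact .inr hx
  refine ⟨id, Pr + nEdges reps, reps.map fun r => (router ws cl r, M' r), others.map M,
    Function.injective_id.injOn, ?_, ?_, ?_, ?_, ?_⟩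
  · rw [hJ', substGraph_eq, List.map_map]
    exact add_right_comm _ _ _
  · rw [Graph.rename_eq_self (f := id) fun _ _ => rfl, hJ, ← hMsum, List.map_append, List.sum_append,
      List.map_map, add_assoc Pr, add_assoc Pr]
    congr 2
    have : ∀ l : List 𝒩, (∀ r ∈ l, r ∈ reps) →
        (l.map M).sum = nEdges l + (l.map (Prod.snd ∘ fun r => (router ws cl r, M' r))).sum := by
      intro l hl
      induction l with
      | nil => rfl
      | cons r l ih =>
        rw [List.map_cons, List.sum_cons, List.map_cons, List.sum_cons,
          ih fun s hs => hl s (List.mem_cons_of_mem _ hs), hM' r (hl r List.mem_cons_self)]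
        change (_ ::ₘ M' r) + _ = (_ ::ₘ nEdges l) + _
        rw [Multiset.cons_add, Multiset.cons_add, add_left_comm]
        rfl
    exact this reps fun _ h => h
  · intro p hp
    obtain ⟨r, hr, rfl⟩ := List.mem_map.1 hp
    obtain ⟨hrn, hrr, hrws, hrB⟩ := hrep_names hr
    refine ⟨?_, ?_, ?_, ?_, ?_, ?_⟩
    · obtain ⟨x, hx, hxr⟩ := (hreps_mem r).1 hr
      obtain ⟨y, ys, -, h⟩ := router_eq_mEdge (hxr ▸ List.mem_map_of_mem hx : r ∈ ws.map cl)
      exact ⟨ys.length, by rw [h]; rfl⟩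
    · intro e he
      exact hlabel e (hM_mem.1 (Multiset.mem_of_le (hM'M hr) he)).1
    · refine hconn (r := r) ?_ (hM'M hr)
      intro e he
      rw [hM' r hr, Multiset.mem_cons] at he
      exact he.symm
    · intro x hx
      rw [hext] at hx
      have hx' := hext_count hr hx
      have h1 := hM'_count hr hx'.2
      rw [hA' x hx'.1] at h1
      change edgeCount (M' r) x = 1
      rcases hx with rfl | ⟨hx, -⟩
      · rw [if_pos rfl, hB' x hrn hrws] at h1
        omega
      · rw [if_neg fun h : x = r => hrws (h ▸ hx), hBws x hx] at h1
        omega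
    · intro x hx hxS
      rw [hext, not_or, not_and] at hxS
      have hx' := hM'_names hr hx
      have h1 := hM'_count hr hx'.2
      rw [hA' x hx'.1, hB' x hx'.1 fun h => hxS.2 h hx'.2, if_neg hxS.1] at h1
      exact h1
    · rintro x hx y hy hxy p ⟨hp, -, hle⟩
      -- without `n(r)`, no edge of the matching `B` is attached to an external node
      obtain ⟨B', hBB'⟩ := Multiset.exists_cons_of_mem hrB
      have hle' : M' r ≤ A + B' := by
        rw [← Multiset.cons_le_cons_iff (nEdge r), ← hM' r hr, ← Multiset.add_cons, ← hBB']
        exact Multiset.filter_le _ _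
      have hB'_count : ∀ z, edgeCount B z = edgeCount B' z + if z = r then 1 else 0 := by
        intro z
        rw [hBB', edgeCount_cons]
        simp [nEdge]
      have hB'0 : ∀ z ∈ (router ws cl r).att.toFinset, edgeCount B' z = 0 := by
        intro z hz
        have h := hB'_count z
        rcases (hext r z).1 hz with rfl | ⟨hz, -⟩
        · rw [hB' z hrn hrws, if_pos rfl] at h
          omega
        · rw [hBws z hz] at h
          omega
      refine ((IsWalk.odd_length p hp (hle.trans hle') hA (fun z => ?_) (hB'0 y hy)).1
        (hB'0 x hx)).resolve_left ?_
      · have := hB z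
        rw [hB'_count] at this
        omega
      · rintro rfl
        exact hxy hp
  · intro N hN
    obtain ⟨r, hr, rfl⟩ := List.mem_map.1 hN
    refine ⟨fun e he => hlabel e (hM_mem.1 he).1, hconn (fun e he => .inl he) le_rfl, by simp, ?_,
      by simp⟩
    intro x hx _
    obtain ⟨hx, hxr⟩ := hM_names hx
    rw [hM_count hxr, edgeCount_add, hA' x hx, hB' x hx]
    exact fun h => ((hothers_mem r).1 hr).2 ((hreps_mem r).2 ⟨x, h, hxr⟩)
  · have hI₁ : ∀ r ∈ reps, ∀ x ∈ Graph.names (M' r) \ (router ws cl r).att.toFinset,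
        cl x = r ∧ x ∉ ws ∧ x ∉ reps := by
      intro r hr x hx
      rw [Finset.mem_sdiff, hext, not_or, not_and] at hx
      obtain ⟨hx, h1, h2⟩ := hx
      have hxr := (hM'_names hr hx).2
      exact ⟨hxr, fun h => h2 h hxr, fun h => h1 ((hrep_names h).2.1.symm.trans hxr)⟩
    have hI₂ : ∀ r ∈ others, ∀ x ∈ Graph.names (M r), cl x = r ∧ x ∉ ws ∧ x ∉ reps := by
      intro r hr x hx
      have hxr := (hM_names hx).2
      have hr' := ((hothers_mem r).1 hr).2
      refine ⟨hxr, fun h => hr' ((hreps_mem r).2 ⟨x, h, hxr⟩), fun h => hr' ?_⟩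
      rwa [← hxr, (hrep_names h).2.1]
    have hne := List.nodup_append.1 hnd
    refine ⟨List.pairwise_append.2 ⟨?_, ?_, ?_⟩, ?_⟩
    · rw [List.map_map, List.pairwise_map]
      refine List.Pairwise.imp_of_mem (fun {r s} hr hs hrs => ?_) hne.1
      exact Finset.disjoint_left.2 fun x hx hx' =>
        hrs ((hI₁ r hr x hx).1.symm.trans (hI₁ s hs x hx').1)
    · rw [List.map_map, List.pairwise_map]
      refine List.Pairwise.imp_of_mem (fun {r s} hr hs hrs => ?_) hne.2.1
      exact Finset.disjoint_left.2 fun x hx hx' =>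
        hrs ((hI₂ r hr x hx).1.symm.trans (hI₂ s hs x hx').1)
    · intro I hI I' hI'
      rw [List.map_map] at hI hI'
      obtain ⟨r, hr, rfl⟩ := List.mem_map.1 hI
      obtain ⟨s, hs, rfl⟩ := List.mem_map.1 hI'
      exact Finset.disjoint_left.2 fun x hx hx' =>
        hne.2.2 r hr s hs ((hI₁ r hr x hx).1.symm.trans (hI₂ s hs x hx').1)
    · intro I hI
      have hI : ∀ x ∈ I, x ∉ ws ∧ x ∉ reps := by
        rw [List.mem_append, List.map_map, List.map_map] at hI
        rcases hI with hI | hI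
        · obtain ⟨r, hr, rfl⟩ := List.mem_map.1 hI
          exact fun x hx => (hI₁ r hr x hx).2
        · obtain ⟨r, hr, rfl⟩ := List.mem_map.1 hI
          exact fun x hx => (hI₂ r hr x hx).2
      exact Finset.disjoint_left.2 fun x hx hx' => (hnJ' x hx').elim (hI x hx).1 (hI x hx).2

end


/-! ### The graph after a reduction step -/

section

variable {𝒩 : Type}

theorem linked_links {l : List (𝒩 × 𝒩)} {p : 𝒩 × 𝒩} (hp : p ∈ l) : Linked (links l) p.1 p.2 :=
  ⟨mEdge p.1 p.2 [], Multiset.mem_coe.2 (List.mem_map_of_mem (f := fun p : 𝒩 × 𝒩 => mEdge p.1 p.2 []) hp),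
    by simp [mEdge], by simp [mEdge]⟩

theorem Linked.mono {M N : Graph Label 𝒩} (h : M ≤ N) {x y : 𝒩} (hxy : Linked M x y) :
    Linked N x y := by
  obtain ⟨e, he, h'⟩ := hxy
  exact ⟨e, Multiset.mem_of_le h he, h'⟩

variable [DecidableEq 𝒩]

theorem edgeCount_nEdges (l : List 𝒩) (x : 𝒩) : edgeCount (nEdges l) x = l.count x := by
  rw [edgeCount, nEdges, Multiset.coe_countP, List.countP_map, List.count]
  refine List.countP_congr fun y _ => ?_
  simp only [nEdge, Function.comp_apply, List.mem_singleton, decide_eq_true_eq, beq_iff_eq]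
  exact eq_comm

theorem edgeCount_links {l : List (𝒩 × 𝒩)} (h : (l.map Prod.fst ++ l.map Prod.snd).Nodup)
    (x : 𝒩) : edgeCount (links l) x = (l.map Prod.fst ++ l.map Prod.snd).count x := by
  induction l with
  | nil => rfl
  | cons p l ih =>
    have hp : p.1 ≠ p.2 := fun hp => (List.nodup_append.1 h).2.2 p.1 (by simp) p.2 (by simp) hp
    have hl : (l.map Prod.fst ++ l.map Prod.snd).Nodup :=
      h.sublist (List.Sublist.append (List.sublist_cons_self _ _) (List.sublist_cons_self _ _))
    have : links (p :: l) = mEdge p.1 p.2 [] ::ₘ links l := rfl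
    rw [this, edgeCount_cons, ih hl]
    simp only [mEdge, List.mem_cons, List.not_mem_nil, or_false, List.map_cons, List.count_append,
      List.count_cons, beq_iff_eq]
    by_cases h1 : x = p.1
    · rw [if_pos (.inl h1), if_pos h1.symm, if_neg fun h2 => hp (h1.symm.trans h2.symm)]
      omega
    · by_cases h2 : x = p.2
      · rw [if_pos (.inr h2), if_neg fun h => h1 h.symm, if_pos h2.symm]
        omega
      · rw [if_neg (by tauto), if_neg fun h => h1 h.symm, if_neg fun h => h2 h.symm]
        omega

theorem edgeCount_substGraph {dom : List 𝒩} {σ : 𝒩 → 𝒩} (h : ∀ x ∈ dom, x ∉ dom.map σ) (x : 𝒩) :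
    edgeCount (substGraph dom σ) x = if x ∈ dom ∨ x ∈ dom.map σ then 1 else 0 := by
  rw [edgeCount, substGraph_eq, Multiset.coe_countP, List.countP_map]
  have : ∀ r ∈ (dom.map σ).dedup,
      ((fun e : Edge Label 𝒩 => decide (x ∈ e.att)) ∘ router dom σ) r = true ↔
        (r == if x ∈ dom then σ x else x) = true := by
    intro r hr
    rw [List.mem_dedup] at hr
    simp only [Function.comp_apply, decide_eq_true_eq, router_att, List.mem_cons,
      List.mem_filter, beq_iff_eq]
    by_cases hx : x ∈ dom
    · rw [if_pos hx]
      refine ⟨fun h' => h'.elim (fun h' => (h x hx (h' ▸ hr)).elim) fun h' => h'.2.symm,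
        fun h' => .inr ⟨hx, h'.symm⟩⟩
    · rw [if_neg hx]
      exact ⟨fun h' => h'.elim Eq.symm fun h' => (hx h'.1).elim, fun h' => .inl h'.symm⟩
  rw [List.countP_congr this]
  change List.count _ _ = _
  rw [(List.nodup_dedup _).count]
  refine if_congr (List.mem_dedup.trans ?_) rfl rfl
  by_cases hx : x ∈ dom
  · simp only [hx, if_true, true_or, iff_true]
    exact List.mem_map_of_mem hx
  · simp [hx]

theorem linked_substGraph {dom : List 𝒩} {σ : 𝒩 → 𝒩} {x : 𝒩} (hx : x ∈ dom) :
    Linked (substGraph dom σ) x (σ x) :=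
  ⟨router dom σ (σ x), mem_substGraph.2 ⟨x, hx, rfl⟩, by simp [router_att, hx],
    by simp [router_att]⟩

theorem substGraph_label {dom : List 𝒩} {σ : 𝒩 → 𝒩} {e : Edge Label 𝒩}
    (he : e ∈ substGraph dom σ) : ∃ i, e.label = .m i := by
  obtain ⟨y, hy, rfl⟩ := mem_substGraph.1 he
  obtain ⟨z, zs, -, h⟩ := router_eq_mEdge (List.mem_map_of_mem (f := σ) hy)
  exact ⟨zs.length, by rw [h]; rfl⟩

set_option maxHeartbeats 800000 in
/-- The graph that arises from a normal form by a reduction step: the linear agents of `Sr` do not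
take part in it, `C` is the continuation, whose names `z` are renamed to `ξ z` before it is brought
into the normal form `(vk)(Sk σk)`, the pairs `L` are the equations that are implemented by the
step, and `Cl` are the remaining names of the agents that take part in the step. It consists of a
translation of the reduct and amoeboids. -/
theorem exists_translation_equalUpTo [Nonempty 𝒩] {P' : Agent 𝒩 Empty} {v w : List 𝒩}
    {σ : 𝒩 → 𝒩} {Sr : List (Seq 𝒩)} {L : List (𝒩 × 𝒩)} {C : Agent 𝒩 Empty} {Cl : List 𝒩}
    (hv : v.Nodup) (hwn : w.Nodup) (hwv : ∀ x ∈ w, x ∉ v) (hσ : ∀ x ∈ w, σ x ∈ v)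
    (hσ' : ∀ y ∈ v, y ∈ w.map σ)
    (hw : w.Perm (fnarray Sr ++ (L.map Prod.fst ++ L.map Prod.snd ++ C.occ ++ Cl)))
    (hP' : ∀ τ, IsSubstEffect τ (eqRel (L.map (Prod.map σ σ))) →
      (Agent.scopes v ((Agent.par (body Sr σ) (C.map σ)).map τ)).Cong P')
    (ξ : Equiv.Perm 𝒩) (hξ : ∀ z ∈ C.occ, ξ z ∉ v ∧ ξ z ∉ w) {A : Finset 𝒩} {vk : List 𝒩}
    {Sk : List (Seq 𝒩)} {σk : 𝒩 → 𝒩} (hN : IsFreshNormalForm (C.map ξ) A vk Sk σk)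
    (hA : ∀ x ∈ v ++ w, x ∈ A) (J : Judgement Label 𝒩)
    (hJ : J.G = procs (Sr ++ Sk) + (substGraph w σ + substGraph (fnarray Sk) σk +
      (nEdges v + links L + links (C.occ.map fun z => (ξ z, z)) + nEdges Cl + nEdges vk))) :
    ∃ (v' w' : List 𝒩) (J' : Judgement Label 𝒩), IsTranslation P' v' w' J' ∧ EqualUpTo J J' := by
  classical
  obtain ⟨τ, hτ⟩ := exists_isSubstEffect (eqRel (L.map (Prod.map σ σ)))
  have hwmem : ∀ x, x ∈ w ↔ x ∈ fnarray Sr ∨ x ∈ L.map Prod.fst ∨ x ∈ L.map Prod.snd ∨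
      x ∈ C.occ ∨ x ∈ Cl := by
    intro x
    rw [hw.mem_iff]
    simp only [List.mem_append, or_assoc]
  have hLw : ∀ p ∈ L, p.1 ∈ w ∧ p.2 ∈ w := fun p hp =>
    ⟨(hwmem _).2 (.inr (.inl (List.mem_map_of_mem hp))),
      (hwmem _).2 (.inr (.inr (.inl (List.mem_map_of_mem hp))))⟩
  have hCw : ∀ z ∈ C.occ, z ∈ w := fun z hz =>
    (hwmem _).2 (.inr (.inr (.inr (.inl hz))))
  have hrw : ∀ x ∈ fnarray Sr, x ∈ w := fun x hx => (hwmem _).2 (.inl hx)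
  have hτv : ∀ x ∈ v, τ x ∈ v := by
    intro x hx
    rcases hτ.eq_or (p := (· ∈ v)) (fun a b hab => by
      obtain ⟨p, hp, h⟩ := List.mem_map.1 hab
      rw [Prod.mk.injEq] at h
      rw [← h.1, ← h.2]
      exact ⟨hσ _ (hLw p hp).1, hσ _ (hLw p hp).2⟩) x with h | h
    · rwa [h]
    · exact h.2
  set wk := fnarray Sk with hwk
  have hknd := List.nodup_append.1 hN.nodup
  have hkfresh : ∀ x ∈ vk ++ wk, x ∉ v ∧ x ∉ w ∧ ∀ z ∈ C.occ, x ≠ ξ z := by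
    refine fun x hx => ⟨fun h => hN.fresh x hx (hA x (List.mem_append_left _ h)),
      fun h => hN.fresh x hx (hA x (List.mem_append_right _ h)), ?_⟩
    rintro z hz rfl
    refine hN.fresh _ hx (hN.occ_subset _ ?_)
    rw [Agent.occ_map]
    exact List.mem_map_of_mem hz
  have hvk : ∀ x ∈ vk, x ∉ v ∧ x ∉ w ∧ (∀ z ∈ C.occ, x ≠ ξ z) ∧ x ∉ wk := fun x hx =>
    ⟨(hkfresh x (List.mem_append_left _ hx)).1, (hkfresh x (List.mem_append_left _ hx)).2.1,
      (hkfresh x (List.mem_append_left _ hx)).2.2, fun h => hknd.2.2 x hx x h rfl⟩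
  have hwk' : ∀ x ∈ wk, x ∉ v ∧ x ∉ w ∧ (∀ z ∈ C.occ, x ≠ ξ z) ∧ x ∉ vk := fun x hx =>
    ⟨(hkfresh x (List.mem_append_right _ hx)).1, (hkfresh x (List.mem_append_right _ hx)).2.1,
      (hkfresh x (List.mem_append_right _ hx)).2.2, fun h => hknd.2.2 x h x hx rfl⟩
  have hσk : ∀ y, y ∈ wk.map σk ↔ y ∈ vk ∨ ∃ z ∈ C.occ, ξ z = y := by
    intro y
    rw [hN.mem_map_iff, Agent.occ_map, List.mem_map]
  -- each node belongs to the amoeboid of its image under `cl`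
  obtain ⟨cl, clv, clw, clvk, clξ, clwk⟩ : ∃ cl : 𝒩 → 𝒩, (∀ x ∈ v, cl x = τ x) ∧
      (∀ x ∈ w, cl x = τ (σ x)) ∧ (∀ x ∈ vk, cl x = x) ∧
      (∀ z ∈ C.occ, cl (ξ z) = τ (σ z)) ∧ ∀ x ∈ wk, cl x = cl (σk x) := by
    let κ : 𝒩 → 𝒩 := fun x => if x ∈ v then τ x else if x ∈ w then τ (σ x) else
      if x ∈ vk then x else τ (σ (ξ.symm x))
    have hκ : ∀ x, x ∉ wk → (if x ∈ wk then κ (σk x) else κ x) = κ x := fun x hx => if_neg hx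
    refine ⟨fun x => if x ∈ wk then κ (σk x) else κ x, fun x hx => ?_, fun x hx => ?_,
      fun x hx => ?_, fun z hz => ?_, fun x hx => ?_⟩
    · exact (hκ x fun h => (hwk' x h).1 hx).trans (if_pos hx)
    · refine (hκ x fun h => (hwk' x h).2.1 hx).trans ?_
      exact (if_neg (hwv x hx)).trans (if_pos hx)
    · refine (hκ x (hvk x hx).2.2.2).trans ?_
      exact (if_neg (hvk x hx).1).trans ((if_neg (hvk x hx).2.1).trans (if_pos hx))
    · refine (hκ _ fun h => (hwk' _ h).2.2.1 z hz rfl).trans ?_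
      refine (if_neg (hξ z hz).1).trans ((if_neg (hξ z hz).2).trans
        ((if_neg fun h => (hvk _ h).2.2.1 z hz rfl).trans ?_))
      rw [Equiv.symm_apply_apply]
    · have : σk x ∉ wk := by
        rcases (hσk _).1 (List.mem_map_of_mem hx) with h | ⟨z, hz, h⟩
        · exact (hvk _ h).2.2.2
        · exact fun h' => (hwk' _ h').2.2.1 z hz h.symm
      exact (if_pos hx).trans (hκ _ this).symm
  have clV : ∀ x ∈ w, cl x ∈ v := fun x hx => clw x hx ▸ hτv _ (hσ x hx)
  have clξV : ∀ z ∈ C.occ, cl (ξ z) ∈ v := fun z hz => clξ z hz ▸ hτv _ (hσ z (hCw z hz))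
  have clK : ∀ y ∈ wk.map σk, cl y ∈ v ∨ cl y ∈ vk := by
    intro y hy
    rcases (hσk y).1 hy with h | ⟨z, hz, rfl⟩
    · exact .inr ((clvk y h).symm ▸ h)
    · exact .inl (clξV z hz)
  set ws := fnarray (Sr ++ Sk) with hws
  have hws' : ws = fnarray Sr ++ wk := fnarray_append _ _
  have hwsmem : ∀ x, x ∈ ws ↔ x ∈ fnarray Sr ∨ x ∈ wk := by
    intro x
    rw [hws', List.mem_append]
  have hvws : ∀ x, x ∈ v ∨ x ∈ vk → x ∉ ws := by
    intro x hx h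
    rcases (hwsmem x).1 h with h | h <;> rcases hx with hx | hx
    · exact hwv x (hrw x h) hx
    · exact (hvk x hx).2.1 (hrw x h)
    · exact (hwk' x h).1 hx
    · exact (hwk' x h).2.2.2 hx
  have clws : ∀ x ∈ ws, cl x ∈ v ∨ cl x ∈ vk := by
    intro x hx
    rcases (hwsmem x).1 hx with hx | hx
    · exact .inl (clV x (hrw x hx))
    · rw [clwk x hx]
      exact clK _ (List.mem_map_of_mem hx)
  -- the normal form of the reduct
  have hcong : (Agent.scopes (ws.map cl).dedup (body (Sr ++ Sk) cl)).Cong P' := by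
    refine .trans ?_ (hP' τ hτ)
    have h1 : (C.map σ).map τ = (C.map ξ).map cl := by
      rw [Agent.map_map, Agent.map_map]
      exact Agent.map_congr _ fun z hz => (clξ z hz).symm
    have h2 : (Agent.scopes vk (body Sk σk)).map cl = Agent.scopes vk (body Sk cl) := by
      rw [Agent.scopes_map, body_map]
      · congr 1
        · conv_rhs => rw [← List.map_id vk]
          exact List.map_congr_left clvk
        · exact body_congr fun x hx => (clwk x hx).symm
      · intro x hx y hy hxy
        rw [occ_body] at hy
        rw [clvk x hx] at hxy
        rcases (hσk y).1 hy with h | ⟨z, hz, rfl⟩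
        · rwa [clvk y h] at hxy
        · exact ((hvk x hx).1 (hxy ▸ clξV z hz)).elim
    have h3 : ((C.map σ).map τ).Cong (Agent.scopes vk (body Sk cl)) := by
      rw [h1, ← h2]
      exact (hN.cong.map cl).symm
    have h4 : (body Sr σ).map τ = body Sr cl := by
      rw [body_map]
      exact body_congr fun x hx => (clw x (hrw x hx)).symm
    have h5 : ((Agent.par (body Sr σ) (C.map σ)).map τ).Cong
        (Agent.scopes vk (body (Sr ++ Sk) cl)) := by
      change (Agent.par ((body Sr σ).map τ) ((C.map σ).map τ)).Cong _
      rw [h4]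
      refine (Agent.Cong.par (.refl _) h3).trans ((Agent.par_scopes_cong ?_).trans
        ((body_append_cong Sr Sk cl).symm.scopes vk))
      intro x hx h
      rw [occ_body] at h
      obtain ⟨y, hy, rfl⟩ := List.mem_map.1 h
      exact (hvk _ hx).1 (clV y (hrw y hy))
    refine .trans ?_ (h5.scopes v).symm
    rw [← Agent.scopes_append]
    refine Agent.scopes_cong_of_mem_iff fun x hx => ?_
    rw [occ_body] at hx
    refine iff_of_true (List.mem_dedup.2 hx) (List.mem_append.2 ?_)
    obtain ⟨y, hy, rfl⟩ := List.mem_map.1 hx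
    exact clws y hy
  have hwsnd : ws.Nodup := by
    rw [hws']
    refine List.nodup_append.2 ⟨(List.nodup_append.1 (hw.nodup_iff.1 hwn)).1, hknd.2.1, ?_⟩
    rintro x hx _ hy rfl
    exact (hwk' x hy).2.1 (hrw x hx)
  have hNF : IsNormalForm P' (ws.map cl).dedup (Sr ++ Sk) cl :=
    { cong := hcong
      nodup := List.nodup_dedup _
      occurs := fun x hx => List.mem_dedup.1 hx
      linear := hwsnd
      fresh := by
        intro x hx h
        obtain ⟨y, hy, rfl⟩ := List.mem_map.1 h
        exact hvws _ (clws y hy) hx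
      free := fun x hx h => (h (List.mem_dedup.2 hx)).elim }
  let J' : Judgement Label 𝒩 := ⟨(freeNames (ws.map cl).dedup (Sr ++ Sk) cl ++
      (ws.map cl).dedup ++ ws).toFinset,
    procs (Sr ++ Sk) + substGraph ws cl + nEdges (ws.map cl).dedup, by
      intro x hx
      simp only [Graph.names_add, Finset.mem_union, mem_names_procs, mem_names_substGraph,
        mem_names_nEdges] at hx
      simp only [List.mem_toFinset, List.mem_append, List.mem_dedup] at hx ⊢
      clear * - hx
      tauto⟩
  have hfree : freeNames (ws.map cl).dedup (Sr ++ Sk) cl = [] := by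
    simp only [freeNames, List.filter_eq_nil_iff, decide_eq_true_eq, not_not, List.mem_dedup]
    exact fun x hx => hx
  have hJ't : IsTranslation P' (ws.map cl).dedup ws J' := by
    refine ⟨_, Sr ++ Sk, cl, hNF, rfl, rfl, ?_, ?_, rfl, (translGraph_self _ _ _).symm⟩
    · rw [hfree]; exact List.disjoint_nil_left _
    · refine List.nodup_append.2 ⟨List.nodup_dedup _, hwsnd, ?_⟩
      rintro x hx _ hy rfl
      exact hNF.fresh x hy (List.mem_dedup.1 hx)
  refine ⟨_, _, J', hJ't, ?_⟩
  -- the two matchings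
  set MA := substGraph w σ + substGraph wk σk with hMA
  set MB := nEdges v + links L + links (C.occ.map fun z => (ξ z, z)) + nEdges Cl + nEdges vk
    with hMB
  let lB : List 𝒩 := v ++ (L.map Prod.fst ++ L.map Prod.snd) ++ (C.occ.map ξ ++ C.occ) ++ Cl ++ vk
  have hCξ : (C.occ.map fun z => (ξ z, z)).map Prod.fst ++
      (C.occ.map fun z => (ξ z, z)).map Prod.snd = C.occ.map ξ ++ C.occ := by
    simp [Function.comp_def]
  have hdead := List.nodup_append.1 (hw.nodup_iff.1 hwn)
  have hlB : lB.Nodup := by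
    have hperm : lB.Perm ((v ++ (L.map Prod.fst ++ L.map Prod.snd ++ C.occ ++ Cl)) ++
        (C.occ.map ξ ++ vk)) := by
      rw [List.perm_iff_count]
      intro x
      simp only [lB, List.count_append]
      omega
    refine hperm.nodup_iff.2 (List.nodup_append.2 ⟨List.nodup_append.2 ⟨hv, hdead.2.1, ?_⟩,
      List.nodup_append.2 ⟨?_, hknd.1, ?_⟩, ?_⟩)
    · rintro x hx _ hy rfl
      exact hwv x (hw.mem_iff.2 (List.mem_append_right _ hy)) hx
    · exact (List.nodup_append.1 (List.nodup_append.1 hdead.2.1).1).2.1.map ξ.injective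
    · rintro x hx _ hy rfl
      obtain ⟨z, hz, rfl⟩ := List.mem_map.1 hx
      exact (hvk _ hy).2.2.1 z hz rfl
    · rintro x hx _ hy rfl
      have hx : x ∈ v ∨ x ∈ w := (List.mem_append.1 hx).imp id fun h =>
        hw.mem_iff.2 (List.mem_append_right _ h)
      rcases List.mem_append.1 hy with hy | hy
      · obtain ⟨z, hz, rfl⟩ := List.mem_map.1 hy
        exact hx.elim (hξ z hz).1 (hξ z hz).2
      · exact hx.elim (hvk x hy).1 (hvk x hy).2.1
  have hBcount : ∀ x, edgeCount MB x = lB.count x := by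
    intro x
    have h1 : (L.map Prod.fst ++ L.map Prod.snd).Nodup :=
      hlB.sublist (((((List.sublist_append_right v _).trans (List.sublist_append_left _ _)).trans
        (List.sublist_append_left _ _)).trans (List.sublist_append_left _ _)))
    have h2 : (C.occ.map ξ ++ C.occ).Nodup :=
      hlB.sublist ((((List.sublist_append_right _ _).trans
        (List.sublist_append_left _ _)).trans (List.sublist_append_left _ _)))
    rw [hMB, edgeCount_add, edgeCount_add, edgeCount_add, edgeCount_add, edgeCount_nEdges,
      edgeCount_nEdges, edgeCount_nEdges, edgeCount_links h1, edgeCount_links (hCξ ▸ h2), hCξ]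
    simp only [lB, List.count_append]
  have hlBmem : ∀ x, x ∈ lB ↔ x ∈ v ∨ x ∈ vk ∨ (∃ z ∈ C.occ, ξ z = x) ∨ x ∈ L.map Prod.fst ∨
      x ∈ L.map Prod.snd ∨ x ∈ C.occ ∨ x ∈ Cl := by
    intro x
    simp only [lB, List.mem_append, List.mem_map (l := C.occ)]
    generalize (∃ z ∈ C.occ, ξ z = x) = q
    clear * -
    tauto
  have hAcount : ∀ x, edgeCount MA x = (if x ∈ w ∨ x ∈ w.map σ then 1 else 0) +
      if x ∈ wk ∨ x ∈ wk.map σk then 1 else 0 := by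
    intro x
    rw [hMA, edgeCount_add, edgeCount_substGraph, edgeCount_substGraph]
    · intro y hy h
      rcases (hσk y).1 h with h | ⟨z, hz, h⟩
      · exact (hwk' y hy).2.2.2 h
      · exact (hwk' y hy).2.2.1 z hz h.symm
    · intro y hy h
      obtain ⟨z, hz, rfl⟩ := List.mem_map.1 h
      exact hwv _ hy (hσ z hz)
  have hnames : ∀ x, x ∈ Graph.names (MA + MB) ↔
      x ∈ v ∨ x ∈ w ∨ x ∈ vk ∨ x ∈ wk ∨ ∃ z ∈ C.occ, ξ z = x := by
    intro x
    have h1 : x ∈ w.map σ → x ∈ v := by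
      intro h
      obtain ⟨z, hz, rfl⟩ := List.mem_map.1 h
      exact hσ z hz
    have h2 := hwmem x
    have h3 : x ∈ C.occ.map (Prod.fst ∘ fun z => (ξ z, z)) ↔ ∃ z ∈ C.occ, ξ z = x := by simp
    have h4 : C.occ.map (Prod.snd ∘ fun z => (ξ z, z)) = C.occ := by simp [Function.comp_def]
    simp only [hMA, hMB, Graph.names_add, Finset.mem_union, mem_names_substGraph,
      mem_names_nEdges, mem_names_links, hσk, List.map_map, h3, h4]
    generalize (∃ z ∈ C.occ, ξ z = x) = q
    clear * - h1 h2
    tauto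
  have hAone : ∀ x ∈ Graph.names (MA + MB), edgeCount MA x = 1 := by
    intro x hx
    rw [hAcount]
    have h1 : (x ∈ w ∨ x ∈ w.map σ) ↔ x ∈ w ∨ x ∈ v := by
      refine or_congr Iff.rfl ⟨fun h => ?_, hσ' x⟩
      obtain ⟨z, hz, rfl⟩ := List.mem_map.1 h
      exact hσ z hz
    rw [if_congr h1 rfl rfl, if_congr (or_congr_right (hσk x)) rfl rfl]
    rcases (hnames x).1 hx with hx | hx | hx | hx | ⟨z, hz, rfl⟩
    · rw [if_pos (.inr hx), if_neg]
      rintro (h | h | ⟨z, hz, rfl⟩)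
      · exact (hwk' x h).1 hx
      · exact (hvk x h).1 hx
      · exact (hξ z hz).1 hx
    · rw [if_pos (.inl hx), if_neg]
      rintro (h | h | ⟨z, hz, rfl⟩)
      · exact (hwk' x h).2.1 hx
      · exact (hvk x h).2.1 hx
      · exact (hξ z hz).2 hx
    · rw [if_neg (not_or.2 ⟨(hvk x hx).2.1, (hvk x hx).1⟩), if_pos (.inr (.inl hx))]
    · rw [if_neg (not_or.2 ⟨(hwk' x hx).2.1, (hwk' x hx).1⟩), if_pos (.inl hx)]
    · rw [if_neg (not_or.2 ⟨(hξ z hz).2, (hξ z hz).1⟩), if_pos (.inr (.inr ⟨z, hz, rfl⟩))]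
  have hmemA : ∀ {x}, 0 < edgeCount MA x → x ∈ Graph.names (MA + MB) := by
    intro x h
    obtain ⟨e, he, hx⟩ := Multiset.countP_pos.1 h
    exact Graph.mem_names.2 ⟨e, Multiset.mem_add.2 (.inl he), hx⟩
  have hcl : ∀ e ∈ MA + MB, ∃ r, ∀ x ∈ e.att, cl x = r := by
    intro e he
    simp only [hMA, hMB, Multiset.mem_add, nEdges, links, Multiset.mem_coe, List.mem_map] at he
    rcases he with (he | he) | ((((⟨x, -, rfl⟩ | ⟨p, hp, rfl⟩) | ⟨p, hp, rfl⟩) | ⟨x, -, rfl⟩) |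
      ⟨x, -, rfl⟩)
    · obtain ⟨y, hy, rfl⟩ := mem_substGraph.1 he
      refine ⟨τ (σ y), fun x hx => ?_⟩
      simp only [router_att, List.mem_cons, List.mem_filter, decide_eq_true_eq] at hx
      rcases hx with rfl | ⟨hx, hxy⟩
      · exact clv _ (hσ y hy)
      · rw [clw x hx, hxy]
    · obtain ⟨y, hy, rfl⟩ := mem_substGraph.1 he
      refine ⟨cl (σk y), fun x hx => ?_⟩
      simp only [router_att, List.mem_cons, List.mem_filter, decide_eq_true_eq] at hx
      rcases hx with rfl | ⟨hx, hxy⟩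
      · rfl
      · rw [clwk x hx, hxy]
    · exact ⟨cl x, by simp [nEdge]⟩
    · refine ⟨τ (σ p.1), ?_⟩
      have : τ (σ p.1) = τ (σ p.2) := (hτ.2 _ _).2
        (.rel _ _ (List.mem_map_of_mem (f := Prod.map σ σ) hp))
      simp only [mEdge, List.mem_cons, List.not_mem_nil, or_false, forall_eq_or_imp, forall_eq]
      exact ⟨clw _ (hLw p hp).1, this ▸ clw _ (hLw p hp).2⟩
    · obtain ⟨z, hz, rfl⟩ := hp
      refine ⟨τ (σ z), ?_⟩
      simp only [mEdge, List.mem_cons, List.not_mem_nil, or_false, forall_eq_or_imp, forall_eq]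
      exact ⟨clξ z hz, clw z (hCw z hz)⟩
    · exact ⟨cl x, by simp [nEdge]⟩
    · exact ⟨cl x, by simp [nEdge]⟩
  have hclV : ∀ x ∈ Graph.names (MA + MB), cl x ∈ v ∧ τ (cl x) = cl x ∨ cl x ∈ vk := by
    have h1 : ∀ x ∈ w, cl x ∈ v ∧ τ (cl x) = cl x := fun x hx =>
      ⟨clV x hx, by rw [clw x hx, hτ.1]⟩
    have h2 : ∀ z ∈ C.occ, cl (ξ z) ∈ v ∧ τ (cl (ξ z)) = cl (ξ z) := fun z hz =>
      ⟨clξV z hz, by rw [clξ z hz, hτ.1]⟩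
    intro x hx
    rcases (hnames x).1 hx with hx | hx | hx | hx | ⟨z, hz, rfl⟩
    · exact .inl (clv x hx ▸ ⟨hτv x hx, hτ.1 x⟩)
    · exact .inl (h1 x hx)
    · exact .inr ((clvk x hx).symm ▸ hx)
    · rw [clwk x hx]
      rcases (hσk _).1 (List.mem_map_of_mem hx) with h | ⟨z, hz, h⟩
      · exact .inr ((clvk _ h).symm ▸ h)
      · rw [← h]
        exact .inl (h2 z hz)
    · exact .inl (h2 z hz)
  have hn : ∀ {x}, x ∈ v ∨ x ∈ vk → nEdge x ∈ MB := by
    intro x hx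
    simp only [hMB, Multiset.mem_add]
    rcases hx with hx | hx
    · exact .inl (.inl (.inl (.inl (Multiset.mem_coe.2 (List.mem_map_of_mem hx)))))
    · exact .inr (Multiset.mem_coe.2 (List.mem_map_of_mem hx))
  have hlink : ∀ {N : Graph Label 𝒩} {x y}, Linked N x y → N ≤ MA + MB →
      Relation.EqvGen (Linked (MA + MB)) x y := fun h hle => .rel _ _ (h.mono hle)
  have hrw : ∀ x ∈ w, Relation.EqvGen (Linked (MA + MB)) x (σ x) := fun x hx =>
    hlink (linked_substGraph hx) ((Multiset.le_add_right _ _).trans (Multiset.le_add_right _ _))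
  have hrv : ∀ x, Relation.EqvGen (Linked (MA + MB)) x (τ x) := by
    intro x
    refine eqvGen_imp id ?_ (hτ.eqvGen_apply x)
    rintro a b hab
    obtain ⟨p, hp, h⟩ := List.mem_map.1 hab
    rw [Prod.mk.injEq] at h
    rw [← h.1, ← h.2]
    refine (hrw _ (hLw p hp).1).symm.trans _ _ _ (.trans _ _ _ (hlink (linked_links hp) ?_)
      (hrw _ (hLw p hp).2))
    refine le_trans ?_ (Multiset.le_add_left _ _)
    exact (Multiset.le_add_left _ _).trans ((Multiset.le_add_right _ _).trans
      ((Multiset.le_add_right _ _).trans (Multiset.le_add_right _ _)))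
  have hrξ : ∀ z ∈ C.occ, Relation.EqvGen (Linked (MA + MB)) (ξ z) (τ (σ z)) := by
    intro z hz
    refine .trans _ _ _ (hlink (linked_links (l := C.occ.map fun z => (ξ z, z)) (p := (ξ z, z))
      (List.mem_map_of_mem (f := fun z => (ξ z, z)) hz)) ?_)
      (.trans _ _ _ (hrw z (hCw z hz)) (hrv _))
    refine le_trans ?_ (Multiset.le_add_left _ _)
    exact (Multiset.le_add_left _ _).trans
      ((Multiset.le_add_right _ _).trans (Multiset.le_add_right _ _))
  refine equalUpTo_of_matchings (A := MA) (B := MB) (ws := ws) (cl := cl) hJ rfl ?_ ?_ ?_ hAone ?_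
    ?_ ?_ ?_ ?_ ?_ ?_ ?_ ?_
  · exact fun x hx => mem_names_procs.1 hx
  · intro e he
    simp only [hMA, hMB, Multiset.mem_add, nEdges, links, Multiset.mem_coe, List.mem_map] at he
    rcases he with (he | he) | ((((⟨x, -, rfl⟩ | ⟨p, -, rfl⟩) | ⟨p, -, rfl⟩) | ⟨x, -, rfl⟩) |
      ⟨x, -, rfl⟩)
    · exact .inr (substGraph_label he)
    · exact .inr (substGraph_label he)
    · exact .inl rfl
    · exact .inr ⟨0, rfl⟩
    · exact .inr ⟨0, rfl⟩
    · exact .inl rfl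
    · exact .inl rfl
  · intro x
    by_cases h : 0 < edgeCount MA x
    · exact (hAone x (hmemA h)).le
    · omega
  · intro x
    rw [hBcount]
    exact List.nodup_iff_count_le_one.1 hlB x
  · intro x hx
    rw [hBcount, List.count_eq_zero, hlBmem]
    rcases (hwsmem x).1 hx with hx | hx
    · have hxw := (hwmem x).2 (.inl hx)
      have hd := fun h => hdead.2.2 x hx x h rfl
      simp only [List.mem_append] at hd
      rintro (h | h | ⟨z, hz, rfl⟩ | h | h | h | h)
      · exact hwv x hxw h
      · exact (hvk x h).2.1 hxw
      · exact (hξ z hz).2 hxw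
      all_goals exact hd (by clear * - h; tauto)
    · have h' := hwk' x hx
      rintro (h | h | ⟨z, hz, rfl⟩ | h)
      · exact h'.1 h
      · exact h'.2.2.2 h
      · exact h'.2.2.1 z hz rfl
      · exact h'.2.1 ((hwmem x).2 (.inr h))
  · intro x hx hxws
    rw [hBcount]
    refine List.count_eq_one_of_mem hlB ((hlBmem x).2 ?_)
    rw [hwsmem] at hxws
    have := (hnames x).1 hx
    rw [hwmem] at this
    generalize (∃ z ∈ C.occ, ξ z = x) = q at this ⊢
    clear * - this hxws
    tauto
  · intro x hx
    rw [hnames]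
    rcases (hwsmem x).1 hx with hx | hx
    · exact .inr (.inl ((hwmem x).2 (.inl hx)))
    · exact .inr (.inr (.inr (.inl hx)))
  · intro e he x hx y hy
    obtain ⟨r, hr⟩ := hcl e he
    rw [hr x hx, hr y hy]
  · exact fun x hx => hn ((hclV x hx).imp And.left id)
  · intro x hx
    rcases hclV x hx with h | h
    · rw [clv _ h.1, h.2]
    · exact clvk _ h
  · exact fun x hx => hvws _ ((hclV x hx).imp And.left id)
  · intro x hx
    rcases (hnames x).1 hx with hx | hx | hx | hx | ⟨z, hz, rfl⟩
    · rw [clv x hx]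
      exact hrv x
    · rw [clw x hx]
      exact (hrw x hx).trans _ _ _ (hrv _)
    · rw [clvk x hx]
      exact .refl _
    · refine .trans _ _ _ (hlink (linked_substGraph hx)
        ((Multiset.le_add_left _ _).trans (Multiset.le_add_right _ _))) ?_
      rw [clwk x hx]
      rcases (hσk _).1 (List.mem_map_of_mem hx) with h | ⟨z, hz, h⟩
      · rw [clvk _ h]
        exact .refl _
      · rw [← h, clξ z hz]
        exact hrξ z hz
    · rw [clξ z hz]
      exact hrξ z hz

end


/-! ### Reduction steps of normal forms as transitions -/

section

variable {𝒩 : Type}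

theorem guarded_cont_of_body {Ss : List (Seq 𝒩)} {σ : 𝒩 → 𝒩} (h : (body Ss σ).Guarded)
    {T : Seq 𝒩} (hT : T ∈ Ss) (i : Fin T.n) : (T.cont i).Guarded := by
  have h1 := (Agent.guarded_parAll _).1 h _ (List.mem_map_of_mem (f := fun S => (S.map σ).toAgent) hT)
  exact (Agent.guarded_map _ σ).1 (h1 i)

variable [DecidableEq 𝒩]

theorem Seq.sublist_occ {ν : Type} (T : Seq ν) (i : Fin T.n) :
    ((T.pre i).occ ++ (T.cont i).occ).Sublist T.occ := by
  have : T.occ = ((List.finRange T.n).map fun i => (T.pre i).occ ++ (T.cont i).occ).flatten := by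
    rw [← List.flatMap_def]
    rfl
  rw [this]
  exact List.sublist_flatten_of_mem (List.mem_map_of_mem
    (f := fun i => (T.pre i).occ ++ (T.cont i).occ) (List.mem_finRange i))

/-- The names of a sequential agent `T` are divided into those that take part in the prefix (they
are objects or are fused), those of the continuation, and the closed ones. -/
theorem perm_closedNodes {T : Seq 𝒩} (hT : T.occ.Nodup) (i : Fin T.n)
    {Λ : 𝒩 → Act × List 𝒩} {π : 𝒩 → 𝒩} {M : List 𝒩} (hM : M.Sublist (T.pre i).occ)
    (h : ∀ x, x ∈ M ↔ (∃ y, x ∈ (Λ y).2) ∨ ∃ y, y ≠ x ∧ π x = π y) :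
    T.occ.Perm (M ++ (T.cont i).occ ++ closedNodes T.occ Λ π (T.cont i)) := by
  have hnd : (M ++ (T.cont i).occ).Nodup :=
    hT.sublist ((hM.append_right _).trans (T.sublist_occ i))
  refine (List.perm_ext_iff_of_nodup hT ?_).2 fun x => ?_
  · refine List.nodup_append.2 ⟨hnd, hT.filter _, ?_⟩
    rintro x hx _ hy rfl
    obtain ⟨-, h1, h2, h3⟩ := mem_closedNodes.1 hy
    rcases List.mem_append.1 hx with hx | hx
    · exact ((h x).1 hx).elim h1 h2
    · exact h3 hx
  · rw [List.mem_append, List.mem_append, mem_closedNodes, h]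
    constructor
    · intro hx
      by_cases h1 : ∃ y, x ∈ (Λ y).2
      · exact .inl (.inl (.inl h1))
      by_cases h2 : ∃ y, y ≠ x ∧ π x = π y
      · exact .inl (.inl (.inr h2))
      by_cases h3 : x ∈ (T.cont i).occ
      · exact .inl (.inr h3)
      · exact .inr ⟨hx, h1, h2, h3⟩
    · rintro ((hx | hx) | hx)
      · exact T.occ_pre_subset i (hM.subset ((h x).2 hx))
      · exact T.occ_cont_subset i hx
      · exact hx.1

theorem fusion_occ_perm {ν : Type} (E : List (ν × ν)) :
    (Prefix.fusion E).occ.Perm (E.map Prod.fst ++ E.map Prod.snd) := by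
  induction E with
  | nil => exact .refl _
  | cons p E ih =>
    change (p.1 :: p.2 :: (Prefix.fusion E).occ).Perm _
    refine .cons _ ((List.Perm.cons _ ih).trans ?_)
    exact List.perm_middle.symm

/-- A canonical translation of a closed agent can perform each fusion of its normal form. -/
theorem exists_fuse_transition [Infinite 𝒩] {P' : Agent 𝒩 Empty} {v : List 𝒩}
    {Sr Ss : List (Seq 𝒩)} {T : Seq 𝒩} {σ : 𝒩 → 𝒩} {J : Judgement Label 𝒩} (hv : v.Nodup)
    (hwn : (fnarray Ss).Nodup) (hwv : ∀ x ∈ fnarray Ss, x ∉ v) (hσ : ∀ x ∈ fnarray Ss, σ x ∈ v)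
    (hσ' : ∀ y ∈ v, y ∈ (fnarray Ss).map σ) (hg : (body Ss σ).Guarded)
    (hΓ : J.Γ = (v ++ fnarray Ss).toFinset)
    (hG : J.G = procs Ss + substGraph (fnarray Ss) σ + nEdges v) (hperm : (Sr ++ [T]).Perm Ss)
    (i : Fin T.n) {E : List (𝒩 × 𝒩)} (hi : T.pre i = .fusion E)
    (hP' : ∀ τ, IsSubstEffect τ (eqRel (E.map (Prod.map σ σ))) →
      (Agent.scopes v ((Agent.par (body Sr σ) ((T.cont i).map σ)).map τ)).Cong P') :
    ∃ t : Transition Label Act 𝒩, Derives (productions 𝒩) t ∧ t.src = J ∧ t.π = id ∧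
      ∃ (v' w' : List 𝒩) (J' : Judgement Label 𝒩),
        IsTranslation P' v' w' J' ∧ EqualUpTo t.tgt J' := by
  set w := fnarray Ss with hw
  have hwperm : w.Perm (fnarray Sr ++ T.occ) := by
    refine (hperm.flatMap_right Seq.occ).symm.trans (.of_eq ?_)
    rw [List.flatMap_append, List.flatMap_singleton]
    rfl
  have hTw : ∀ x ∈ T.occ, x ∈ w := fun x hx => hwperm.mem_iff.2 (List.mem_append_right _ hx)
  have hrw : ∀ x ∈ fnarray Sr, x ∈ w := fun x hx => hwperm.mem_iff.2 (List.mem_append_left _ hx)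
  have hT : T.occ.Nodup := (List.nodup_append.1 (hwperm.nodup_iff.1 hwn)).2.1
  have hsub := T.sublist_occ i
  rw [hi] at hsub
  have hE : (E.map Prod.fst ++ E.map Prod.snd).Nodup := (fusion_occ_perm E).nodup_iff.1
    (hT.sublist ((List.sublist_append_left _ _).trans hsub))
  have hE' := List.nodup_append.1 hE
  have hC : (T.cont i).occ.Nodup := hT.sublist ((List.sublist_append_right _ _).trans hsub)
  obtain ⟨ξ, -, hξ, -⟩ := exists_copy (v ++ w).toFinset (v ++ w).toFinset (v ++ w).toFinset
  simp only [List.mem_toFinset] at hξ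
  have hξw : ∀ z ∈ w, ξ z ∉ v ∧ ξ z ∉ w := fun z hz => by
    have := hξ z (List.mem_append_right _ hz) (List.mem_append_right _ hz)
    rwa [List.mem_append, not_or] at this
  let A : Finset 𝒩 := (v ++ w ++ w.map ξ).toFinset
  have hAmem : ∀ x, x ∈ A ↔ (x ∈ v ∨ x ∈ w) ∨ x ∈ w.map ξ := by
    intro x
    rw [List.mem_toFinset, List.mem_append, List.mem_append]
  have hgC : ((T.cont i).map ξ).Guarded := (Agent.guarded_map _ _).2
    (guarded_cont_of_body hg (hperm.mem_iff.1 (by simp)) i)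
  obtain ⟨vk, Sk, σk, hN⟩ := exists_isFreshNormalForm hgC (A := A) (by
    intro x hx
    rw [Agent.occ_map] at hx
    obtain ⟨z, hz, rfl⟩ := List.mem_map.1 hx
    exact (hAmem _).2 (.inr (List.mem_map_of_mem (hTw z (T.occ_cont_subset i hz)))))
  -- the representative of each equation is its left-hand side
  set π := vecSubst (E.map Prod.snd) (E.map Prod.fst) with hπdef
  have hElen : (E.map Prod.snd).length = (E.map Prod.fst).length := by simp
  have hEdisj : ∀ x ∈ E.map Prod.snd, x ∉ E.map Prod.fst := fun x hx hx' =>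
    hE'.2.2 x hx' x hx rfl
  have hzip : (E.map Prod.snd).zip (E.map Prod.fst) = E.map Prod.swap := by
    rw [List.zip_map']
    rfl
  have hπE : IsSubstEffect π (eqRel E) := by
    have := isSubstEffect_vecSubst hElen hE'.2.1 hEdisj
    rw [hzip] at this
    refine this.congr fun x y => ⟨eqvGen_imp id fun a b h => ?_, eqvGen_imp id fun a b h => ?_⟩
    · obtain ⟨p, hp, he⟩ := List.mem_map.1 h
      rw [← Prod.mk.eta (p := p), Prod.swap_prod_mk, Prod.mk.injEq] at he
      rw [← he.1, ← he.2]
      exact .symm _ _ (.rel _ _ hp)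
    · exact .symm _ _ (.rel _ _ (List.mem_map_of_mem (f := Prod.swap) h))
  have hπsnd : (E.map Prod.snd).map π = E.map Prod.fst := map_vecSubst hElen hE'.2.1
  have hπself : ∀ x, x ∉ E.map Prod.snd → π x = x := fun x hx => vecSubst_of_notMem hElen hx
  have hπp : ∀ p ∈ E, π p.2 = p.1 := by
    rw [List.map_map] at hπsnd
    exact List.map_inj_left.1 hπsnd
  have hmoved : ∀ x, π x ≠ x ↔ x ∈ E.map Prod.snd := by
    refine fun x => ⟨fun h => by_contra fun h' => h (hπself x h'), fun h h' => ?_⟩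
    refine hEdisj x h ?_
    rw [← h', ← hπsnd]
    exact List.mem_map_of_mem h
  have hEocc : ∀ x, x ∈ (Prefix.fusion E).occ ↔ x ∈ E.map Prod.fst ∨ x ∈ E.map Prod.snd := by
    intro x
    rw [(fusion_occ_perm E).mem_iff, List.mem_append]
  have hfused : ∀ x, x ∈ (Prefix.fusion E).occ ↔
      (∃ y : 𝒩, x ∈ ((fun _ : 𝒩 => ((Act.eps, []) : Act × List 𝒩)) y).2) ∨ ∃ y, y ≠ x ∧ π x = π y := by
    intro x
    simp only [List.not_mem_nil, exists_false, false_or]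
    rw [hEocc]
    constructor
    · rintro (h | h)
      · obtain ⟨p, hp, rfl⟩ := List.mem_map.1 h
        refine ⟨p.2, fun he => hE'.2.2 _ h _ (List.mem_map_of_mem hp) he.symm, ?_⟩
        rw [hπp p hp, hπself _ fun h' => hEdisj _ h' h]
      · refine ⟨π x, (hmoved x).2 h, (hπE.1 x).symm⟩
    · rintro ⟨y, hy, hxy⟩
      by_contra h
      rw [not_or] at h
      rw [hπself x h.2] at hxy
      by_cases h' : y ∈ E.map Prod.snd
      · refine h.1 ?_
        rw [hxy, ← hπsnd]
        exact List.mem_map_of_mem h'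
      · exact hy (hxy.trans (hπself y h')).symm
  have hΛ : PrefixTransl (T.pre i) (fun _ => (Act.eps, [])) π := hi ▸ .fusion E π hπE
  have hTperm := perm_closedNodes hT i (M := (Prefix.fusion E).occ) (hi ▸ .refl _) hfused
  obtain ⟨t₀, ht₀, hπ₀, hΓ₀, hG₀, hΛ₀, hΓ₀', hG₀'⟩ := exists_process_transition hT i hΛ (ξ := ξ)
    (fun x _ y _ h => ξ.injective h) (fun x hx h => (hξw x (hTw x hx)).2 (hTw _ h)) hC hN
    (fun x hx => (hAmem x).2 (.inl (.inr (hTw x hx))))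
  have hlinks : substGraph (T.occ.filter fun x => π x ≠ x) π = links E := by
    have hperm' : (T.occ.filter fun x => π x ≠ x).Perm (E.map Prod.snd) := by
      refine (List.perm_ext_iff_of_nodup (hT.filter _) hE'.2.1).2 fun x => ?_
      rw [List.mem_filter, decide_eq_true_eq, hmoved]
      refine and_iff_right_of_imp fun h => hsub.subset (List.mem_append_left _ ?_)
      exact (hEocc x).2 (.inr h)
    rw [substGraph_of_injOn (hT.filter _)]
    · have h1 := hperm'.map fun x => (π x, x)
      have h2 : (E.map Prod.snd).map (fun x => (π x, x)) = E := by
        rw [List.map_map]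
        conv_rhs => rw [← List.map_id E]
        exact List.map_congr_left fun p hp => Prod.ext (hπp p hp) rfl
      rw [h2] at h1
      exact Multiset.coe_eq_coe.2 (h1.map _)
    · intro x hx y hy
      exact List.inj_on_of_nodup_map (hπsnd ▸ hE'.1) (hperm'.mem_iff.1 hx) (hperm'.mem_iff.1 hy)
  let K : Judgement Label 𝒩 := ⟨(v ++ w).toFinset, procs Sr + substGraph w σ + nEdges v, by
    intro x hx
    simp only [Graph.names_add, Finset.mem_union, mem_names_procs, mem_names_substGraph,
      mem_names_nEdges] at hx
    rw [List.mem_toFinset, List.mem_append]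
    rcases hx with (hx | hx | hx) | hx
    · exact .inr (hrw x hx)
    · exact .inr hx
    · obtain ⟨y, hy, rfl⟩ := List.mem_map.1 hx
      exact .inl (hσ y hy)
    · exact .inl hx⟩
  obtain ⟨t, ht, hπt, hΓt, hGt, hGt'⟩ := ht₀.exists_context hπ₀ K (fun x _ _ => hΛ₀ ▸ rfl) (by
    intro x hx hx'
    rw [hΓ₀, List.mem_toFinset]
    have hx : x ∈ v ∨ x ∈ w := List.mem_append.1 (List.mem_toFinset.1 hx)
    rcases hΓ₀' x hx' with h | h | h
    · exact h
    · exact (hN.fresh x h ((hAmem x).2 (.inl hx))).elim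
    · obtain ⟨z, hz, rfl⟩ := List.mem_map.1 h
      exact (hx.elim (hξw z (hTw z hz)).1 (hξw z (hTw z hz)).2).elim)
  refine ⟨t, ht, Judgement.ext ?_ ?_, hπt, ?_⟩
  · rw [hΓt, hΓ₀, hΓ]
    refine Finset.union_eq_right.2 fun x hx => ?_
    exact List.mem_toFinset.2 (List.mem_append_right _ (hTw x (List.mem_toFinset.1 hx)))
  · rw [hGt, hG₀, hG, ← procs_perm hperm, procs_append]
    change {procEdge T} + (procs Sr + substGraph w σ + nEdges v) =
      procs Sr + {procEdge T} + substGraph w σ + nEdges v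
    abel
  · refine exists_translation_equalUpTo (L := E) (C := T.cont i)
      (Cl := closedNodes T.occ (fun _ => (Act.eps, [])) π (T.cont i)) hv hwn hwv hσ hσ' ?_ hP' ξ
      (fun z hz => hξw z (hTw z (T.occ_cont_subset i hz))) hN
      (fun x hx => (hAmem x).2 (.inl (List.mem_append.1 hx))) _ ?_
    · refine hwperm.trans (.append_left _ (hTperm.trans ?_))
      exact ((fusion_occ_perm E).append_right _).append_right _
    · rw [hGt', hG₀', hlinks, procs_append, contGraph]
      change _ + (procs Sr + substGraph w σ + nEdges v) = _
      abel

end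


section

variable {𝒩 : Type} [DecidableEq 𝒩]

/-- The transition of a sequential agent that exposes an input or an output on `c` with the objects
`xs`. The names of the agent are the objects, those of the continuation, and the names `Cl` (the
subject and the names of the discarded summands), which are closed by `n` edges. -/
theorem exists_input_or_output_transition [Infinite 𝒩] {T : Seq 𝒩} (hT : T.occ.Nodup)
    (i : Fin T.n) {c : 𝒩} {xs : List 𝒩} {a : Act}
    (hi : PrefixTransl (T.pre i) (single c a xs) id) (hpre : (T.pre i).occ = c :: xs)
    {ξ : 𝒩 → 𝒩} (hξ : ∀ x ∈ T.occ, ∀ y ∈ T.occ, ξ x = ξ y → x = y)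
    (hξT : ∀ x ∈ T.occ, ξ x ∉ T.occ) {A : Finset 𝒩} {v : List 𝒩} {Ss : List (Seq 𝒩)} {σ : 𝒩 → 𝒩}
    (hN : IsFreshNormalForm ((T.cont i).map ξ) A v Ss σ) (hTA : ∀ x ∈ T.occ, x ∈ A) :
    ∃ (t : Transition Label Act 𝒩) (Cl : List 𝒩), Derives (productions 𝒩) t ∧ t.π = id ∧
      t.src.Γ = T.occ.toFinset ∧ t.src.G = {procEdge T} ∧ t.Λ = single c a xs ∧
      (∀ x, x ∈ t.tgt.Γ → x ∈ T.occ ∨ x ∈ v ++ fnarray Ss ∨ x ∈ T.occ.map ξ) ∧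
      t.tgt.G = contGraph (T.cont i) ξ v Ss σ + nEdges Cl ∧
      T.occ.Perm (xs ++ (T.cont i).occ ++ Cl) := by
  obtain ⟨t, ht, hπ, hΓ, hG, hΛ, hΓ', hG'⟩ := exists_process_transition hT i hi hξ hξT
    (hT.sublist ((List.sublist_append_right _ _).trans (T.sublist_occ i))) hN hTA
  refine ⟨t, _, ht, hπ, hΓ, hG, hΛ, hΓ', ?_, perm_closedNodes hT i (Λ := single c a xs) (π := id)
    (M := xs) (hpre ▸ List.sublist_cons_self c xs) ?_⟩
  · rw [hG']
    simp [substGraph]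
  · intro x
    constructor
    · exact fun h => .inl ⟨c, by simpa [single] using h⟩
    · rintro (⟨y, hy⟩ | ⟨y, hy, hxy⟩)
      · by_cases h : y = c
        · subst h
          simpa [single] using hy
        · simp [single, Function.update_of_ne h] at hy
      · exact (hy hxy.symm).elim

/-- A canonical translation of a closed agent can perform each communication of its normal form. -/
theorem exists_comm_step_transition [Infinite 𝒩] {P' : Agent 𝒩 Empty} {v : List 𝒩}
    {Sr Ss : List (Seq 𝒩)} {T₁ T₂ : Seq 𝒩} {σ : 𝒩 → 𝒩} {J : Judgement Label 𝒩} (hv : v.Nodup)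
    (hwn : (fnarray Ss).Nodup) (hwv : ∀ x ∈ fnarray Ss, x ∉ v) (hσ : ∀ x ∈ fnarray Ss, σ x ∈ v)
    (hσ' : ∀ y ∈ v, y ∈ (fnarray Ss).map σ) (hg : (body Ss σ).Guarded)
    (hΓ : J.Γ = (v ++ fnarray Ss).toFinset)
    (hG : J.G = procs Ss + substGraph (fnarray Ss) σ + nEdges v)
    (hperm : (Sr ++ [T₁, T₂]).Perm Ss) (i : Fin T₁.n) (j : Fin T₂.n) {c₁ c₂ : 𝒩} {xs ys : List 𝒩}
    (hi : T₁.pre i = .input c₁ xs) (hj : T₂.pre j = .output c₂ ys) (hc : σ c₁ = σ c₂)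
    (hlen : xs.length = ys.length)
    (hP' : ∀ τ, IsSubstEffect τ (eqRel ((xs.zip ys).map (Prod.map σ σ))) →
      (Agent.scopes v ((Agent.par (body Sr σ)
        (.par ((T₁.cont i).map σ) ((T₂.cont j).map σ))).map τ)).Cong P') :
    ∃ t : Transition Label Act 𝒩, Derives (productions 𝒩) t ∧ t.src = J ∧ t.π = id ∧
      ∃ (v' w' : List 𝒩) (J' : Judgement Label 𝒩),
        IsTranslation P' v' w' J' ∧ EqualUpTo t.tgt J' := by
  set w := fnarray Ss with hw
  have hwperm : w.Perm (fnarray Sr ++ (T₁.occ ++ T₂.occ)) := by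
    refine (hperm.flatMap_right Seq.occ).symm.trans (.of_eq ?_)
    rw [List.flatMap_append]
    simp [fnarray]
  have hT₁w : ∀ x ∈ T₁.occ, x ∈ w := fun x hx => hwperm.mem_iff.2 (by simp [hx])
  have hT₂w : ∀ x ∈ T₂.occ, x ∈ w := fun x hx => hwperm.mem_iff.2 (by simp [hx])
  have hrw : ∀ x ∈ fnarray Sr, x ∈ w := fun x hx => hwperm.mem_iff.2 (by simp [hx])
  have hnd := List.nodup_append.1 (hwperm.nodup_iff.1 hwn)
  have hT := List.nodup_append.1 hnd.2.1
  have hT₁₂ : ∀ x ∈ T₁.occ, x ∉ T₂.occ := fun x hx hx' => hT.2.2 x hx x hx' rfl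
  have hpre₁ := T₁.occ_pre_subset i
  have hpre₂ := T₂.occ_pre_subset j
  rw [hi] at hpre₁
  rw [hj] at hpre₂
  have hc₁ : c₁ ∈ T₁.occ := hpre₁ List.mem_cons_self
  have hc₂ : c₂ ∈ T₂.occ := hpre₂ List.mem_cons_self
  have hxs : ∀ x ∈ xs, x ∈ T₁.occ := fun x hx => hpre₁ (List.mem_cons_of_mem _ hx)
  have hys : ∀ x ∈ ys, x ∈ T₂.occ := fun x hx => hpre₂ (List.mem_cons_of_mem _ hx)
  obtain ⟨ξ, -, hξ, -⟩ := exists_copy (v ++ w).toFinset (v ++ w).toFinset (v ++ w).toFinset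
  simp only [List.mem_toFinset] at hξ
  have hξw : ∀ z ∈ w, ξ z ∉ v ∧ ξ z ∉ w := fun z hz => by
    have := hξ z (List.mem_append_right _ hz) (List.mem_append_right _ hz)
    rwa [List.mem_append, not_or] at this
  let A : Finset 𝒩 := (v ++ w ++ w.map ξ).toFinset
  have hAmem : ∀ x, x ∈ A ↔ (x ∈ v ∨ x ∈ w) ∨ x ∈ w.map ξ := by
    intro x
    rw [List.mem_toFinset, List.mem_append, List.mem_append]
  have hgC₁ : ((T₁.cont i).map ξ).Guarded := (Agent.guarded_map _ _).2
    (guarded_cont_of_body hg (hperm.mem_iff.1 (by simp)) i)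
  have hgC₂ : ((T₂.cont j).map ξ).Guarded := (Agent.guarded_map _ _).2
    (guarded_cont_of_body hg (hperm.mem_iff.1 (by simp)) j)
  have hA₁ : ∀ x ∈ ((T₁.cont i).map ξ).occ, x ∈ A := by
    intro x hx
    rw [Agent.occ_map] at hx
    obtain ⟨z, hz, rfl⟩ := List.mem_map.1 hx
    exact (hAmem _).2 (.inr (List.mem_map_of_mem (hT₁w z (T₁.occ_cont_subset i hz))))
  have hA₂ : ∀ x ∈ ((T₂.cont j).map ξ).occ, x ∈ A := by
    intro x hx
    rw [Agent.occ_map] at hx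
    obtain ⟨z, hz, rfl⟩ := List.mem_map.1 hx
    exact (hAmem _).2 (.inr (List.mem_map_of_mem (hT₂w z (T₂.occ_cont_subset j hz))))
  obtain ⟨v₁, S₁, σ₁, hN₁⟩ := exists_isFreshNormalForm hgC₁ hA₁
  obtain ⟨v₂, S₂, σ₂, hN₂⟩ := exists_isFreshNormalForm hgC₂
    (A := A ∪ (v₁ ++ fnarray S₁).toFinset) fun x hx => Finset.mem_union_left _ (hA₂ x hx)
  have hN := hN₁.par hN₂ hA₂ le_rfl
  set σk : 𝒩 → 𝒩 := fun x => if x ∈ fnarray S₁ then σ₁ x else σ₂ x with hσk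
  have hAw : ∀ x, x ∈ v ∨ x ∈ w → x ∈ A := fun x hx => (hAmem x).2 (.inl hx)
  have hf₁ : ∀ x ∈ v₁ ++ fnarray S₁, x ∉ A := hN₁.fresh
  have hf₂ : ∀ x ∈ v₂ ++ fnarray S₂, x ∉ A ∧ x ∉ v₁ ++ fnarray S₁ := by
    intro x hx
    have := hN₂.fresh x hx
    rw [Finset.mem_union, not_or] at this
    exact ⟨this.1, fun h => this.2 (List.mem_toFinset.2 h)⟩
  obtain ⟨t₁, Cl₁, ht₁, hπ₁, hΓ₁, hG₁, hΛ₁, hΓ₁', hG₁', hp₁⟩ :=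
    exists_input_or_output_transition (T := T₁) (a := .inp xs.length) hT.1 i
      (by rw [hi]; exact .input c₁ xs)
      (by rw [hi]; rfl) (fun x _ y _ h => ξ.injective h)
      (fun x hx h => (hξw x (hT₁w x hx)).2 (hT₁w _ h)) hN₁ (fun x hx => hAw x (.inr (hT₁w x hx)))
  obtain ⟨t₂, Cl₂, ht₂, hπ₂, hΓ₂, hG₂, hΛ₂, hΓ₂', hG₂', hp₂⟩ :=
    exists_input_or_output_transition (T := T₂) (a := .out ys.length) hT.2.1 j
      (by rw [hj]; exact .output c₂ ys) (by rw [hj]; rfl) (fun x _ y _ h => ξ.injective h)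
      (fun x hx h => (hξw x (hT₂w x hx)).2 (hT₂w _ h)) hN₂
      (fun x hx => Finset.mem_union_left _ (hAw x (.inr (hT₂w x hx))))
  have hΓ₁'' : ∀ x ∈ t₁.src.Γ ∪ t₁.tgt.Γ,
      x ∈ T₁.occ ∨ x ∈ v₁ ++ fnarray S₁ ∨ x ∈ T₁.occ.map ξ := by
    intro x hx
    rw [Finset.mem_union, hΓ₁, List.mem_toFinset] at hx
    exact hx.elim .inl (hΓ₁' x)
  have hΓ₂'' : ∀ x ∈ t₂.src.Γ ∪ t₂.tgt.Γ,
      x ∈ T₂.occ ∨ x ∈ v₂ ++ fnarray S₂ ∨ x ∈ T₂.occ.map ξ := by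
    intro x hx
    rw [Finset.mem_union, hΓ₂, List.mem_toFinset] at hx
    exact hx.elim .inl (hΓ₂' x)
  have hξA : ∀ {z}, z ∈ w → ξ z ∈ A := fun hz => (hAmem _).2 (.inr (List.mem_map_of_mem hz))
  have hdisj : Disjoint (t₁.src.Γ ∪ t₁.tgt.Γ) (t₂.src.Γ ∪ t₂.tgt.Γ) := by
    rw [Finset.disjoint_left]
    intro x hx hx'
    rcases hΓ₁'' x hx with h | h | h <;> rcases hΓ₂'' x hx' with h' | h' | h'
    · exact hT₁₂ x h h'
    · exact (hf₂ x h').1 (hAw x (.inr (hT₁w x h)))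
    · obtain ⟨z, hz, rfl⟩ := List.mem_map.1 h'
      exact (hξw z (hT₂w z hz)).2 (hT₁w _ h)
    · exact hf₁ x h (hAw x (.inr (hT₂w x h')))
    · exact (hf₂ x h').2 h
    · obtain ⟨z, hz, rfl⟩ := List.mem_map.1 h'
      exact hf₁ _ h (hξA (hT₂w z hz))
    · obtain ⟨z, hz, rfl⟩ := List.mem_map.1 h
      exact (hξw z (hT₁w z hz)).2 (hT₂w _ h')
    · obtain ⟨z, hz, rfl⟩ := List.mem_map.1 h
      exact (hf₂ _ h').1 (hξA (hT₁w z hz))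
    · obtain ⟨z, hz, rfl⟩ := List.mem_map.1 h
      obtain ⟨z', hz', h'⟩ := List.mem_map.1 h'
      exact hT₁₂ z hz (ξ.injective h' ▸ hz')
  have hold : ∀ x, x ∈ v ∨ x ∈ w → x ∈ t₁.tgt.Γ ∪ t₂.tgt.Γ → x ∈ t₁.src.Γ ∪ t₂.src.Γ := by
    intro x hx hx'
    rw [Finset.mem_union, hΓ₁, hΓ₂, List.mem_toFinset, List.mem_toFinset]
    rcases Finset.mem_union.1 hx' with h | h
    · rcases hΓ₁' x h with h | h | h
      · exact .inl h
      · exact (hf₁ x h (hAw x hx)).elim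
      · obtain ⟨z, hz, rfl⟩ := List.mem_map.1 h
        exact (hx.elim (hξw z (hT₁w z hz)).1 (hξw z (hT₁w z hz)).2).elim
    · rcases hΓ₂' x h with h | h | h
      · exact .inr h
      · exact ((hf₂ x h).1 (hAw x hx)).elim
      · obtain ⟨z, hz, rfl⟩ := List.mem_map.1 h
        exact (hx.elim (hξw z (hT₂w z hz)).1 (hξw z (hT₂w z hz)).2).elim
  -- the router that connects the subjects of the two prefixes
  have hx₀ : σ c₁ ∈ w.map σ := List.mem_map_of_mem (hT₁w c₁ hc₁)
  obtain ⟨b, cs, hbcs, hrouter⟩ := router_eq_mEdge hx₀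
  have hbmem : ∀ x, x ∈ b :: cs ↔ x ∈ w ∧ σ x = σ c₁ := by
    intro x
    rw [← hbcs, List.mem_filter, decide_eq_true_eq]
  have hcw : ∀ x ∈ w, x ∉ w.map σ := by
    intro x hx h
    obtain ⟨z, hz, rfl⟩ := List.mem_map.1 h
    exact hwv _ hx (hσ z hz)
  have hrnd : (σ c₁ :: b :: cs).Nodup := by
    refine List.nodup_cons.2 ⟨fun h => hcw _ ((hbmem _).1 h).1 hx₀, ?_⟩
    rw [← hbcs]
    exact hwn.filter _
  have hrmem : ∀ x ∈ σ c₁ :: b :: cs, x ∈ v ∨ x ∈ w := by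
    intro x hx
    rcases List.mem_cons.1 hx with rfl | hx
    · exact .inl (hσ _ (hT₁w c₁ hc₁))
    · exact .inr ((hbmem x).1 hx).1
  have hr₁ : c₁ ∈ b :: cs := (hbmem _).2 ⟨hT₁w _ hc₁, rfl⟩
  have hr₂ : c₂ ∈ b :: cs := (hbmem _).2 ⟨hT₂w _ hc₂, hc.symm⟩
  obtain ⟨t, ht, hπt, hΓt, hGt, hΛt, hΓt', hGt'⟩ := exists_comm_transition ht₁ ht₂ hπ₁ hπ₂ hdisj
    hlen hΛ₁ hΛ₂ (by rwa [hΓ₁, List.mem_toFinset]) (by rwa [hΓ₂, List.mem_toFinset])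
    (fun x hx => by rw [hΓ₁, List.mem_toFinset]; exact hxs x hx)
    (fun x hx => by rw [hΓ₂, List.mem_toFinset]; exact hys x hx) hrnd
    (List.mem_cons_of_mem _ hr₁) (List.mem_cons_of_mem _ hr₂)
    (fun x hx => hold x (hrmem x hx))
  obtain ⟨Gr, hGr⟩ : ∃ Gr, substGraph w σ = mEdge (σ c₁) b cs ::ₘ Gr :=
    Multiset.exists_cons_of_mem (mem_substGraph.2 ⟨c₁, hT₁w c₁ hc₁, hrouter⟩)
  -- the nodes of the subjects are not attached to other edges of the context
  have hGr₀ : ∀ x ∈ b :: cs, x ∉ Graph.names Gr := by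
    intro x hx h
    have h1 := edgeCount_substGraph hcw x
    rw [if_pos (.inl ((hbmem x).1 hx).1), hGr, edgeCount_cons,
      if_pos (show x ∈ (mEdge (σ c₁) b cs).att from List.mem_cons_of_mem _ hx)] at h1
    obtain ⟨e, he, hxe⟩ := Graph.mem_names.1 h
    exact notMem_att_of_edgeCount_eq_zero (by omega) he hxe
  have hsg : ∀ x ∈ Graph.names (substGraph w σ), x ∈ v ∨ x ∈ w := by
    intro x hx
    rcases mem_names_substGraph.1 hx with hx | hx
    · exact .inr hx
    · obtain ⟨y, hy, rfl⟩ := List.mem_map.1 hx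
      exact .inl (hσ y hy)
  let K : Judgement Label 𝒩 := ⟨((v ++ w).filter fun x => x ≠ c₁ ∧ x ≠ c₂).toFinset,
    procs Sr + Gr + nEdges v, by
      intro x hx
      simp only [Graph.names_add, Finset.mem_union, mem_names_procs, mem_names_nEdges] at hx
      rw [List.mem_toFinset, List.mem_filter, List.mem_append, decide_eq_true_eq]
      rcases hx with (hx | hx) | hx
      · refine ⟨.inr (hrw x hx), ?_, ?_⟩
        · rintro rfl
          exact hnd.2.2 x hx x (List.mem_append_left _ hc₁) rfl
        · rintro rfl
          exact hnd.2.2 x hx x (List.mem_append_right _ hc₂) rfl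
      · refine ⟨hsg x ?_, ?_, ?_⟩
        · obtain ⟨e, he, hxe⟩ := Graph.mem_names.1 hx
          exact Graph.mem_names.2 ⟨e, hGr ▸ Multiset.mem_cons_of_mem he, hxe⟩
        · rintro rfl
          exact hGr₀ x hr₁ hx
        · rintro rfl
          exact hGr₀ x hr₂ hx
      · refine ⟨.inl hx, ?_, ?_⟩
        · rintro rfl
          exact hwv x (hT₁w x hc₁) hx
        · rintro rfl
          exact hwv x (hT₂w x hc₂) hx⟩
  have hKmem : ∀ x, x ∈ K.Γ ↔ (x ∈ v ∨ x ∈ w) ∧ x ≠ c₁ ∧ x ≠ c₂ := by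
    intro x
    change x ∈ ((v ++ w).filter fun x => x ≠ c₁ ∧ x ≠ c₂).toFinset ↔ _
    rw [List.mem_toFinset, List.mem_filter, List.mem_append, decide_eq_true_eq]
  obtain ⟨t', ht', hπt', hΓ', hG', hG''⟩ := ht.exists_context hπt K
    (fun x hx _ => hΛt x ((hKmem x).1 hx).2.1 ((hKmem x).1 hx).2.2) (by
      intro x hx hx'
      refine (hΓt' x hx').elim (fun h => ?_) id
      rw [hΓt]
      exact Finset.mem_union_left _ (hold x ((hKmem x).1 hx).1 h))
  refine ⟨t', ht', Judgement.ext ?_ ?_, hπt', ?_⟩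
  · ext x
    rw [hΓ', hΓt, hΓ, Finset.mem_union, Finset.mem_union, Finset.mem_union, hΓ₁, hΓ₂, hKmem,
      List.mem_toFinset, List.mem_toFinset, List.mem_toFinset, List.mem_toFinset,
      List.mem_append (s := v)]
    constructor
    · rintro (((h | h) | h) | h)
      · exact .inr (hT₁w x h)
      · exact .inr (hT₂w x h)
      · exact hrmem x h
      · exact h.1
    · intro h
      by_cases h1 : x = c₁
      · exact .inl (.inl (.inl (h1 ▸ hc₁)))
      · by_cases h2 : x = c₂
        · exact .inl (.inl (.inr (h2 ▸ hc₂)))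
        · exact .inr ⟨h, h1, h2⟩
  · rw [hG', hGt, hG₁, hG₂, hG, ← procs_perm hperm, procs_append, hGr]
    change {procEdge T₁} + {procEdge T₂} + {mEdge (σ c₁) b cs} + (procs Sr + Gr + nEdges v) =
      procs Sr + (procEdge T₁ ::ₘ {procEdge T₂}) + (mEdge (σ c₁) b cs ::ₘ Gr) + nEdges v
    rw [← Multiset.singleton_add, ← Multiset.singleton_add]
    abel
  · have hzf : (xs.zip ys).map Prod.fst = xs := List.map_fst_zip hlen.le
    have hzs : (xs.zip ys).map Prod.snd = ys := List.map_snd_zip hlen.ge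
    refine exists_translation_equalUpTo (L := xs.zip ys) (C := .par (T₁.cont i) (T₂.cont j))
      (Cl := Cl₁ ++ Cl₂) hv hwn hwv hσ hσ' ?_ hP' ξ ?_ hN
      (fun x hx => hAw x (List.mem_append.1 hx)) _ ?_
    · rw [hzf, hzs]
      refine hwperm.trans (.append_left _ ((hp₁.append hp₂).trans ?_))
      rw [List.perm_iff_count]
      intro x
      simp only [Agent.occ, List.count_append]
      omega
    · intro z hz
      rcases List.mem_append.1 hz with hz | hz
      · exact hξw z (hT₁w z (T₁.occ_cont_subset i hz))
      · exact hξw z (hT₂w z (T₂.occ_cont_subset j hz))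
    · have h1 : ∀ x ∈ fnarray S₁, σk x = σ₁ x := fun x hx => if_pos hx
      have h2 : ∀ x ∈ fnarray S₂, σk x = σ₂ x := fun x hx =>
        if_neg fun h => (hf₂ x (List.mem_append_right _ hx)).2 (List.mem_append_right _ h)
      have hsplit : substGraph (fnarray (S₁ ++ S₂)) σk =
          substGraph (fnarray S₁) σ₁ + substGraph (fnarray S₂) σ₂ := by
        rw [fnarray_append, substGraph_append, substGraph_congr h1, substGraph_congr h2]
        intro x hx y hy hxy
        rw [h1 x hx, h2 y hy] at hxy
        have hx' := (hN₁.mem_map_iff _).1 (List.mem_map_of_mem hx)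
        have hy' := (hN₂.mem_map_iff _).1 (List.mem_map_of_mem hy)
        rw [← hxy] at hy'
        rcases hx' with h | h <;> rcases hy' with h' | h'
        · exact (hf₂ _ (List.mem_append_left _ h')).2 (List.mem_append_left _ h)
        · exact hf₁ _ (List.mem_append_left _ h) (hA₂ _ h')
        · exact (hf₂ _ (List.mem_append_left _ h')).1 (hA₁ _ h)
        · rw [Agent.occ_map] at h h'
          obtain ⟨z, hz, h⟩ := List.mem_map.1 h
          obtain ⟨z', hz', h'⟩ := List.mem_map.1 h'
          have := ξ.injective (h.trans h'.symm)
          exact hT₁₂ z (T₁.occ_cont_subset i hz) (this ▸ T₂.occ_cont_subset j hz')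
      rw [hG'', hGt', hG₁', hG₂', hsplit, hGr, contGraph, contGraph, procs_append, procs_append,
        nEdges_append, nEdges_append, ← Multiset.singleton_add]
      simp only [Agent.occ, List.map_append, links_append]
      change _ + (procs Sr + Gr + nEdges v) = _
      abel

/-- Every reduction of a closed agent is simulated by a transition of its translation. -/
theorem exists_transition_of_red [Infinite 𝒩] {P P' : Agent 𝒩 Empty} (hclosed : P.Closed)
    (hguarded : P.Guarded) (hred : Red P P') {v w : List 𝒩} {J : Judgement Label 𝒩}
    (hJ : IsTranslation P v w J) :
    ∃ t : Transition Label Act 𝒩, Derives (productions 𝒩) t ∧ t.src = J ∧ t.π = id ∧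
      ∃ (v' w' : List 𝒩) (J' : Judgement Label 𝒩),
        IsTranslation P' v' w' J' ∧ EqualUpTo t.tgt J' := by
  obtain ⟨Ss, σ, rfl, hv, hw, hwv, hσ, hσ', hcong, hΓ, hG⟩ := hJ.exists_canonical hclosed
  have hg := hcong.guarded_iff.2 hguarded
  have hg' : (body Ss σ).Guarded := (Agent.guarded_scopes _ _).1 hg
  cases hred.normalStep hv hσ hg hcong with
  | comm Sr T₁ T₂ hperm i j c₁ c₂ xs ys hi hj hc hlen hP' =>
    exact exists_comm_step_transition hv hw hwv hσ hσ' hg' hΓ hG hperm i j hi hj hc hlen hP'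
  | fuse Sr T hperm i E hi hP' =>
    exact exists_fuse_transition hv hw hwv hσ hσ' hg' hΓ hG hperm i hi hP'

end

end FusionSHR

open FusionSHR
theorem mainTheorem1 {𝒩 : Type} [DecidableEq 𝒩] [Infinite 𝒩]
    (P P' : Agent 𝒩 Empty) (hclosed : P.Closed) (hguarded : P.Guarded) (hred : Red P P')
    (v w : List 𝒩) (J : Judgement Label 𝒩) (hJ : IsTranslation P v w J) :
    ∃ t : Transition Label Act 𝒩,
      Derives (productions 𝒩) t ∧ t.src = J ∧ t.π = id ∧
      ∃ (v' w' : List 𝒩) (J' : Judgement Label 𝒩),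
        IsTranslation P' v' w' J' ∧ EqualUpTo t.tgt J' := by
  exact exists_transition_of_red hclosed hguarded hred hJ
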